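/- Let $K$ be a field and let $E$ be an elliptic curve over $K$ with origin $O$ and function field $K(E)$. Regard $E(K(E))$ as the group of rational maps from $E$ to $E$ defined over $K$, with pointwise addition. Let $\operatorname{End}_K(E)$ be the set of morphisms $E \to E$ over $K$ that fix $O$; these are homomorphisms for the group law and form a ring under pointwise addition and composition. Then there is a short exact sequence of abelian groups $$0 \to E(K) \to E(K(E)) \to \operatorname{End}_K(E) \to 0,$$ where the first map sends a point to the corresponding constant map and the second sends a rational map $g$ to the endomorphism that differs from $g$ by a constant in $E(K)$. Say that $E$ has $K$-rational CM if $\operatorname{End}_K(E)$ is larger than $\mathbb{Z}$, that is, if it contains an element that is not multiplication by an integer. Then $\operatorname{End}_K(E) \cong \mathbb{Z}^{a}$ as abelian groups, where - $a = 1$ if $E$ does not have $K$-rational CM; - $a = 2$ if $E$ has $K$-rational CM and $\operatorname{End}_K(E)$ is commutative; - $a = 4$ if $\operatorname{End}_K(E)$ is not commutative, which does not happen if $K$ has characteristic zero. Consequently $E(K(E)) \cong E(K) \oplus \mathbb{Z}^{a}$. -/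

import Mathlib

open scoped WeierstrassCurve.Affine

namespace EllipticEnd

/-- Homogeneous coordinates `[x : y : z]` in the projective plane over `L` of a point of `E(L)`:
the origin is `[0 : 1 : 0]`, and the affine point `(x, y)` is `[x : y : 1]`. -/
def coords {L : Type*} [CommRing L] {E : WeierstrassCurve.Affine L} : E.Point → Fin 3 → L
  | .zero => ![0, 1, 0]
  | .some x y _ => ![x, y, 1]

/-- Two triples are the same up to a unit (so, over a field, two nonzero triples represent the same
point of the projective plane if and only if this holds). -/
def SamePoint {L : Type*} [CommRing L] (v w : Fin 3 → L) : Prop :=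
  ∃ u : Lˣ, v = (u : L) • w

section

variable {K : Type*} [Field K]

/-- The values at a triple `v` over an extension `L` of `K` of three polynomials over `K`. -/
noncomputable def evalTriple {L : Type*} [CommRing L] [Algebra K L]
    (f : Fin 3 → MvPolynomial (Fin 3) K) (v : Fin 3 → L) : Fin 3 → L :=
  fun i => MvPolynomial.aeval v (f i)

/-- The triple `f` of homogeneous polynomials over `K` of the same degree, where it does not vanish
identically, computes the map `φ : E(K̄) → E(K̄)`: we have `φ(Q) = [f₀(Q) : f₁(Q) : f₂(Q)]` at every
geometric point `Q` at which `f₀, f₁, f₂` have no common zero. -/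
def Computes (E : WeierstrassCurve.Affine K) (f : Fin 3 → MvPolynomial (Fin 3) K)
    (φ : (E⁄(AlgebraicClosure K)).Point → (E⁄(AlgebraicClosure K)).Point) : Prop :=
  (∃ d : ℕ, ∀ i, (f i).IsHomogeneous d) ∧
    ∀ Q : (E⁄(AlgebraicClosure K)).Point,
      evalTriple f (coords Q) ≠ 0 → SamePoint (coords (φ Q)) (evalTriple f (coords Q))

/-- `φ` is a morphism `E → E` of projective curves defined over `K`, described by its effect on
geometric points: near every point of `E(K̄)` it is given by a triple of homogeneous polynomials
of the same degree, with coefficients in `K` and without common zero at that point. -/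
def IsMorphism (E : WeierstrassCurve.Affine K)
    (φ : (E⁄(AlgebraicClosure K)).Point → (E⁄(AlgebraicClosure K)).Point) : Prop :=
  ∀ P : (E⁄(AlgebraicClosure K)).Point, ∃ f : Fin 3 → MvPolynomial (Fin 3) K,
    evalTriple f (coords P) ≠ 0 ∧ Computes E f φ

/-- `φ` is an endomorphism of the elliptic curve `(E, O)` over `K`: a morphism `E → E` over `K`
that fixes the origin `O`. -/
def IsEndomorphism (E : WeierstrassCurve.Affine K)
    (φ : (E⁄(AlgebraicClosure K)).Point → (E⁄(AlgebraicClosure K)).Point) : Prop :=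
  IsMorphism E φ ∧ φ 0 = 0

/-- Homogeneous coordinates `[x : y : 1]` of the generic point of `E`, where `x` and `y` are the
coordinate functions in the function field `K(E)`. -/
noncomputable def genericCoords (E : WeierstrassCurve.Affine K) : Fin 3 → E.FunctionField :=
  ![algebraMap E.CoordinateRing E.FunctionField
      (WeierstrassCurve.Affine.CoordinateRing.mk E (Polynomial.C Polynomial.X)),
    algebraMap E.CoordinateRing E.FunctionField
      (WeierstrassCurve.Affine.CoordinateRing.mk E Polynomial.X),
    1]

/-- The `K(E)`-rational point `g` of `E`, seen as a rational map from `E` to `E`, is the one that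
the map `φ` on geometric points induces: some triple of homogeneous polynomials over `K` has the
value `g` at the generic point (in particular it does not vanish identically on `E`), and computes
`φ`. -/
def Represents (E : WeierstrassCurve.Affine K) (g : (E⁄E.FunctionField).Point)
    (φ : (E⁄(AlgebraicClosure K)).Point → (E⁄(AlgebraicClosure K)).Point) : Prop :=
  ∃ f : Fin 3 → MvPolynomial (Fin 3) K,
    SamePoint (coords g) (evalTriple f (genericCoords E)) ∧ Computes E f φ

/-- The subring `R` of the ring of group endomorphisms of `E(K̄)` is `End_K(E)`: its elements are
exactly the endomorphisms of the elliptic curve `E` over `K`. In particular, every morphism `E → E`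
over `K` that fixes `O` is then a group homomorphism on geometric points, and `End_K(E)` is closed
under pointwise addition and composition. There is at most one such `R`. -/
def IsEndRing (E : WeierstrassCurve.Affine K) [DecidableEq (AlgebraicClosure K)]
    (R : Subring (AddMonoid.End (E⁄(AlgebraicClosure K)).Point)) : Prop :=
  ∀ φ : (E⁄(AlgebraicClosure K)).Point → (E⁄(AlgebraicClosure K)).Point,
    IsEndomorphism E φ ↔ ∃ r ∈ R, ⇑r = φ

/-- `E` has `K`-rational complex multiplication, where `R` is `End_K(E)`: some endomorphism of `E`
over `K` is not multiplication by an integer, that is, `End_K(E)` is larger than `ℤ`. -/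
def HasCM {E : WeierstrassCurve.Affine K} [DecidableEq (AlgebraicClosure K)]
    (R : Subring (AddMonoid.End (E⁄(AlgebraicClosure K)).Point)) : Prop :=
  ∃ r : R, ∀ n : ℤ, r ≠ (n : R)

end

end EllipticEnd

namespace EllipticEnd

open WeierstrassCurve

/-! The function field has a place at each geometric point `Q`, and projective coordinates can be
scaled to have finite values there, not all zero. So a point `g` of `E(K(E))` specializes at `Q` to
a point `pointMap E g Q`. Specialization is a homomorphism (`Place.Specializes.add`), and `pointMap`
is a bijection from `E(K(E))` onto the self-morphisms of `E` over `K` (`isMor_pointMap`,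
`exists_pointMap_eq`, `pointMap_injective`). Subtracting the value at `O`, which is rational over
`K`, gives the map `endOf` to endomorphisms, whose kernel consists of the constants. The sequence
splits because its quotient turns out to be free.

A morphism that fixes `O` is additive: the map `Q ↦ φ (T + Q) + φ (T - Q)` is even, so it factors
through the projective line, and a rational curve on a smooth cubic is constant
(`exists_const_of_equation`). In particular `φ` is odd, so it acts on `x`-coordinates by a reduced
fraction `p / q` (`XRep`), and the degree of `p` is the degree of `φ`.

The degree is multiplicative (`XRep.comp`) and satisfies the parallelogram law
(`XRep.parallelogram`, `exists_degree_form`), so it is an integral, multiplicative, anisotropic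
quadratic form on the endomorphism ring. As in a composition algebra, every element is then a root
of an integral quadratic polynomial, and orthogonal elements of trace zero anticommute. Hence `1`,
or `1, i`, or `1, i, j, ij` is a complete orthogonal family, according to the case, and its length
is the rank (`NormForm.nonempty_addEquiv`). Neither dual isogenies nor Tate modules enter.

The leading coefficient of `x * q / p` at infinity is the square of the scalar by which `φ` acts on
the invariant differential. In characteristic zero its square root is an injective ring homomorphism
to a field, so the ring is commutative (`NormForm.mul_comm_of_rank_one`). -/

instance {K S : Type*} [Field K] [CommRing S] [Algebra K S] (E : Affine K) [E.IsElliptic] :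
    WeierstrassCurve.IsElliptic (E⁄S) :=
  inferInstanceAs (WeierstrassCurve.map E (algebraMap K S)).IsElliptic

/-! ### Projective coordinates of points -/

section SamePoint

variable {L : Type*} [Field L]

lemma SamePoint.refl (v : Fin 3 → L) : SamePoint v v := ⟨1, by simp⟩

lemma SamePoint.symm {v w : Fin 3 → L} : SamePoint v w → SamePoint w v := by
  rintro ⟨u, rfl⟩
  exact ⟨u⁻¹, by rw [smul_smul]; simp⟩

lemma SamePoint.trans {v w x : Fin 3 → L} : SamePoint v w → SamePoint w x → SamePoint v x := by
  rintro ⟨u, rfl⟩ ⟨u', rfl⟩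
  exact ⟨u * u', by rw [smul_smul]; simp⟩

lemma samePoint_smul {a : L} (ha : a ≠ 0) (v : Fin 3 → L) : SamePoint (a • v) v :=
  ⟨Units.mk0 a ha, rfl⟩

lemma SamePoint.ne_zero {v w : Fin 3 → L} (h : SamePoint v w) (hv : v ≠ 0) : w ≠ 0 := by
  rintro rfl
  obtain ⟨u, rfl⟩ := h
  simp at hv

lemma SamePoint.cross {v w : Fin 3 → L} (h : SamePoint v w) (i j : Fin 3) :
    v i * w j = v j * w i := by
  obtain ⟨u, rfl⟩ := h
  simp only [Pi.smul_apply, smul_eq_mul]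
  ring

lemma samePoint_of_cross {v w : Fin 3 → L} (hv : v ≠ 0) (hw : w ≠ 0)
    (h : ∀ i j, v i * w j = v j * w i) : SamePoint v w := by
  obtain ⟨j, hj⟩ := Function.ne_iff.mp hw
  have hj : w j ≠ 0 := hj
  have hvj : v j ≠ 0 := by
    intro h0
    apply hv
    funext i
    have := h i j
    rw [h0, zero_mul] at this
    exact (mul_eq_zero.mp this).resolve_right hj
  refine ⟨Units.mk0 (v j / w j) (div_ne_zero hvj hj), ?_⟩
  funext i
  simp only [Units.val_mk0, Pi.smul_apply, smul_eq_mul]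
  field_simp
  rw [h i j]

lemma coords_ne_zero {W : Affine L} (P : W.Point) : coords P ≠ 0 := by
  intro h
  cases P with
  | zero => simpa [coords] using congrFun h 1
  | some x y hxy => simpa [coords] using congrFun h 2

lemma samePoint_iff_orbitRel {v w : Fin 3 → L} :
    SamePoint v w ↔ (MulAction.orbitRel Lˣ (Fin 3 → L)).r v w := by
  constructor
  · rintro ⟨u, rfl⟩
    exact ⟨u, rfl⟩
  · rintro ⟨u, rfl⟩
    exact ⟨u, rfl⟩

lemma nonsingular_coords {W : Affine L} (P : W.Point) :
    Projective.Nonsingular W (coords P) := by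
  cases P with
  | zero => exact Projective.nonsingular_zero
  | some x y h => exact (Projective.nonsingular_some x y).mpr h

lemma toAffine_coords {W : Affine L} (P : W.Point) :
    Projective.Point.toAffine W (coords P) = P := by
  cases P with
  | zero => exact Projective.Point.toAffine_zero
  | some x y h => exact Projective.Point.toAffine_some ((Projective.nonsingular_some x y).mpr h)

lemma SamePoint.nonsingular {W : Affine L} {P : W.Point} {v : Fin 3 → L}
    (h : SamePoint (coords P) v) : Projective.Nonsingular W v :=
  (Projective.nonsingular_of_equiv (samePoint_iff_orbitRel.mp h)).mp (nonsingular_coords P)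

lemma SamePoint.toAffine_eq {W : Affine L} {P : W.Point} {v : Fin 3 → L}
    (h : SamePoint (coords P) v) : Projective.Point.toAffine W v = P := by
  rw [← Projective.Point.toAffine_of_equiv (samePoint_iff_orbitRel.mp h), toAffine_coords]

lemma samePoint_toAffine {W : Affine L} {v : Fin 3 → L} (h : Projective.Nonsingular W v) :
    SamePoint (coords (Projective.Point.toAffine W v)) v := by
  by_cases hz : v 2 = 0
  · rw [Projective.Point.toAffine_of_Z_eq_zero hz]
    exact (samePoint_iff_orbitRel.mpr (Projective.equiv_zero_of_Z_eq_zero h hz)).symm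
  · rw [Projective.Point.toAffine_of_Z_ne_zero h hz]
    exact (samePoint_iff_orbitRel.mpr (Projective.equiv_some_of_Z_ne_zero hz)).symm

lemma eq_of_samePoint {W : Affine L} {P Q : W.Point} {v : Fin 3 → L}
    (h : SamePoint (coords P) v) (h' : SamePoint (coords Q) v) : P = Q := by
  rw [← h.toAffine_eq, ← h'.toAffine_eq]

lemma nonsingular_of_equation {W : Affine L} [W.IsElliptic] {v : Fin 3 → L} (hv : v ≠ 0)
    (h : Projective.Equation W v) : Projective.Nonsingular W v := by
  by_cases hz : v 2 = 0
  · refine (Projective.nonsingular_of_Z_eq_zero hz).mpr ⟨h, ?_⟩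
    have hx : v 0 = 0 := Projective.X_eq_zero_of_Z_eq_zero h hz
    have hy : v 1 ≠ 0 := by
      intro hy
      apply hv
      funext i
      fin_cases i <;> assumption
    simp [hx, hy]
  · rw [Projective.nonsingular_of_Z_ne_zero hz]
    rw [Projective.equation_of_Z_ne_zero hz] at h
    exact Affine.equation_iff_nonsingular.mp h

lemma exists_samePoint {W : Affine L} [W.IsElliptic] {v : Fin 3 → L} (hv : v ≠ 0)
    (h : Projective.Equation W v) : ∃ P : W.Point, SamePoint (coords P) v :=
  ⟨_, samePoint_toAffine (nonsingular_of_equation hv h)⟩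

/-- The polynomials `addXYZ` describe the chord construction, hence the condition `hPQ`. Being
polynomials, they are compatible with specialization. -/
lemma SamePoint.add [DecidableEq L] {W : Affine L} {P Q : W.Point} {v w : Fin 3 → L}
    (h : SamePoint (coords P) v) (h' : SamePoint (coords Q) w) (hPQ : P ≠ Q) :
    SamePoint (coords (P + Q)) (Projective.addXYZ W v w) := by
  have hn : ¬ (MulAction.orbitRel Lˣ (Fin 3 → L)).r v w := fun hvw =>
    hPQ (eq_of_samePoint h (h'.trans (samePoint_iff_orbitRel.mpr hvw).symm))
  rw [← Projective.add_of_not_equiv hn, ← h.toAffine_eq, ← h'.toAffine_eq,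
    ← Projective.Point.toAffine_add h.nonsingular h'.nonsingular]
  exact samePoint_toAffine (Projective.nonsingular_add h.nonsingular h'.nonsingular)

end SamePoint

/-! ### Places of a field and specialization of points -/

/-- A place of `F` over `K` with values in `Ω`, given by the graph of its finite part. -/
structure Place (K F Ω : Type*) [Field K] [Field F] [Field Ω] [Algebra K F] [Algebra K Ω] extends
    Subalgebra K (F × Ω) where
  eq_zero_of_zero_mem : ∀ c, (0, c) ∈ carrier → c = 0
  exists_mem_or_inv_mem : ∀ f : F, (∃ c, (f, c) ∈ carrier) ∨ (f⁻¹, 0) ∈ carrier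

namespace Place

variable {K F Ω : Type*} [Field K] [Field F] [Field Ω] [Algebra K F] [Algebra K Ω]
  (A : Place K F Ω)

/-- The function `f` has the finite value `c` at the place `A`. -/
def Val (f : F) (c : Ω) : Prop := (f, c) ∈ A.toSubalgebra

variable {A} {f g : F} {c d : Ω}

lemma Val.add (h : A.Val f c) (h' : A.Val g d) : A.Val (f + g) (c + d) :=
  A.toSubalgebra.add_mem h h'

lemma Val.mul (h : A.Val f c) (h' : A.Val g d) : A.Val (f * g) (c * d) :=
  A.toSubalgebra.mul_mem h h'

lemma Val.neg (h : A.Val f c) : A.Val (-f) (-c) := A.toSubalgebra.neg_mem h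

lemma Val.sub (h : A.Val f c) (h' : A.Val g d) : A.Val (f - g) (c - d) :=
  A.toSubalgebra.sub_mem h h'

lemma Val.pow (h : A.Val f c) (n : ℕ) : A.Val (f ^ n) (c ^ n) := A.toSubalgebra.pow_mem h n

lemma val_algebraMap (a : K) : A.Val (algebraMap K F a) (algebraMap K Ω a) :=
  A.toSubalgebra.algebraMap_mem a

lemma val_zero : A.Val 0 0 := A.toSubalgebra.zero_mem

lemma val_one : A.Val 1 1 := A.toSubalgebra.one_mem

lemma Val.unique (h : A.Val f c) (h' : A.Val f d) : c = d := by
  have := h.sub h'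
  rw [sub_self] at this
  exact sub_eq_zero.mp (A.eq_zero_of_zero_mem _ this)

lemma Val.ne_zero (h : A.Val f c) (hc : c ≠ 0) : f ≠ 0 := by
  rintro rfl
  exact hc (h.unique val_zero)

lemma val_or_inv (f : F) : (∃ c, A.Val f c) ∨ A.Val f⁻¹ 0 := A.exists_mem_or_inv_mem f

lemma Val.inv (h : A.Val f c) (hc : c ≠ 0) : A.Val f⁻¹ c⁻¹ := by
  have hf := h.ne_zero hc
  rcases A.val_or_inv f⁻¹ with ⟨d, hd⟩ | h'
  · have := h.mul hd
    rw [mul_inv_cancel₀ hf] at this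
    rwa [inv_eq_of_mul_eq_one_right (this.unique val_one)]
  · rw [inv_inv] at h'
    exact absurd (h.unique h') hc

lemma Val.div (h : A.Val f c) (h' : A.Val g d) (hd : d ≠ 0) : A.Val (f / g) (c / d) := by
  rw [div_eq_mul_inv, div_eq_mul_inv]
  exact h.mul (h'.inv hd)

lemma val_div_or (f g : F) :
    (∃ c, A.Val (f / g) c) ∨ (f ≠ 0 ∧ ∃ c, A.Val (g / f) c) := by
  rcases A.val_or_inv (f / g) with h | h
  · exact .inl h
  · by_cases hf : f = 0
    · left
      exact ⟨0, by rw [hf, zero_div]; exact val_zero⟩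
    · exact .inr ⟨hf, 0, by rwa [inv_div] at h⟩

/-- Of two functions one divides the other at the place, so some nonzero coordinate divides all
three. Dividing by it gives finite values, one of which is `1`. -/
lemma exists_scale (A : Place K F Ω) {v : Fin 3 → F} (hv : v ≠ 0) :
    ∃ a : F, a ≠ 0 ∧ ∃ w : Fin 3 → Ω, w ≠ 0 ∧ ∀ i, A.Val (a * v i) (w i) := by
  obtain ⟨j, hj, hm⟩ : ∃ j, v j ≠ 0 ∧ ∀ i, ∃ c, A.Val (v i / v j) c := by
    have key : ∀ s : Finset (Fin 3), (∃ j ∈ s, v j ≠ 0) →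
        ∃ j, v j ≠ 0 ∧ ∀ i ∈ s, ∃ c, A.Val (v i / v j) c := by
      intro s
      induction s using Finset.induction_on with
      | empty => simp
      | insert m s hm ih =>
        intro hs
        by_cases h : ∃ j ∈ s, v j ≠ 0
        · obtain ⟨j, hj, hjs⟩ := ih h
          rcases A.val_div_or (v m) (v j) with h' | ⟨hmn, d, hd⟩
          · refine ⟨j, hj, fun i hi => ?_⟩
            rcases Finset.mem_insert.mp hi with rfl | hi
            exacts [h', hjs i hi]
          · refine ⟨m, hmn, fun i hi => ?_⟩
            rcases Finset.mem_insert.mp hi with rfl | hi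
            · exact ⟨1, by rw [div_self hmn]; exact val_one⟩
            · obtain ⟨c, hc⟩ := hjs i hi
              exact ⟨c * d, by simpa only [div_mul_div_cancel₀ hj] using hc.mul hd⟩
        · push Not at h
          obtain ⟨j, hj, hjv⟩ := hs
          obtain rfl : j = m := by
            rcases Finset.mem_insert.mp hj with h' | h'
            exacts [h', absurd (h j h') hjv]
          refine ⟨j, hjv, fun i hi => ?_⟩
          rcases Finset.mem_insert.mp hi with rfl | hi
          · exact ⟨1, by rw [div_self hjv]; exact val_one⟩
          · exact ⟨0, by rw [h i hi, zero_div]; exact val_zero⟩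
    obtain ⟨j, hj⟩ := Function.ne_iff.mp hv
    obtain ⟨j, hj, h⟩ := key Finset.univ ⟨j, Finset.mem_univ _, hj⟩
    exact ⟨j, hj, fun i => h i (Finset.mem_univ i)⟩
  choose w hw using hm
  refine ⟨(v j)⁻¹, inv_ne_zero hj, w, ?_, fun i => ?_⟩
  · intro h0
    have h1 := hw j
    rw [div_self hj, h0] at h1
    exact one_ne_zero (val_one.unique h1)
  · rw [mul_comm, ← div_eq_mul_inv]
    exact hw i

variable (E : Affine K)

variable (A) in
/-- The point `P` of `E(F)` specializes to the point `Q` of `E(Ω)` at the place `A`. -/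
def Specializes {E : Affine K} (P : (E⁄F).Point) (Q : (E⁄Ω).Point) : Prop :=
  ∃ (v : Fin 3 → F) (w : Fin 3 → Ω), (∀ i, A.Val (v i) (w i)) ∧
    SamePoint (coords P) v ∧ SamePoint (coords Q) w

variable {E}

/-- A triple of functions with finite values, as a triple over the ring of the place. -/
def lift {v : Fin 3 → F} {w : Fin 3 → Ω} (h : ∀ i, A.Val (v i) (w i)) :
    Fin 3 → A.toSubalgebra := fun i => ⟨(v i, w i), h i⟩

variable (A) in
/-- The inclusion of the ring of the place into the field. -/
def toField : A.toSubalgebra →ₐ[K] F := (AlgHom.fst K F Ω).comp A.toSubalgebra.val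

variable (A) in
/-- The residue map of the place. -/
def residue : A.toSubalgebra →ₐ[K] Ω := (AlgHom.snd K F Ω).comp A.toSubalgebra.val

lemma val_of_mem (a : A.toSubalgebra) : A.Val (A.toField a) (A.residue a) := a.2

lemma Specializes.unique {P : (E⁄F).Point} {Q Q' : (E⁄Ω).Point} (h : A.Specializes P Q)
    (h' : A.Specializes P Q') : Q = Q' := by
  obtain ⟨v, w, hvw, hv, hw⟩ := h
  obtain ⟨v', w', hvw', hv', hw'⟩ := h'
  refine eq_of_samePoint hw (hw'.trans ?_)
  refine samePoint_of_cross (hw'.ne_zero (coords_ne_zero _)) (hw.ne_zero (coords_ne_zero _)) ?_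
  intro i j
  have h1 := ((hvw' i).mul (hvw j)).sub ((hvw' j).mul (hvw i))
  rw [(hv'.symm.trans hv).cross i j, sub_self] at h1
  exact sub_eq_zero.mp (h1.unique val_zero)

lemma equation_of_val {v : Fin 3 → F} {w : Fin 3 → Ω} (h : ∀ i, A.Val (v i) (w i))
    (hv : Projective.Equation (E⁄F) v) : Projective.Equation (E⁄Ω) w := by
  rw [Projective.equation_iff] at hv ⊢
  have e1 := (((h 1).pow 2).mul (h 2)).add (((A.val_algebraMap E.a₁).mul (h 0)).mul (h 1) |>.mul
    (h 2)) |>.add (((A.val_algebraMap E.a₃).mul (h 1)).mul ((h 2).pow 2))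
  have e2 := (((h 0).pow 3).add (((A.val_algebraMap E.a₂).mul ((h 0).pow 2)).mul (h 2))).add
    (((A.val_algebraMap E.a₄).mul (h 0)).mul ((h 2).pow 2)) |>.add
    ((A.val_algebraMap E.a₆).mul ((h 2).pow 3))
  simp only [Affine.baseChange_a₁, Affine.baseChange_a₂, Affine.baseChange_a₃,
    Affine.baseChange_a₄, Affine.baseChange_a₆] at hv ⊢
  rw [sub_eq_zero] at hv ⊢
  rw [hv] at e1
  exact e1.unique e2

lemma exists_specializes (A : Place K F Ω) [E.IsElliptic] (P : (E⁄F).Point) :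
    ∃ Q, A.Specializes P Q := by
  obtain ⟨a, ha, w, hw, h⟩ := A.exists_scale (coords_ne_zero P)
  have h' : ∀ i, A.Val ((a • coords P) i) (w i) := h
  have hP : SamePoint (coords P) (a • coords P) := (samePoint_smul ha _).symm
  obtain ⟨Q, hQ⟩ := exists_samePoint hw (equation_of_val h' hP.nonsingular.1)
  exact ⟨Q, _, w, h', hP, hQ⟩

lemma specializes_zero : A.Specializes (0 : (E⁄F).Point) 0 := by
  refine ⟨![0, 1, 0], ![0, 1, 0], fun i => ?_, SamePoint.refl _, SamePoint.refl _⟩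
  fin_cases i
  exacts [val_zero, val_one, val_zero]

lemma Specializes.neg {P : (E⁄F).Point} {Q : (E⁄Ω).Point} [E.IsElliptic]
    (h : A.Specializes P Q) : A.Specializes (-P) (-Q) := by
  obtain ⟨v, w, hvw, hv, hw⟩ := h
  have hv' : SamePoint (coords (-P)) (Projective.neg (E⁄F) v) := by
    rw [← hv.toAffine_eq, ← Projective.Point.toAffine_neg hv.nonsingular]
    exact samePoint_toAffine (Projective.nonsingular_neg hv.nonsingular)
  have hw' : SamePoint (coords (-Q)) (Projective.neg (E⁄Ω) w) := by
    rw [← hw.toAffine_eq, ← Projective.Point.toAffine_neg hw.nonsingular]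
    exact samePoint_toAffine (Projective.nonsingular_neg hw.nonsingular)
  refine ⟨_, _, fun i => ?_, hv', hw'⟩
  fin_cases i
  · exact hvw 0
  · exact ((hvw 1).neg.sub ((A.val_algebraMap E.a₁).mul (hvw 0))).sub
      ((A.val_algebraMap E.a₃).mul (hvw 2))
  · exact hvw 2

lemma specializes_some {x y : F} {c d : Ω} {h : (E⁄F).Nonsingular x y}
    {h' : (E⁄Ω).Nonsingular c d} (hx : A.Val x c) (hy : A.Val y d) :
    A.Specializes (.some x y h) (.some c d h') := by
  refine ⟨![x, y, 1], ![c, d, 1], fun i => ?_, SamePoint.refl _, SamePoint.refl _⟩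
  fin_cases i
  exacts [hx, hy, val_one]

lemma Specializes.of_some {P : (E⁄F).Point} {c d : Ω} {h' : (E⁄Ω).Nonsingular c d}
    (h : A.Specializes P (.some c d h')) :
    ∃ x y, ∃ hxy : (E⁄F).Nonsingular x y, P = .some x y hxy ∧ A.Val x c ∧ A.Val y d := by
  obtain ⟨v, w, hvw, hv, hw⟩ := h
  have hw2 : w 2 ≠ 0 := by
    have := hw.symm
    obtain ⟨u, hu⟩ := this
    rw [hu]
    simp [coords]
  have hv2 := (hvw 2).ne_zero hw2
  have c0 := hw.cross 0 2
  have c1 := hw.cross 1 2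
  cases P with
  | zero =>
    obtain ⟨u, hu⟩ := hv.symm
    rw [hu] at hv2
    simp [coords] at hv2
  | some x y hxy =>
    have d0 := hv.cross 0 2
    have d1 := hv.cross 1 2
    simp only [coords, Matrix.cons_val_zero, Matrix.cons_val_one, Matrix.cons_val] at c0 c1 d0 d1
    refine ⟨x, y, hxy, rfl, ?_, ?_⟩
    · have := (hvw 0).div (hvw 2) hw2
      rwa [show v 0 / v 2 = x by rw [div_eq_iff hv2]; linear_combination -d0,
        show w 0 / w 2 = c by rw [div_eq_iff hw2]; linear_combination -c0] at this
    · have := (hvw 1).div (hvw 2) hw2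
      rwa [show v 1 / v 2 = y by rw [div_eq_iff hv2]; linear_combination -d1,
        show w 1 / w 2 = d by rw [div_eq_iff hw2]; linear_combination -c1] at this

variable [DecidableEq F] [DecidableEq Ω]

lemma Specializes.add_of_ne {P P' : (E⁄F).Point} {Q Q' : (E⁄Ω).Point}
    (h : A.Specializes P Q) (h' : A.Specializes P' Q') (hne : Q ≠ Q') :
    A.Specializes (P + P') (Q + Q') := by
  have hP : P ≠ P' := by
    rintro rfl
    exact hne (h.unique h')
  obtain ⟨v, w, hvw, hv, hw⟩ := h
  obtain ⟨v', w', hvw', hv', hw'⟩ := h'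
  -- The addition formula is evaluated over the ring of the place and mapped to both fields, so the
  -- two results correspond coordinate by coordinate.
  have e1 := Projective.baseChange_addXYZ (W' := E) (f := A.toField) (lift hvw) (lift hvw')
  have e2 := Projective.baseChange_addXYZ (W' := E) (f := A.residue) (lift hvw) (lift hvw')
  have a1 := hv.add hv' hP
  have a2 := hw.add hw' hne
  refine ⟨_, _, fun i => ?_, a1, a2⟩
  have e1' := congrFun e1 i
  have e2' := congrFun e2 i
  have := val_of_mem (Projective.addXYZ (E⁄A.toSubalgebra) (lift hvw) (lift hvw') i)
  simp only [Function.comp_apply] at e1' e2'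
  rw [← e1', ← e2'] at this
  exact this

/-- The slope of the chord or tangent through two points which are not opposite. -/
lemma exists_slope {W : Affine F} {x₁ y₁ x₂ y₂ : F} (h₁ : W.Nonsingular x₁ y₁)
    (h₂ : W.Nonsingular x₂ y₂)
    (hne : Affine.Point.some x₁ y₁ h₁ + Affine.Point.some x₂ y₂ h₂ ≠ 0) :
    ∃ l y₃ h₃, Affine.Point.some x₁ y₁ h₁ + Affine.Point.some x₂ y₂ h₂ =
        .some (l ^ 2 + W.a₁ * l - W.a₂ - x₁ - x₂) y₃ h₃ ∧
      l * (y₁ + y₂ + W.a₁ * x₂ + W.a₃) =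
        x₁ ^ 2 + x₁ * x₂ + x₂ ^ 2 + W.a₂ * (x₁ + x₂) + W.a₄ - W.a₁ * y₁ := by
  have hxy : ¬(x₁ = x₂ ∧ y₁ = W.negY x₂ y₂) := fun h => hne (Affine.Point.add_of_Y_eq h.1 h.2)
  refine ⟨W.slope x₁ x₂ y₁ y₂, _, _, Affine.Point.add_some hxy, ?_⟩
  have e1 := (W.equation_iff x₁ y₁).mp h₁.1
  have e2 := (W.equation_iff x₂ y₂).mp h₂.1
  by_cases hx : x₁ = x₂
  · have hy : y₁ ≠ W.negY x₂ y₂ := fun h => hxy ⟨hx, h⟩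
    have hy' := Affine.Y_eq_of_Y_ne h₁.1 h₂.1 hx hy
    rw [Affine.slope_of_Y_ne hx hy]
    subst hx hy'
    rw [div_mul_eq_mul_div, div_eq_iff (sub_ne_zero.mpr hy), Affine.negY]
    ring
  · rw [Affine.slope_of_X_ne hx, div_mul_eq_mul_div, div_eq_iff (sub_ne_zero.mpr hx)]
    linear_combination e1 - e2

/-- Let `P + P'` specialize to `r`. If `r ≠ -s`, then adding `-P'`, which specializes to `-s`, falls
under `add_of_ne` and gives `r - s = s`. If `r = -s`, one has to see that `3s = 0`. For affine `s`
the sum then has finite `x`-coordinate, so the slope has a finite value, which is the slope of the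
tangent at `s`, and `2s` has the same `x`-coordinate as `s`. -/
lemma specializes_add_of_eq [E.IsElliptic] {P P' : (E⁄F).Point} {s : (E⁄Ω).Point}
    (h : A.Specializes P s) (h' : A.Specializes P' s) : A.Specializes (P + P') (s + s) := by
  obtain ⟨r, hr⟩ := A.exists_specializes (P + P')
  by_cases hrs : r = -s
  swap
  · have := hr.add_of_ne h'.neg hrs
    rw [add_neg_cancel_right] at this
    have := this.unique h
    rw [← sub_eq_add_neg, sub_eq_iff_eq_add] at this
    rwa [← this]
  subst hrs
  suffices s + s = -s by rwa [this]
  match s, h, h', hr with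
  | 0, _, _, _ => simp
  | .some c d hcd, h, h', hr =>
    obtain ⟨x₁, y₁, h₁, rfl, hx₁, hy₁⟩ := h.of_some
    obtain ⟨x₂, y₂, h₂, rfl, hx₂, hy₂⟩ := h'.of_some
    rw [Affine.Point.neg_some] at hr
    obtain ⟨x₃, y₃, h₃, he, hx₃, hy₃⟩ := hr.of_some
    obtain ⟨l, y₃', h₃', hl, hl'⟩ := exists_slope h₁ h₂ (by rw [he]; exact Affine.Point.some_ne_zero _)
    rw [hl, Affine.Point.some.injEq] at he
    have hX := he.1
    simp only [Affine.baseChange_a₁, Affine.baseChange_a₂, Affine.baseChange_a₃,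
      Affine.baseChange_a₄] at hX hl'
    have v1 := A.val_algebraMap E.a₁
    have v2 := A.val_algebraMap E.a₂
    have v3 := A.val_algebraMap E.a₃
    have v4 := A.val_algebraMap E.a₄
    -- If `l` had a pole, dividing the formula for the finite `x₃` by `l ^ 2` would give `1 = 0` in
    -- the limit.
    obtain ⟨m, hm⟩ : ∃ m, A.Val l m := by
      rcases A.val_or_inv l with h0 | h0
      · exact h0
      by_cases hl0 : l = 0
      · exact ⟨0, hl0 ▸ val_zero⟩
      exfalso
      have t1 := val_one.add (v1.mul h0)
      have t2 := (((hx₃.add v2).add hx₁).add hx₂).mul (h0.pow 2)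
      have : 1 + algebraMap K F E.a₁ * l⁻¹ = (x₃ + algebraMap K F E.a₂ + x₁ + x₂) * l⁻¹ ^ 2 := by
        rw [← hX]
        field_simp
        ring
      rw [this] at t1
      simpa using t1.unique t2
    have hm' := (hm.mul (((hy₁.add hy₂).add (v1.mul hx₂)).add v3)).unique (d := _) (by
      rw [hl']
      exact ((((((hx₁.pow 2).add (hx₁.mul hx₂)).add (hx₂.pow 2)).add (v2.mul (hx₁.add hx₂))).add
        v4).sub (v1.mul hy₁)))
    have hmX := ((((hm.pow 2).add (v1.mul hm)).sub v2).sub hx₁ |>.sub hx₂).unique (hX ▸ hx₃)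
    have hns := ((E⁄Ω).nonsingular_iff c d).mp hcd
    -- If `s` were 2-torsion, the limit of the slope equation would make both partial derivatives
    -- vanish at `s`.
    have hd : d ≠ (E⁄Ω).negY c d := by
      intro hd
      rcases hns.2 with h0 | h0
      · apply h0
        simp only [Affine.negY, Affine.baseChange_a₁, Affine.baseChange_a₂, Affine.baseChange_a₃,
          Affine.baseChange_a₄] at hd ⊢
        linear_combination hm' - m * hd
      · exact h0 hd
    have hne : Affine.Point.some c d hcd + Affine.Point.some c d hcd ≠ 0 := by
      rw [Affine.Point.add_self_of_Y_ne hd]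
      exact Affine.Point.some_ne_zero _
    obtain ⟨m', z, hz, hs, hm''⟩ := exists_slope hcd hcd hne
    simp only [Affine.baseChange_a₁, Affine.baseChange_a₂, Affine.baseChange_a₃,
      Affine.baseChange_a₄] at hm''
    have hmm : m' = m := by
      have : d + d + algebraMap K Ω E.a₁ * c + algebraMap K Ω E.a₃ ≠ 0 := by
        intro h0
        apply hd
        simp only [Affine.negY, Affine.baseChange_a₁, Affine.baseChange_a₃]
        linear_combination h0
      apply mul_right_cancel₀ this
      rw [hm', hm'']
    subst hmm
    -- Equal `x`-coordinates leave `2s = s`, impossible as `s` is affine, and `2s = -s`.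
    rcases (Affine.Point.X_eq_iff (h₁ := hz) (h₂ := hcd)).mp hmX with h0 | h0
    · rw [h0] at hs
      exact absurd (add_eq_left.mp hs) (Affine.Point.some_ne_zero _)
    · rw [hs, h0]

lemma Specializes.add [E.IsElliptic] {P P' : (E⁄F).Point} {Q Q' : (E⁄Ω).Point}
    (h : A.Specializes P Q) (h' : A.Specializes P' Q') : A.Specializes (P + P') (Q + Q') := by
  by_cases hne : Q = Q'
  · subst hne
    exact specializes_add_of_eq h h'
  · exact h.add_of_ne h' hne

variable (A) in
/-- The specialization homomorphism at a place. -/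
noncomputable def sp (E : Affine K) [E.IsElliptic] : (E⁄F).Point →+ (E⁄Ω).Point where
  toFun P := (A.exists_specializes P).choose
  map_zero' := (A.exists_specializes 0).choose_spec.unique specializes_zero
  map_add' P P' := (A.exists_specializes (P + P')).choose_spec.unique
    ((A.exists_specializes P).choose_spec.add (A.exists_specializes P').choose_spec)

lemma specializes_sp [E.IsElliptic] (P : (E⁄F).Point) : A.Specializes P (A.sp E P) :=
  (A.exists_specializes P).choose_spec

lemma Specializes.sp_eq [E.IsElliptic] {P : (E⁄F).Point} {Q : (E⁄Ω).Point}
    (h : A.Specializes P Q) : A.sp E P = Q := (specializes_sp P).unique h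

/-- The Weierstrass equation makes `y` integral over `x`, so `y` has a finite value too: if `1 / y`
had value zero, dividing the equation by `y ^ 2` would give `1 = 0`. -/
lemma sp_ne_zero [E.IsElliptic] {x y : F} {c : Ω} {h : (E⁄F).Nonsingular x y} (hx : A.Val x c) :
    A.sp E (.some x y h) ≠ 0 := by
  have hy : ∃ d, A.Val y d := by
    rcases A.val_or_inv y with h0 | h0
    · exact h0
    by_cases hy : y = 0
    · exact ⟨0, hy ▸ val_zero⟩
    exfalso
    have e := ((E⁄F).equation_iff x y).mp h.1
    simp only [Affine.baseChange_a₁, Affine.baseChange_a₂, Affine.baseChange_a₃,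
      Affine.baseChange_a₄, Affine.baseChange_a₆] at e
    have t1 := (val_one.add (((A.val_algebraMap E.a₁).mul hx).mul h0)).add
      ((A.val_algebraMap E.a₃).mul h0)
    have t2 := ((((hx.pow 3).add ((A.val_algebraMap E.a₂).mul (hx.pow 2))).add
      ((A.val_algebraMap E.a₄).mul hx)).add (A.val_algebraMap E.a₆)).mul (h0.pow 2)
    rw [← e] at t2
    have : (y ^ 2 + algebraMap K F E.a₁ * x * y + algebraMap K F E.a₃ * y) * y⁻¹ ^ 2 =
        1 + algebraMap K F E.a₁ * x * y⁻¹ + algebraMap K F E.a₃ * y⁻¹ := by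
      field_simp
    rw [this] at t2
    simpa using t1.unique t2
  obtain ⟨d, hd⟩ := hy
  have h' : (E⁄Ω).Nonsingular c d := by
    refine Affine.equation_iff_nonsingular.mp ((Projective.equation_some c d).mp
      (equation_of_val (A := A) (v := ![x, y, 1]) (fun i => ?_)
        ((Projective.equation_some x y).mpr h.1)))
    fin_cases i
    exacts [hx, hd, val_one]
  rw [(specializes_some (h' := h') hx hd).sp_eq]
  exact Affine.Point.some_ne_zero _

lemma sp_eq_some [E.IsElliptic] {x y : F} {h : (E⁄F).Nonsingular x y} {c d : Ω}
    {h' : (E⁄Ω).Nonsingular c d} (hs : A.sp E (.some x y h) = .some c d h') :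
    A.Val x c ∧ A.Val y d := by
  have := specializes_sp (A := A) (E := E) (.some x y h)
  rw [hs] at this
  obtain ⟨x', y', hxy, he, hx, hy⟩ := this.of_some
  rw [Affine.Point.some.injEq] at he
  obtain ⟨rfl, rfl⟩ := he
  exact ⟨hx, hy⟩

end Place

open Polynomial

/-! ### Local rings with principal maximal ideal -/

section Localization

/-- Since `s` is invertible in the local ring at `p`, the relation `h` makes the maximal ideal
principal, generated by `a`. A Noetherian local domain with principal maximal ideal is a valuation
ring; it remains to clear denominators. -/
lemma exists_mul_eq_of_prime {R : Type*} [CommRing R] [IsDomain R] [IsNoetherianRing R]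
    (p : Ideal R) [p.IsPrime] {a b s t : R} (hp : p = Ideal.span {a, b}) (hs : s ∉ p)
    (h : s * b = t * a) (f g : R) : ∃ s u, s ∉ p ∧ (s * g = u * f ∨ s * f = u * g) := by
  have hinj : Function.Injective (algebraMap R (Localization.AtPrime p)) :=
    IsLocalization.injective _ p.primeCompl_le_nonZeroDivisors
  have : IsNoetherianRing (Localization.AtPrime p) :=
    IsLocalization.isNoetherianRing p.primeCompl _ inferInstance
  have hm : Submodule.IsPrincipal (IsLocalRing.maximalIdeal (Localization.AtPrime p)) := by
    refine ⟨algebraMap R _ a, ?_⟩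
    rw [← Localization.AtPrime.map_eq_maximalIdeal]
    apply le_antisymm
    · rw [Ideal.map_le_iff_le_comap]
      conv_lhs => rw [hp]
      rw [Ideal.span_le]
      rintro x (rfl | rfl)
      · exact Submodule.mem_span_singleton_self _
      · rw [SetLike.mem_coe, Ideal.mem_comap]
        have hu : IsUnit (algebraMap R (Localization.AtPrime p) s) :=
          (IsLocalization.AtPrime.isUnit_to_map_iff _ p s).mpr hs
        obtain ⟨u, hu⟩ := hu
        have : algebraMap R (Localization.AtPrime p) x =
            (↑u⁻¹ * algebraMap R _ t) * algebraMap R _ a := by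
          rw [mul_assoc, ← map_mul, ← h, map_mul, ← hu, ← mul_assoc, Units.inv_mul, one_mul]
        rw [this]
        exact Ideal.mul_mem_left _ _ (Submodule.mem_span_singleton_self _)
    · rw [Submodule.span_singleton_le_iff_mem]
      apply Ideal.mem_map_of_mem
      rw [hp]
      exact Ideal.subset_span (by simp)
  have hv : ValuationRing (Localization.AtPrime p) :=
    ((tfae_of_isNoetherianRing_of_isLocalRing_of_isDomain (Localization.AtPrime p)).out 4 1).mp hm
  have key : ∀ f g : R, (∃ c, algebraMap R (Localization.AtPrime p) f * c = algebraMap R _ g) →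
      ∃ s u, s ∉ p ∧ s * g = u * f := by
    rintro f g ⟨c, hc⟩
    obtain ⟨⟨u, s⟩, hus⟩ := IsLocalization.surj p.primeCompl c
    refine ⟨s, u, s.2, hinj ?_⟩
    rw [map_mul, map_mul, ← hc, ← hus]
    ring
  obtain ⟨c, hc | hc⟩ := ValuationRing.cond (algebraMap R (Localization.AtPrime p) f)
    (algebraMap R _ g)
  · obtain ⟨s, u, hs, h⟩ := key f g ⟨c, hc⟩
    exact ⟨s, u, hs, .inl h⟩
  · obtain ⟨s, u, hs, h⟩ := key g f ⟨c, hc⟩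
    exact ⟨s, u, hs, .inr h⟩

end Localization

/-! ### The coordinate ring and its values at affine points -/

section CoordinateRing

variable {k : Type*} [Field k] (E : Affine k)

/-- The element `p + q Y` of the coordinate ring. -/
noncomputable def elt (p q : k[X]) : E.CoordinateRing :=
  p • (1 : E.CoordinateRing) + q • Affine.CoordinateRing.mk E X

lemma exists_elt (a : E.CoordinateRing) : ∃ p q, a = elt E p q := by
  obtain ⟨p, q, h⟩ := Affine.CoordinateRing.exists_smul_basis_eq a
  exact ⟨p, q, h.symm⟩

variable {E} in
lemma elt_eq_zero {p q : k[X]} (h : elt E p q = 0) : p = 0 ∧ q = 0 :=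
  Affine.CoordinateRing.smul_basis_eq_zero h

lemma elt_eq_mk (p q : k[X]) : elt E p q = Affine.CoordinateRing.mk E (C p + C q * X) := by
  rw [elt, Affine.CoordinateRing.smul, Affine.CoordinateRing.smul, mul_one, ← map_mul, ← map_add]

lemma elt_add (p q r s : k[X]) : elt E p q + elt E r s = elt E (p + r) (q + s) := by
  simp only [elt, add_smul]
  abel

lemma elt_mul (p q r s : k[X]) : elt E p q * elt E r s =
    elt E (p * r + q * s * (X ^ 3 + C E.a₂ * X ^ 2 + C E.a₄ * X + C E.a₆))
      (p * s + q * r - q * s * (C E.a₁ * X + C E.a₃)) := by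
  simp only [elt_eq_mk, ← map_mul]
  refine AdjoinRoot.mk_eq_mk.mpr ⟨C (q * s), ?_⟩
  rw [Affine.polynomial]
  simp only [map_add, map_mul, map_sub]
  ring

variable {L : Type*} [Field L] [Algebra k L]

variable {E} in
lemma eval₂_polynomial {x y : L} (h : (E⁄L).Equation x y) :
    E.polynomial.eval₂ ((aeval x : k[X] →ₐ[k] L) : k[X] →+* L) y = 0 := by
  rw [Affine.equation_iff] at h
  simp only [Affine.baseChange_a₁, Affine.baseChange_a₂, Affine.baseChange_a₃,
      Affine.baseChange_a₄, Affine.baseChange_a₆] at h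
  rw [Affine.polynomial]
  simp only [eval₂_sub, eval₂_add, eval₂_mul, eval₂_pow, eval₂_X, eval₂_C, RingHom.coe_coe,
    map_add, map_mul, map_pow, aeval_X, aeval_C]
  linear_combination h

/-- The value of a regular function at an affine point. -/
noncomputable def evalAt {x y : L} (h : (E⁄L).Equation x y) : E.CoordinateRing →ₐ[k] L :=
  AdjoinRoot.liftAlgHom E.polynomial (aeval x) y (eval₂_polynomial h)

lemma evalAt_elt {x y : L} (h : (E⁄L).Equation x y) (p q : k[X]) :
    evalAt E h (elt E p q) = aeval x p + aeval x q * y := by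
  rw [evalAt, elt_eq_mk, AdjoinRoot.liftAlgHom_mk]
  simp

/-- The coordinates `[x : y : 1]` in the coordinate ring. -/
noncomputable def ringCoords : Fin 3 → E.CoordinateRing := ![elt E X 0, elt E 0 1, 1]

lemma algebraMap_ringCoords (i : Fin 3) :
    algebraMap E.CoordinateRing E.FunctionField (ringCoords E i) = genericCoords E i := by
  fin_cases i <;> simp [ringCoords, genericCoords, elt_eq_mk]

lemma evalAt_ringCoords {x y : L} (h : (E⁄L).Equation x y) (i : Fin 3) :
    evalAt E h (ringCoords E i) = ![x, y, 1] i := by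
  fin_cases i
  · simp [ringCoords, evalAt_elt]
  · simp [ringCoords, evalAt_elt]
  · simp [ringCoords]

lemma evalAt_aeval {x y : L} (h : (E⁄L).Nonsingular x y) (f : MvPolynomial (Fin 3) k) :
    evalAt E h.1 (MvPolynomial.aeval (ringCoords E) f) =
      MvPolynomial.aeval (coords (Affine.Point.some x y h)) f := by
  rw [MvPolynomial.comp_aeval_apply]
  congr 2
  funext i
  exact evalAt_ringCoords E h.1 i

lemma algebraMap_aeval (f : MvPolynomial (Fin 3) k) :
    algebraMap E.CoordinateRing E.FunctionField (MvPolynomial.aeval (ringCoords E) f) =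
      MvPolynomial.aeval (genericCoords E) f := by
  rw [← IsScalarTower.coe_toAlgHom' k, MvPolynomial.comp_aeval_apply]
  congr 2
  funext i
  exact algebraMap_ringCoords E i

lemma ker_evalAt {x y : k} (h : (E⁄k).Equation x y) :
    RingHom.ker (evalAt E h) = Ideal.span {elt E (X - C x) 0, elt E (- C y) 1} := by
  apply le_antisymm
  · intro a ha
    obtain ⟨p, q, rfl⟩ := exists_elt E a
    rw [RingHom.mem_ker, evalAt_elt] at ha
    simp only [coe_aeval_eq_eval] at ha
    obtain ⟨p', hp⟩ := X_sub_C_dvd_sub_C_eval (a := x) (p := p)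
    obtain ⟨q', hq⟩ := X_sub_C_dvd_sub_C_eval (a := x) (p := q)
    rw [Ideal.mem_span_pair]
    refine ⟨elt E p' q', elt E (C (q.eval x)) 0, ?_⟩
    rw [elt_mul, elt_mul, elt_add]
    congr 1
    · have : C (p.eval x) = - C (q.eval x) * C y := by
        rw [← C_neg, ← C_mul]
        congr 1
        linear_combination ha
      linear_combination -hp - this
    · linear_combination -hq
  · rw [Ideal.span_le]
    rintro a (rfl | rfl) <;> simp [evalAt_elt]

/-- Expanding the Weierstrass equation at the point gives `(Y + y + a₁ X + a₃) (Y - y) = (⋯) (X -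
x)`. By nonsingularity one of the two cofactors is nonzero at the point, so `X - x` or `Y - y` alone
generates the maximal ideal of the local ring. -/
lemma exists_mul_eq_of_rational {x y : k} (h : (E⁄k).Nonsingular x y) (f g : E.CoordinateRing) :
    ∃ s u, evalAt E h.1 s ≠ 0 ∧ (s * g = u * f ∨ s * f = u * g) := by
  have hp := ker_evalAt E h.1
  have : (RingHom.ker (evalAt E h.1)).IsPrime := RingHom.ker_isPrime _
  have heq := ((E⁄k).equation_iff x y).mp h.1
  have hrel : elt E (C y + (C E.a₁ * X + C E.a₃)) 1 * elt E (- C y) 1 =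
      elt E (X ^ 2 + X * C x + C x ^ 2 + C E.a₂ * (X + C x) + C E.a₄ - C E.a₁ * C y) 0 *
        elt E (X - C x) 0 := by
    have heq' := congrArg (C : k → k[X]) heq
    simp only [Affine.baseChange_a₁, Affine.baseChange_a₂, Affine.baseChange_a₃,
      Affine.baseChange_a₄, Affine.baseChange_a₆, Algebra.algebraMap_self, RingHom.id_apply,
      map_add, map_mul, map_pow] at heq'
    rw [elt_mul, elt_mul]
    congr 1
    · linear_combination -heq'
    · ring
  have hns := ((E⁄k).nonsingular_iff x y).mp h
  simp only [Affine.baseChange_a₁, Affine.baseChange_a₂, Affine.baseChange_a₃,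
      Affine.baseChange_a₄, Algebra.algebraMap_self, RingHom.id_apply] at hns
  by_cases hy : y + (E.a₁ * x + E.a₃) + y = 0
  · have hx : x ^ 2 + x * x + x ^ 2 + E.a₂ * (x + x) + E.a₄ - E.a₁ * y ≠ 0 := by
      intro h0
      rcases hns.2 with h1 | h1
      · exact h1 (by linear_combination -h0)
      · exact h1 (by linear_combination hy)
    refine exists_mul_eq_of_prime (RingHom.ker (evalAt E h.1)) (hp.trans ?_) ?_ hrel.symm f g
    · rw [Set.pair_comm]
    · simpa [RingHom.mem_ker, evalAt_elt] using hx
  · refine exists_mul_eq_of_prime (RingHom.ker (evalAt E h.1)) hp ?_ hrel f g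
    simpa [RingHom.mem_ker, evalAt_elt] using hy

/-! ### Descent along a field extension -/

/-- Expand the `c m` in a basis of `L` over `k`; the coordinate functionals are the only ones
needed. -/
lemma sum_eq_zero_of_functionals {ι : Type*} (s : Finset ι) (c w : ι → L)
    (h : ∀ l : L →ₗ[k] k, ∑ m ∈ s, algebraMap k L (l (c m)) * w m = 0) :
    ∑ m ∈ s, c m * w m = 0 := by
  classical
  let b := Module.Basis.ofVectorSpace k L
  let S := s.biUnion fun m => (b.repr (c m)).support
  have hc : ∀ m ∈ s, c m = ∑ i ∈ S, algebraMap k L (b.repr (c m) i) * b i := by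
    intro m hm
    conv_lhs => rw [← b.linearCombination_repr (c m)]
    rw [Finsupp.linearCombination_apply, Finsupp.sum_of_support_subset
      (s := S) _ (Finset.subset_biUnion_of_mem (fun m => (b.repr (c m)).support) hm) _ (by simp)]
    simp [Algebra.smul_def]
  calc ∑ m ∈ s, c m * w m = ∑ m ∈ s, ∑ i ∈ S, algebraMap k L (b.repr (c m) i) * b i * w m := by
        refine Finset.sum_congr rfl fun m hm => ?_
        conv_lhs => rw [hc m hm]
        rw [Finset.sum_mul]
    _ = ∑ i ∈ S, b i * ∑ m ∈ s, algebraMap k L (b.coord i (c m)) * w m := by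
        rw [Finset.sum_comm]
        refine Finset.sum_congr rfl fun i _ => ?_
        rw [Finset.mul_sum]
        refine Finset.sum_congr rfl fun m _ => ?_
        rw [Module.Basis.coord_apply]
        ring
    _ = 0 := Finset.sum_eq_zero fun i _ => by rw [h, mul_zero]

/-- Apply a linear functional to the coefficients of a polynomial. -/
noncomputable def mapCoeff (l : L →ₗ[k] k) (p : L[X]) : k[X] :=
  p.sum fun n a => monomial n (l a)

lemma coeff_mapCoeff (l : L →ₗ[k] k) (p : L[X]) (n : ℕ) :
    (mapCoeff l p).coeff n = l (p.coeff n) := by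
  rw [mapCoeff, sum_def, finsetSum_coeff]
  simp only [coeff_monomial, Finset.sum_ite_eq', mem_support_iff]
  split_ifs with h
  · rfl
  · rw [notMem_support_iff.mp h, map_zero]

lemma mapCoeff_add (l : L →ₗ[k] k) (p q : L[X]) :
    mapCoeff l (p + q) = mapCoeff l p + mapCoeff l q := by
  ext n
  simp [coeff_mapCoeff]

lemma mapCoeff_sub (l : L →ₗ[k] k) (p q : L[X]) :
    mapCoeff l (p - q) = mapCoeff l p - mapCoeff l q := by
  ext n
  simp [coeff_mapCoeff]

lemma mapCoeff_mul (l : L →ₗ[k] k) (p : L[X]) (q : k[X]) :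
    mapCoeff l (p * q.map (algebraMap k L)) = mapCoeff l p * q := by
  ext n
  simp only [coeff_mapCoeff, coeff_mul, map_sum, coeff_map]
  refine Finset.sum_congr rfl fun i _ => ?_
  rw [mul_comm (p.coeff i.1), ← Algebra.smul_def, map_smul, smul_eq_mul, mul_comm]

/-- This lets a denominator descend to `k` without acquiring a zero at the given point. If every
functional failed, `sum_eq_zero_of_functionals`, applied to the quantities `x ^ i` and `x ^ i * y`,
would make the original value zero. -/
lemma exists_mapCoeff_ne_zero {x y : L} (p q : L[X]) (h : p.eval x + q.eval x * y ≠ 0) :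
    ∃ l : L →ₗ[k] k, aeval x (mapCoeff l p) + aeval x (mapCoeff l q) * y ≠ 0 := by
  by_contra! H
  apply h
  let N := p.natDegree + q.natDegree + 1
  have hev : ∀ r : L[X], r.natDegree < N → r.eval x = ∑ i ∈ Finset.range N, r.coeff i * x ^ i :=
    fun r hr => eval_eq_sum_range' hr x
  have haev : ∀ (l : L →ₗ[k] k) (r : L[X]), r.natDegree < N →
      aeval x (mapCoeff l r) = ∑ i ∈ Finset.range N, algebraMap k L (l (r.coeff i)) * x ^ i := by
    intro l r hr
    have hd : (mapCoeff l r).natDegree < N := by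
      refine lt_of_le_of_lt (natDegree_le_iff_coeff_eq_zero.mpr fun n hn => ?_) hr
      rw [coeff_mapCoeff, coeff_eq_zero_of_natDegree_lt hn, map_zero]
    rw [aeval_eq_sum_range' hd]
    simp [coeff_mapCoeff, Algebra.smul_def]
  have hp : p.natDegree < N := by simp only [N]; omega
  have hq : q.natDegree < N := by simp only [N]; omega
  have := sum_eq_zero_of_functionals (k := k) ((Finset.range N).disjSum (Finset.range N))
    (Sum.elim p.coeff q.coeff) (Sum.elim (fun i => x ^ i) fun i => x ^ i * y) (fun l => by
      rw [Finset.sum_disjSum]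
      have := H l
      rw [haev l p hp, haev l q hq, Finset.sum_mul] at this
      simpa [mul_assoc] using this)
  rw [Finset.sum_disjSum] at this
  rw [hev p hp, hev q hq, Finset.sum_mul]
  simpa [mul_assoc] using this

/-- Of two regular functions, one is a multiple of the other near a given geometric point. -/
lemma exists_mul_eq {x y : L} (h : (E⁄L).Nonsingular x y) (f g : E.CoordinateRing) :
    ∃ s u, evalAt E h.1 s ≠ 0 ∧ (s * g = u * f ∨ s * f = u * g) := by
  have h' : ((E⁄L)⁄L).Nonsingular x y := by
    have : ((E⁄L)⁄L) = E⁄L := WeierstrassCurve.map_id _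
    rwa [this]
  obtain ⟨f₁, f₂, rfl⟩ := exists_elt E f
  obtain ⟨g₁, g₂, rfl⟩ := exists_elt E g
  -- Over `L` the point is rational. As `f` and `g` have coefficients in `k`, the relation obtained
  -- is `k`-linear in the coefficients of `s` and `u`, so it survives the application of a
  -- functional `L → k` to them, chosen so that `s` stays nonzero at the point.
  obtain ⟨s, u, hs, hsu⟩ := exists_mul_eq_of_rational (E⁄L) h'
    (elt _ (f₁.map (algebraMap k L)) (f₂.map (algebraMap k L)))
    (elt _ (g₁.map (algebraMap k L)) (g₂.map (algebraMap k L)))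
  obtain ⟨s₁, s₂, rfl⟩ := exists_elt _ s
  obtain ⟨u₁, u₂, rfl⟩ := exists_elt _ u
  rw [evalAt_elt] at hs
  obtain ⟨l, hl⟩ := exists_mapCoeff_ne_zero (k := k) s₁ s₂ hs
  have key : ∀ a₁ a₂ b₁ b₂ : k[X],
      elt (E⁄L) s₁ s₂ * elt _ (a₁.map (algebraMap k L)) (a₂.map (algebraMap k L)) =
        elt _ u₁ u₂ * elt _ (b₁.map (algebraMap k L)) (b₂.map (algebraMap k L)) →
      elt E (mapCoeff l s₁) (mapCoeff l s₂) * elt E a₁ a₂ =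
        elt E (mapCoeff l u₁) (mapCoeff l u₂) * elt E b₁ b₂ := by
    intro a₁ a₂ b₁ b₂ hab
    have h1 : (X ^ 3 + C (E⁄L).a₂ * X ^ 2 + C (E⁄L).a₄ * X + C (E⁄L).a₆ : L[X]) =
        (X ^ 3 + C E.a₂ * X ^ 2 + C E.a₄ * X + C E.a₆ : k[X]).map (algebraMap k L) := by
      simp
    have h2 : (C (E⁄L).a₁ * X + C (E⁄L).a₃ : L[X]) =
        (C E.a₁ * X + C E.a₃ : k[X]).map (algebraMap k L) := by
      simp
    rw [elt_mul, elt_mul, h1, h2, ← sub_eq_zero, sub_eq_add_neg, elt, elt, neg_add, ← neg_smul,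
      ← neg_smul, add_add_add_comm, ← add_smul, ← add_smul] at hab
    obtain ⟨e1, e2⟩ := elt_eq_zero hab
    rw [← sub_eq_add_neg, sub_eq_zero] at e1 e2
    simp only [mul_assoc, ← Polynomial.map_mul] at e1 e2
    have e1' := congrArg (mapCoeff l) e1
    have e2' := congrArg (mapCoeff l) e2
    simp only [mapCoeff_add, mapCoeff_sub, mapCoeff_mul] at e1' e2'
    rw [elt_mul, elt_mul]
    congr 1
    · linear_combination e1'
    · linear_combination e2'
  refine ⟨elt E (mapCoeff l s₁) (mapCoeff l s₂), elt E (mapCoeff l u₁) (mapCoeff l u₂), ?_, ?_⟩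
  · rwa [evalAt_elt]
  · exact hsu.imp (key _ _ _ _) (key _ _ _ _)

end CoordinateRing

/-! ### The order of the pole at the origin -/

section PoleOrder

variable {k : Type*} [Field k] {E : Affine k}

instance : Module.Finite k[X] E.CoordinateRing :=
  .of_basis (Affine.CoordinateRing.basis E)

/-- The order of the pole at the origin of a regular function on the affine curve. -/
noncomputable def poleOrder (a : E.CoordinateRing) : WithBot ℕ := (Algebra.norm k[X] a).degree

lemma poleOrder_mul (a b : E.CoordinateRing) :
    poleOrder (a * b) = poleOrder a + poleOrder b := by
  rw [poleOrder, map_mul, degree_mul, poleOrder, poleOrder]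

lemma poleOrder_elt (p q : k[X]) :
    poleOrder (elt E p q) = max (2 • p.degree) (2 • q.degree + 3) :=
  Affine.CoordinateRing.degree_norm_smul_basis p q

lemma poleOrder_one : poleOrder (1 : E.CoordinateRing) = 0 := by
  rw [poleOrder, map_one, degree_one]

lemma poleOrder_pow (a : E.CoordinateRing) (n : ℕ) :
    poleOrder (a ^ n) = n • poleOrder a := by
  rw [poleOrder, map_pow, degree_pow, poleOrder]

lemma exists_poleOrder {a : E.CoordinateRing} (ha : a ≠ 0) : ∃ n : ℕ, poleOrder a = n := by
  refine ⟨(Algebra.norm k[X] a).natDegree, degree_eq_natDegree ?_⟩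
  rwa [Ne, Algebra.norm_eq_zero_iff]

lemma ne_zero_of_poleOrder {a : E.CoordinateRing} {n : ℕ} (ha : poleOrder a = n) : a ≠ 0 := by
  rintro rfl
  rw [poleOrder, Algebra.norm_zero, degree_zero] at ha
  exact WithBot.bot_ne_coe ha

lemma two_smul_degree_add_lt_iff (p : k[X]) (j N : ℕ) :
    2 • p.degree + (j : WithBot ℕ) < N ↔ ∀ i, N ≤ 2 * i + j → p.coeff i = 0 := by
  by_cases hp : p = 0
  · subst hp
    simp only [degree_zero, coeff_zero, implies_true, iff_true]
    exact WithBot.bot_lt_coe N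
  · rw [degree_eq_natDegree hp]
    have : 2 • ((p.natDegree : ℕ) : WithBot ℕ) + (j : WithBot ℕ) =
      ((2 * p.natDegree + j : ℕ) : WithBot ℕ) := by push_cast; simp
    rw [this, Nat.cast_lt]
    constructor
    · intro h i hi
      exact coeff_eq_zero_of_natDegree_lt (by omega)
    · intro h
      by_contra! hlt
      exact hp (leadingCoeff_eq_zero.mp (h _ hlt))

lemma poleOrder_elt_lt_iff (p q : k[X]) (N : ℕ) :
    poleOrder (elt E p q) < N ↔
      (∀ i, N ≤ 2 * i → p.coeff i = 0) ∧ (∀ i, N ≤ 2 * i + 3 → q.coeff i = 0) := by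
  rw [poleOrder_elt, max_lt_iff]
  refine and_congr ?_ ?_
  · simpa using two_smul_degree_add_lt_iff p 0 N
  · simpa using two_smul_degree_add_lt_iff q 3 N

variable (E) in
/-- The functions whose pole at the origin has order less than `N`. -/
noncomputable def poleFiltration (N : ℕ) : Submodule k E.CoordinateRing where
  carrier := {a | poleOrder a < N}
  zero_mem' := by
    have : (0 : E.CoordinateRing) = elt E 0 0 := by simp [elt]
    rw [Set.mem_ofPred_eq, this, poleOrder_elt_lt_iff]
    simp
  add_mem' := by
    intro a b ha hb
    obtain ⟨p, q, rfl⟩ := exists_elt E a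
    obtain ⟨r, s, rfl⟩ := exists_elt E b
    rw [Set.mem_ofPred_eq, poleOrder_elt_lt_iff] at ha hb
    rw [Set.mem_ofPred_eq, elt_add, poleOrder_elt_lt_iff]
    refine ⟨fun i hi => ?_, fun i hi => ?_⟩
    · rw [coeff_add, ha.1 i hi, hb.1 i hi, add_zero]
    · rw [coeff_add, ha.2 i hi, hb.2 i hi, add_zero]
  smul_mem' := by
    intro c a ha
    obtain ⟨p, q, rfl⟩ := exists_elt E a
    rw [Set.mem_ofPred_eq, poleOrder_elt_lt_iff] at ha
    have : c • elt E p q = elt E (c • p) (c • q) := by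
      simp only [elt, smul_add, smul_assoc]
    rw [Set.mem_ofPred_eq, this, poleOrder_elt_lt_iff]
    refine ⟨fun i hi => ?_, fun i hi => ?_⟩
    · rw [coeff_smul, ha.1 i hi, smul_zero]
    · rw [coeff_smul, ha.2 i hi, smul_zero]

lemma mem_poleFiltration {a : E.CoordinateRing} {N : ℕ} :
    a ∈ poleFiltration E N ↔ poleOrder a < N := Iff.rfl

lemma smul_elt (c : k) (p q : k[X]) : c • elt E p q = elt E (C c * p) (C c * q) := by
  simp only [elt, smul_add, ← smul_assoc, smul_eq_C_mul]

lemma elt_sub (p q r s : k[X]) : elt E p q - elt E r s = elt E (p - r) (q - s) := by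
  simp only [elt, sub_smul]
  abel

/-- Two functions with the same pole order at the origin are proportional up to a function with
a smaller pole. -/
lemma exists_sub_smul_mem {a e : E.CoordinateRing} {n : ℕ} (ha : a ∈ poleFiltration E (n + 1))
    (he : poleOrder e = n) : ∃ c : k, a - c • e ∈ poleFiltration E n := by
  obtain ⟨p, q, rfl⟩ := exists_elt E a
  obtain ⟨r, s, rfl⟩ := exists_elt E e
  have he1 : poleOrder (elt E r s) < (n + 1 : ℕ) := by
    rw [he, Nat.cast_lt]
    omega
  have he2 : ¬ poleOrder (elt E r s) < n := by
    rw [he]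
    exact lt_irrefl _
  rw [poleOrder_elt_lt_iff] at he1 he2
  rw [mem_poleFiltration, poleOrder_elt_lt_iff] at ha
  simp only [smul_elt, elt_sub, mem_poleFiltration, poleOrder_elt_lt_iff, coeff_sub, coeff_C_mul]
  -- The function `x ^ i` has a pole of order `2 * i` and `x ^ i * y` one of order `2 * i + 3`, so
  -- the parity of `n` decides whether the leading coefficient sits in the first or the second
  -- component.
  rcases Nat.even_or_odd' n with ⟨m, rfl | rfl⟩
  · have hr : r.coeff m ≠ 0 := by
      intro h
      refine he2 ⟨fun i hi => ?_, fun i hi => he1.2 i (by omega)⟩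
      rcases (show m ≤ i by omega).eq_or_lt with rfl | hlt
      · exact h
      · exact he1.1 i (by omega)
    refine ⟨p.coeff m / r.coeff m, fun i hi => ?_, fun i hi => ?_⟩
    · rcases (show m ≤ i by omega).eq_or_lt with rfl | hlt
      · field_simp
        simp
      · rw [ha.1 i (by omega), he1.1 i (by omega), mul_zero, sub_zero]
    · rw [ha.2 i (by omega), he1.2 i (by omega), mul_zero, sub_zero]
  · by_cases hm : m = 0
    · subst hm
      exact absurd ⟨fun i hi => he1.1 i (by omega), fun i hi => he1.2 i (by omega)⟩ he2
    have hs : s.coeff (m - 1) ≠ 0 := by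
      intro h
      refine he2 ⟨fun i hi => he1.1 i (by omega), fun i hi => ?_⟩
      rcases (show m - 1 ≤ i by omega).eq_or_lt with rfl | hlt
      · exact h
      · exact he1.2 i (by omega)
    refine ⟨q.coeff (m - 1) / s.coeff (m - 1), fun i hi => ?_, fun i hi => ?_⟩
    · rw [ha.1 i (by omega), he1.1 i (by omega), mul_zero, sub_zero]
    · rcases (show m - 1 ≤ i by omega).eq_or_lt with rfl | hlt
      · field_simp
        simp
      · rw [ha.2 i (by omega), he1.2 i (by omega), mul_zero, sub_zero]

lemma poleOrder_X : poleOrder (elt E X 0) = (2 : ℕ) := by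
  rw [poleOrder_elt, degree_X, degree_zero]
  rfl

lemma poleOrder_Y : poleOrder (elt E 0 1) = (3 : ℕ) := by
  rw [poleOrder_elt, degree_one, degree_zero]
  rfl

lemma poleOrder_X_pow_mul_Y_pow (i j : ℕ) :
    poleOrder (elt E X 0 ^ i * elt E 0 1 ^ j) = (2 * i + 3 * j : ℕ) := by
  rw [poleOrder_mul, poleOrder_pow, poleOrder_pow, poleOrder_X, poleOrder_Y]
  push_cast
  simp only [nsmul_eq_mul]
  ring

lemma mul_mem_poleFiltration {a b : E.CoordinateRing} {m n : ℕ} (ha : a ∈ poleFiltration E m)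
    (hb : poleOrder b = n) : a * b ∈ poleFiltration E (m + n) := by
  by_cases h0 : a = 0
  · rw [h0, zero_mul]
    exact Submodule.zero_mem _
  obtain ⟨l, hl⟩ := exists_poleOrder h0
  rw [mem_poleFiltration, hl, Nat.cast_lt] at ha
  rw [mem_poleFiltration, poleOrder_mul, hl, hb, ← Nat.cast_add, Nat.cast_lt]
  omega

lemma poleFiltration_mono {m n : ℕ} (h : m ≤ n) : poleFiltration E m ≤ poleFiltration E n :=
  fun _ ha => lt_of_lt_of_le (mem_poleFiltration.mp ha) (Nat.cast_le.mpr h)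

end PoleOrder

/-! ### Homogeneous forms on the curve -/

section Forms

variable {k : Type*} [Field k] (E : Affine k)

lemma aeval_ringCoords_monomial (m : Fin 3 →₀ ℕ) (c : k) :
    MvPolynomial.aeval (ringCoords E) (MvPolynomial.monomial m c) =
      c • (elt E X 0 ^ m 0 * elt E 0 1 ^ m 1) := by
  rw [MvPolynomial.aeval_monomial, Finsupp.prod_fintype _ _ (fun i => pow_zero _),
    Fin.prod_univ_three, Algebra.smul_def]
  simp [ringCoords]

lemma eval_monomial_origin (m : Fin 3 →₀ ℕ) (c : k) :
    MvPolynomial.eval ![0, 1, 0] (MvPolynomial.monomial m c) = c * (0 ^ m 0 * 0 ^ m 2) := by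
  rw [MvPolynomial.eval_monomial, Finsupp.prod_fintype _ _ (fun i => pow_zero _),
    Fin.prod_univ_three]
  simp

lemma sum_eq_of_mem_support {F : MvPolynomial (Fin 3) k} {d : ℕ} (hF : F.IsHomogeneous d)
    {m : Fin 3 →₀ ℕ} (hm : m ∈ F.support) : m 0 + m 1 + m 2 = d := by
  have := hF (MvPolynomial.mem_support_iff.mp hm)
  rw [Finsupp.weight_apply, Finsupp.sum_fintype _ _ (fun i => by simp)] at this
  simpa [Fin.sum_univ_three] using this

/-- Among the monomials of degree `d`, only the `d`-th power of the second variable is nonzero at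
`[0 : 1 : 0]`, and only it reaches pole order `3 * d`. Thus `F / y ^ d` has value `F(0, 1, 0)` at
the origin. -/
lemma aeval_sub_eval_origin_mem {F : MvPolynomial (Fin 3) k} {d : ℕ} (hF : F.IsHomogeneous d) :
    MvPolynomial.aeval (ringCoords E) F - MvPolynomial.eval ![0, 1, 0] F • elt E 0 1 ^ d ∈
      poleFiltration E (3 * d) := by
  rw [F.as_sum, map_sum, map_sum, Finset.sum_smul, ← Finset.sum_sub_distrib]
  refine Submodule.sum_mem _ fun m hm => ?_
  have hs := sum_eq_of_mem_support hF hm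
  rw [aeval_ringCoords_monomial, eval_monomial_origin, mul_smul, ← smul_sub]
  apply Submodule.smul_mem
  by_cases h : m 0 = 0 ∧ m 2 = 0
  · rw [h.1, h.2, ← hs, h.1, h.2]
    simp
  · have : (0 : k) ^ m 0 * 0 ^ m 2 = 0 := by
      rw [not_and_or] at h
      rcases h with h | h <;> simp [zero_pow h]
    rw [this, zero_smul, sub_zero, mem_poleFiltration, poleOrder_X_pow_mul_Y_pow, Nat.cast_lt]
    rw [not_and_or] at h
    omega

/-- An explicit form of Riemann–Roch for multiples of the origin: by induction on the pole order,
the leading term is removed by a monomial `x ^ i * y ^ j`, which homogenizes to degree `d`. -/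
lemma exists_form_of_mem {n d : ℕ} (hnd : n ≤ 3 * d) {a : E.CoordinateRing}
    (ha : a ∈ poleFiltration E (n + 1)) : ∃ F : MvPolynomial (Fin 3) k, F.IsHomogeneous d ∧
      MvPolynomial.aeval (ringCoords E) F = a ∧
        (n < 3 * d → MvPolynomial.eval ![0, 1, 0] F = 0) := by
  induction n using Nat.strong_induction_on generalizing a with
  | _ n ih =>
    match n, ih with
    | 0, _ =>
      obtain ⟨c, hc⟩ := exists_sub_smul_mem ha (e := 1) poleOrder_one
      have hc0 : a - c • (1 : E.CoordinateRing) = 0 := by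
        by_contra h
        obtain ⟨l, hl⟩ := exists_poleOrder h
        rw [mem_poleFiltration, hl, Nat.cast_lt] at hc
        omega
      refine ⟨MvPolynomial.C c * MvPolynomial.X 2 ^ d, ?_, ?_, fun h => ?_⟩
      · simpa using (MvPolynomial.isHomogeneous_C (Fin 3) c).mul
          ((MvPolynomial.isHomogeneous_X k 2).pow d)
      · rw [sub_eq_zero.mp hc0, Algebra.smul_def]
        simp [ringCoords]
      · simp [show d ≠ 0 by omega]
    | 1, ih =>
      -- No regular function on the affine curve has a simple pole at the origin.
      have ha' : a ∈ poleFiltration E 1 := by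
        by_cases h0 : a = 0
        · rw [h0]
          exact Submodule.zero_mem _
        obtain ⟨l, hl⟩ := exists_poleOrder h0
        have h1 : l ≠ 1 := by
          rintro rfl
          exact Affine.CoordinateRing.degree_norm_ne_one a hl
        rw [mem_poleFiltration, hl, Nat.cast_lt] at ha ⊢
        omega
      obtain ⟨F, hF, hFa, hF0⟩ := ih 0 (by omega) (by omega) ha'
      exact ⟨F, hF, hFa, fun _ => hF0 (by omega)⟩
    | n + 2, ih =>
      -- The bound `i ≤ 2` keeps the monomial within degree `d`: `3 * (i + j) = n + 2 + i ≤ 3 * d +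
      -- 2`.
      obtain ⟨i, j, hi, hij⟩ : ∃ i j, i ≤ 2 ∧ 2 * i + 3 * j = n + 2 := by
        rcases (show (n + 2) % 3 = 0 ∨ (n + 2) % 3 = 1 ∨ (n + 2) % 3 = 2 by omega) with
          h | h | h
        · exact ⟨0, (n + 2) / 3, by omega, by omega⟩
        · exact ⟨2, (n - 2) / 3, by omega, by omega⟩
        · exact ⟨1, n / 3, by omega, by omega⟩
      have hijd : i + j ≤ d := by omega
      obtain ⟨c, hc⟩ := exists_sub_smul_mem ha (e := elt E X 0 ^ i * elt E 0 1 ^ j)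
        (by rw [poleOrder_X_pow_mul_Y_pow, hij])
      obtain ⟨F, hF, hFa, hF0⟩ := ih (n + 1) (by omega) (by omega) hc
      refine ⟨F + MvPolynomial.C c * (MvPolynomial.X 0 ^ i * MvPolynomial.X 1 ^ j *
        MvPolynomial.X 2 ^ (d - i - j)), hF.add ?_, ?_, fun h => ?_⟩
      · have := (MvPolynomial.isHomogeneous_C (Fin 3) c).mul
          ((((MvPolynomial.isHomogeneous_X k 0).pow i).mul
            ((MvPolynomial.isHomogeneous_X k 1).pow j)).mul
            ((MvPolynomial.isHomogeneous_X k (2 : Fin 3)).pow (d - i - j)))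
        convert this using 1
        omega
      · rw [map_add, hFa, Algebra.smul_def]
        simp [ringCoords]
      · rw [map_add, hF0 (by omega)]
        have : i ≠ 0 ∨ d - i - j ≠ 0 := by omega
        rcases this with h | h <;> simp [zero_pow h]

lemma exists_degree_bound (a : E.CoordinateRing) : ∃ d : ℕ, a ∈ poleFiltration E (3 * d + 1) := by
  by_cases h0 : a = 0
  · exact ⟨0, h0 ▸ Submodule.zero_mem _⟩
  obtain ⟨l, hl⟩ := exists_poleOrder h0
  refine ⟨l, ?_⟩
  rw [mem_poleFiltration, hl, Nat.cast_lt]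
  omega

end Forms

/-! ### Places of the function field -/

/-- The relation "the fraction `a / b` has the value `c`", from which a place of the field of
fractions is built. -/
structure PrePlace (k R L : Type*) [Field k] [CommRing R] [Field L] [Algebra k R]
    [Algebra k L] where
  rel : R → R → L → Prop
  add : ∀ {a b c a' b' c'}, rel a b c → rel a' b' c' → rel (a * b' + a' * b) (b * b') (c + c')
  mul : ∀ {a b c a' b' c'}, rel a b c → rel a' b' c' → rel (a * a') (b * b') (c * c')
  const : ∀ a : k, rel (algebraMap k R a) 1 (algebraMap k L a)
  ne_zero : ∀ {a b c}, rel a b c → b ≠ 0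
  self : ∀ {a b c}, rel a b c → rel b b 1
  zero : ∀ {b c}, rel 0 b c → c = 0
  exists_rel : ∀ a b, a ≠ 0 → b ≠ 0 → ∃ s u, s ≠ 0 ∧
    ((s * a = u * b ∧ ∃ c, rel u s c) ∨ (s * b = u * a ∧ rel u s 0))

namespace PrePlace

variable {k R L : Type*} [Field k] [CommRing R] [Field L] [Algebra k R] [Algebra k L]
  (ρ : PrePlace k R L)

variable {ρ} in
lemma common {v : Fin 3 → R} {b : Fin 3 → R} {c : Fin 3 → L} (h : ∀ i, ρ.rel (v i) (b i) (c i)) :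
    ∃ b', ρ.rel b' b' 1 ∧ ∃ a : Fin 3 → R, ∀ i, ρ.rel (a i) b' (c i) ∧ a i * b i = v i * b' := by
  refine ⟨b 0 * b 1 * b 2, ?_, ![v 0 * b 1 * b 2, b 0 * v 1 * b 2, b 0 * b 1 * v 2], ?_⟩
  · simpa using ρ.mul (ρ.mul (ρ.self (h 0)) (ρ.self (h 1))) (ρ.self (h 2))
  · intro i
    fin_cases i
    · exact ⟨by simpa using ρ.mul (ρ.mul (h 0) (ρ.self (h 1))) (ρ.self (h 2)), by simp; ring⟩
    · exact ⟨by simpa using ρ.mul (ρ.mul (ρ.self (h 0)) (h 1)) (ρ.self (h 2)), by simp; ring⟩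
    · exact ⟨by simpa using ρ.mul (ρ.mul (ρ.self (h 0)) (ρ.self (h 1))) (h 2), by simp; ring⟩

variable [IsDomain R] (F : Type*) [Field F] [Algebra R F] [IsFractionRing R F] [Algebra k F]
  [IsScalarTower k R F]

/-- The place of the field of fractions defined by the relation. -/
def toPlace : Place k F L where
  carrier := {x | ∃ a b, ρ.rel a b x.2 ∧ x.1 * algebraMap R F b = algebraMap R F a}
  mul_mem' := by
    rintro ⟨f, c⟩ ⟨g, d⟩ ⟨a, b, h, e⟩ ⟨a', b', h', e'⟩
    refine ⟨_, _, ρ.mul h h', ?_⟩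
    simp only [Prod.fst_mul, map_mul] at e e' ⊢
    rw [← e, ← e']
    ring
  add_mem' := by
    rintro ⟨f, c⟩ ⟨g, d⟩ ⟨a, b, h, e⟩ ⟨a', b', h', e'⟩
    refine ⟨_, _, ρ.add h h', ?_⟩
    simp only [Prod.fst_add, map_mul, map_add] at e e' ⊢
    rw [← e, ← e']
    ring
  algebraMap_mem' a := ⟨_, _, ρ.const a, by
    rw [Prod.algebraMap_apply, map_one, mul_one, ← IsScalarTower.algebraMap_apply]⟩
  eq_zero_of_zero_mem := by
    rintro c ⟨a, b, h, e⟩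
    simp only [zero_mul] at e
    rw [eq_comm, map_eq_zero_iff _ (IsFractionRing.injective R F)] at e
    exact ρ.zero (e ▸ h)
  exists_mem_or_inv_mem f := by
    have hinj := IsFractionRing.injective R F
    by_cases hf : f = 0
    · subst hf
      exact .inl ⟨0, 0, 1, by simpa using ρ.const 0, by simp⟩
    obtain ⟨a, b, hb, rfl⟩ := IsFractionRing.div_surjective (A := R) f
    have hb' : algebraMap R F b ≠ 0 :=
      (map_ne_zero_iff _ hinj).mpr (nonZeroDivisors.ne_zero hb)
    have ha' : algebraMap R F a ≠ 0 := by
      intro h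
      rw [h, zero_div] at hf
      exact hf rfl
    have ha : a ≠ 0 := by
      rintro rfl
      simp at ha'
    obtain ⟨s, u, hs, ⟨h, c, hc⟩ | ⟨h, hc⟩⟩ :=
      ρ.exists_rel a b ha (nonZeroDivisors.ne_zero hb)
    · refine .inl ⟨c, u, s, hc, ?_⟩
      dsimp only
      rw [div_mul_eq_mul_div, div_eq_iff hb', ← map_mul, ← map_mul, ← h, mul_comm]
    · refine .inr ⟨u, s, hc, ?_⟩
      dsimp only
      rw [inv_div, div_mul_eq_mul_div, div_eq_iff ha', ← map_mul, ← map_mul, ← h, mul_comm]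

variable {ρ F}

lemma exists_common {v : Fin 3 → F} {c : Fin 3 → L} (h : ∀ i, (ρ.toPlace F).Val (v i) (c i)) :
    ∃ b, ρ.rel b b 1 ∧ ∃ a : Fin 3 → R, ∀ i, ρ.rel (a i) b (c i) ∧
      v i * algebraMap R F b = algebraMap R F (a i) := by
  choose a b h e using h
  obtain ⟨b', hb', a', h'⟩ := common h
  refine ⟨b', hb', a', fun i => ⟨(h' i).1, ?_⟩⟩
  have hb : algebraMap R F (b i) ≠ 0 :=
    (map_ne_zero_iff _ (IsFractionRing.injective R F)).mpr (ρ.ne_zero (h i))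
  have := congrArg (algebraMap R F) (h' i).2
  rw [map_mul, map_mul, ← e i] at this
  apply mul_right_cancel₀ hb
  rw [this]
  ring

end PrePlace

/-! ### The places of the function field at the points of the curve -/

section PlaceAt

variable {k : Type*} [Field k] (E : Affine k) {L : Type*} [Field L] [Algebra k L]

/-- Evaluation of fractions at an affine point. -/
noncomputable def affinePrePlace {x y : L} (h : (E⁄L).Nonsingular x y) :
    PrePlace k E.CoordinateRing L where
  rel a b c := evalAt E h.1 b ≠ 0 ∧ evalAt E h.1 a = c * evalAt E h.1 b
  add := by
    rintro a b c a' b' c' ⟨hb, hc⟩ ⟨hb', hc'⟩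
    refine ⟨by rw [map_mul]; exact mul_ne_zero hb hb', ?_⟩
    rw [map_add, map_mul, map_mul, map_mul, hc, hc']
    ring
  mul := by
    rintro a b c a' b' c' ⟨hb, hc⟩ ⟨hb', hc'⟩
    refine ⟨by rw [map_mul]; exact mul_ne_zero hb hb', ?_⟩
    rw [map_mul, map_mul, hc, hc']
    ring
  const a := by simp
  ne_zero := by
    rintro a b c ⟨hb, -⟩ rfl
    simp at hb
  self := fun h => ⟨h.1, by rw [one_mul]⟩
  zero := by
    rintro b c ⟨hb, hc⟩
    simpa [hb] using hc
  exists_rel a b ha hb := by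
    obtain ⟨s, u, hs, h' | h'⟩ := exists_mul_eq E h a b
    · by_cases hu : evalAt E h.1 u = 0
      · exact ⟨s, u, fun h0 => hs (by rw [h0, map_zero]), .inr ⟨h', hs, by rw [hu, zero_mul]⟩⟩
      · exact ⟨u, s, fun h0 => hu (by rw [h0, map_zero]), .inl ⟨h'.symm, _, hu,
          (div_mul_cancel₀ _ hu).symm⟩⟩
    · exact ⟨s, u, fun h0 => hs (by rw [h0, map_zero]), .inl ⟨h', _, hs,
          (div_mul_cancel₀ _ hs).symm⟩⟩

lemma poleOrder_X_pow (i : ℕ) : poleOrder (elt E X 0 ^ i) = (2 * i : ℕ) := by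
  simpa using poleOrder_X_pow_mul_Y_pow (E := E) i 0

lemma poleOrder_Y_pow (i : ℕ) : poleOrder (elt E 0 1 ^ i) = (3 * i : ℕ) := by
  simpa using poleOrder_X_pow_mul_Y_pow (E := E) 0 i

variable {E} in
lemma mem_poleFiltration_succ {a : E.CoordinateRing} {n : ℕ} (ha : poleOrder a = n) :
    a ∈ poleFiltration E (n + 1) := by
  rw [mem_poleFiltration, ha, Nat.cast_lt]
  omega

variable {E} in
lemma mul_mem_poleFiltration_of_mem {a b : E.CoordinateRing} {m n : ℕ}
    (ha : a ∈ poleFiltration E m) (hb : b ∈ poleFiltration E (n + 1)) :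
    a * b ∈ poleFiltration E (m + n) := by
  by_cases h0 : b = 0
  · rw [h0, mul_zero]
    exact Submodule.zero_mem _
  obtain ⟨l, hl⟩ := exists_poleOrder h0
  rw [mem_poleFiltration, hl, Nat.cast_lt] at hb
  exact poleFiltration_mono (by omega) (mul_mem_poleFiltration ha hl)

/-- Evaluation of fractions at the origin. -/
noncomputable def originPrePlace (L : Type*) [Field L] [Algebra k L] :
    PrePlace k E.CoordinateRing L where
  -- The fraction `a / b` has value `c₀` when `a - c₀ • b` has a smaller pole than `b`. The origin
  -- is rational, so finite values lie in `k`.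
  rel a b c := ∃ c₀ : k, algebraMap k L c₀ = c ∧ ∃ n : ℕ, poleOrder b = n ∧
    a - c₀ • b ∈ poleFiltration E n
  add := by
    rintro a b _ a' b' _ ⟨c, rfl, n, hb, h⟩ ⟨c', rfl, n', hb', h'⟩
    refine ⟨c + c', map_add _ _ _, n + n', by rw [poleOrder_mul, hb, hb', Nat.cast_add], ?_⟩
    have hb1 := mem_poleFiltration_succ hb
    have hb1' := mem_poleFiltration_succ hb'
    have e : a * b' + a' * b - (c + c') • (b * b') =
        (a - c • b) * b' + b * (a' - c' • b') := by
      simp only [Algebra.smul_def, map_add]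
      ring
    rw [e]
    refine Submodule.add_mem _ (mul_mem_poleFiltration_of_mem h hb1') ?_
    rw [mul_comm b, add_comm n]
    exact mul_mem_poleFiltration_of_mem h' hb1
  mul := by
    rintro a b _ a' b' _ ⟨c, rfl, n, hb, h⟩ ⟨c', rfl, n', hb', h'⟩
    refine ⟨c * c', map_mul _ _ _, n + n', by rw [poleOrder_mul, hb, hb', Nat.cast_add], ?_⟩
    have hb1 := mem_poleFiltration_succ hb
    have hb1' := mem_poleFiltration_succ hb'
    have ha1' : a' ∈ poleFiltration E (n' + 1) := by
      have := Submodule.add_mem _ (poleFiltration_mono (Nat.le_succ n') h')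
        (Submodule.smul_mem _ c' hb1')
      rwa [sub_add_cancel] at this
    have e : a * a' - (c * c') • (b * b') =
        (a - c • b) * a' + c • (b * (a' - c' • b')) := by
      simp only [Algebra.smul_def, map_mul]
      ring
    rw [e]
    refine Submodule.add_mem _ (mul_mem_poleFiltration_of_mem h ha1') (Submodule.smul_mem _ c ?_)
    rw [mul_comm b, add_comm n]
    exact mul_mem_poleFiltration_of_mem h' hb1
  const a := ⟨a, rfl, 0, poleOrder_one, by
    rw [Algebra.algebraMap_eq_smul_one, sub_self]; exact Submodule.zero_mem _⟩
  ne_zero := by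
    rintro a b _ ⟨-, -, n, hb, -⟩
    exact ne_zero_of_poleOrder hb
  self := by
    rintro a b _ ⟨-, -, n, hb, -⟩
    exact ⟨1, map_one _, n, hb, by rw [one_smul, sub_self]; exact Submodule.zero_mem _⟩
  zero := by
    rintro b _ ⟨c, rfl, n, hb, h⟩
    by_contra hc
    have hc : c ≠ 0 := by
      rintro rfl
      exact hc (map_zero _)
    rw [zero_sub, Submodule.neg_mem_iff, Submodule.smul_mem_iff _ hc, mem_poleFiltration, hb] at h
    exact lt_irrefl _ h
  exists_rel a b ha hb := by
    obtain ⟨n, hn⟩ := exists_poleOrder ha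
    obtain ⟨m, hm⟩ := exists_poleOrder hb
    have key : ∀ {a b : E.CoordinateRing} {n m : ℕ}, poleOrder a = n → poleOrder b = m → n ≤ m →
        ∃ c : k, a - c • b ∈ poleFiltration E m := by
      intro a b n m hn hm h
      refine exists_sub_smul_mem ?_ hm
      rw [mem_poleFiltration, hn, Nat.cast_lt]
      omega
    by_cases h : n ≤ m
    · obtain ⟨c, hc⟩ := key hn hm h
      exact ⟨b, a, hb, .inl ⟨mul_comm _ _, _, c, rfl, m, hm, hc⟩⟩
    · refine ⟨a, b, ha, .inr ⟨mul_comm _ _, 0, map_zero _, n, hn, ?_⟩⟩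
      rw [zero_smul, sub_zero, mem_poleFiltration, hm, Nat.cast_lt]
      omega

/-- The place of the function field at a point of the curve. -/
noncomputable def placeAt : (E⁄L).Point → Place k E.FunctionField L
  | .zero => (originPrePlace E L).toPlace E.FunctionField
  | .some _ _ h => (affinePrePlace E h).toPlace E.FunctionField

lemma aeval_coords_zero (f : MvPolynomial (Fin 3) k) :
    MvPolynomial.aeval (coords (0 : (E⁄L).Point)) f =
      algebraMap k L (MvPolynomial.eval ![0, 1, 0] f) := by
  have : (coords (0 : (E⁄L).Point)) = fun i => algebraMap k L (![0, 1, 0] i) := by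
    funext i
    change ![0, 1, 0] i = _
    fin_cases i <;> simp
  rw [this]
  exact MvPolynomial.aeval_algebraMap_apply L ![0, 1, 0] f

variable {E}

/-- Near a given point, a triple of functions is proportional to a triple of forms. -/
lemma exists_forms {Q : (E⁄L).Point} {v : Fin 3 → E.FunctionField} {w : Fin 3 → L}
    (h : ∀ i, (placeAt E Q).Val (v i) (w i)) :
    ∃ f : Fin 3 → MvPolynomial (Fin 3) k, (∃ d, ∀ i, (f i).IsHomogeneous d) ∧
      (∃ μ : E.FunctionField, μ ≠ 0 ∧ evalTriple f (genericCoords E) = μ • v) ∧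
      ∃ ν : L, ν ≠ 0 ∧ evalTriple f (coords Q) = ν • w := by
  have hinj := IsFractionRing.injective E.CoordinateRing E.FunctionField
  match Q with
  | .some x y hQ =>
    obtain ⟨b, ⟨hb, -⟩, a, ha⟩ := PrePlace.exists_common h
    choose d hd using fun i => exists_degree_bound E (a i)
    have hd' : ∀ i, a i ∈ poleFiltration E (3 * (d 0 + d 1 + d 2) + 1) := fun i =>
      poleFiltration_mono (by fin_cases i <;> simp <;> omega) (hd i)
    choose f hf hfa _ using fun i => exists_form_of_mem E le_rfl (hd' i)
    refine ⟨f, ⟨_, hf⟩, ⟨algebraMap _ _ b, ?_, ?_⟩, evalAt E hQ.1 b, hb, ?_⟩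
    · rw [Ne, map_eq_zero_iff _ hinj]
      rintro rfl
      exact hb (map_zero _)
    · funext i
      rw [evalTriple, ← algebraMap_aeval, hfa, ← (ha i).2, Pi.smul_apply, smul_eq_mul, mul_comm]
    · funext i
      rw [evalTriple, ← evalAt_aeval, hfa, (ha i).1.2, Pi.smul_apply, smul_eq_mul, mul_comm]
  | .zero =>
    obtain ⟨b, ⟨-, -, n, hb, -⟩, a, ha⟩ := PrePlace.exists_common h
    -- Multiplying numerators and denominator by `x ^ n` raises the pole order of the denominator
    -- from `n` to `3 * n`, that of a form of degree `n` which does not vanish at the origin.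
    have hX : poleOrder (elt E X 0 ^ n * b) = (3 * n : ℕ) := by
      rw [poleOrder_mul, poleOrder_X_pow, hb, ← Nat.cast_add]
      congr 1
      ring
    choose c hc m hm hac using fun i => (ha i).1
    have hac' : ∀ i, elt E X 0 ^ n * a i - c i • (elt E X 0 ^ n * b) ∈
        poleFiltration E (3 * n) := by
      intro i
      have hmn : m i = n := by
        have := (hm i).symm.trans hb
        exact_mod_cast this
      have := mul_mem_poleFiltration (hac i) (poleOrder_X_pow E n)
      rw [hmn] at this
      convert this using 1
      · congr 1
        ring
      · rw [Algebra.smul_def, Algebra.smul_def]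
        ring
    have hXb : elt E X 0 ^ n * b ∈ poleFiltration E (3 * n + 1) := by
      rw [mem_poleFiltration, hX, Nat.cast_lt]
      omega
    obtain ⟨g, hg, hgb, -⟩ := exists_form_of_mem E le_rfl hXb
    have hXa : ∀ i, elt E X 0 ^ n * a i ∈ poleFiltration E (3 * n + 1) := by
      intro i
      have := Submodule.add_mem _ (poleFiltration_mono (Nat.le_succ _) (hac' i))
        (Submodule.smul_mem _ (c i) hXb)
      rwa [sub_add_cancel] at this
    choose f hf hfa _ using fun i => exists_form_of_mem E le_rfl (hXa i)
    have key : ∀ F : MvPolynomial (Fin 3) k, F.IsHomogeneous n →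
        MvPolynomial.aeval (ringCoords E) F ∈ poleFiltration E (3 * n) →
        MvPolynomial.eval ![0, 1, 0] F = 0 := by
      intro F hF hF'
      have := Submodule.sub_mem _ hF' (aeval_sub_eval_origin_mem E hF)
      by_contra h0
      rw [sub_sub_cancel, Submodule.smul_mem_iff _ h0, mem_poleFiltration,
        poleOrder_Y_pow] at this
      exact lt_irrefl _ this
    refine ⟨f, ⟨_, hf⟩, ⟨algebraMap _ _ (elt E X 0 ^ n * b), ?_, ?_⟩,
      algebraMap k L (MvPolynomial.eval ![0, 1, 0] g), ?_, ?_⟩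
    · rw [Ne, map_eq_zero_iff _ hinj]
      exact ne_zero_of_poleOrder hX
    · funext i
      rw [evalTriple, ← algebraMap_aeval, hfa, Pi.smul_apply, smul_eq_mul, map_mul, map_mul,
        ← (ha i).2]
      ring
    · rw [Ne, map_eq_zero_iff _ (algebraMap k L).injective]
      intro h0
      have := aeval_sub_eval_origin_mem E hg
      rw [hgb, h0, zero_smul, sub_zero, mem_poleFiltration, hX] at this
      exact lt_irrefl _ this
    · funext i
      refine (aeval_coords_zero E (f i)).trans ?_
      have h1 : MvPolynomial.eval ![0, 1, 0] (f i - c i • g) = 0 := by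
        apply key
        · exact (hf i).sub (by
            rw [MvPolynomial.smul_eq_C_mul]
            simpa using (MvPolynomial.isHomogeneous_C (Fin 3) (c i)).mul hg)
        · rw [map_sub, map_smul, hfa, hgb]
          exact hac' i
      rw [map_sub, MvPolynomial.smul_eval, sub_eq_zero] at h1
      rw [h1, map_mul, hc, Pi.smul_apply, smul_eq_mul, mul_comm]

/-- After scaling, forms of the same degree have values at every point. -/
lemma exists_val_of_isHomogeneous {f : Fin 3 → MvPolynomial (Fin 3) k} {d : ℕ}
    (hf : ∀ i, (f i).IsHomogeneous d) (Q : (E⁄L).Point) : ∃ μ : E.FunctionField, μ ≠ 0 ∧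
      ∀ i, (placeAt E Q).Val (μ * evalTriple f (genericCoords E) i)
        (evalTriple f (coords Q) i) := by
  have hinj := IsFractionRing.injective E.CoordinateRing E.FunctionField
  match Q with
  | .some x y hQ =>
    refine ⟨1, one_ne_zero, fun i => ⟨MvPolynomial.aeval (ringCoords E) (f i), 1, ?_, ?_⟩⟩
    · exact ⟨by simp, by rw [evalAt_aeval, map_one, mul_one]; rfl⟩
    · rw [algebraMap_aeval, map_one, mul_one, one_mul]
      rfl
  | .zero =>
    -- The pole of `y ^ d` is the largest that a form of degree `d` can have, so division by `y ^ d`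
    -- leaves finite values.
    have hY : poleOrder (elt E 0 1 ^ d) = (3 * d : ℕ) := poleOrder_Y_pow E d
    have hY0 : algebraMap E.CoordinateRing E.FunctionField (elt E 0 1 ^ d) ≠ 0 := by
      rw [Ne, map_eq_zero_iff _ hinj]
      exact ne_zero_of_poleOrder hY
    refine ⟨(algebraMap _ _ (elt E 0 1 ^ d))⁻¹, inv_ne_zero hY0, fun i =>
      ⟨MvPolynomial.aeval (ringCoords E) (f i), elt E 0 1 ^ d, ?_, ?_⟩⟩
    · exact ⟨MvPolynomial.eval ![0, 1, 0] (f i), (aeval_coords_zero E (f i)).symm, _, hY,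
        aeval_sub_eval_origin_mem E (hf i)⟩
    · rw [mul_comm, mul_inv_cancel_left₀ hY0, algebraMap_aeval]
      rfl

end PlaceAt

/-! ### Morphisms -/

section Morphisms

variable {k : Type*} [Field k] {L : Type*} [Field L] [Algebra k L]

/-- The triple `f` of forms over `k` computes the self-map `φ` of the points over `L`. -/
def ComputesOver {C : Affine L} (f : Fin 3 → MvPolynomial (Fin 3) k) (φ : C.Point → C.Point) :
    Prop :=
  (∃ d : ℕ, ∀ i, (f i).IsHomogeneous d) ∧ ∀ Q : C.Point,
    evalTriple f (coords Q) ≠ 0 → SamePoint (coords (φ Q)) (evalTriple f (coords Q))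

variable (k) in
/-- The self-map `φ` of the points over `L` is a morphism defined over `k`. -/
def IsMor (C : Affine L) (φ : C.Point → C.Point) : Prop :=
  ∀ P : C.Point, ∃ f : Fin 3 → MvPolynomial (Fin 3) k,
    evalTriple f (coords P) ≠ 0 ∧ ComputesOver f φ

lemma evalTriple_smul {f : Fin 3 → MvPolynomial (Fin 3) k} {d : ℕ}
    (hf : ∀ i, (f i).IsHomogeneous d) (u : L) (v : Fin 3 → L) :
    evalTriple f (u • v) = u ^ d • evalTriple f v := by
  funext i
  rw [Pi.smul_apply, evalTriple, evalTriple, (f i).as_sum, map_sum, map_sum, Finset.smul_sum]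
  refine Finset.sum_congr rfl fun m hm => ?_
  rw [MvPolynomial.aeval_monomial, MvPolynomial.aeval_monomial,
    Finsupp.prod_fintype _ _ (fun i => pow_zero _), Finsupp.prod_fintype _ _ (fun i => pow_zero _),
    Fin.prod_univ_three, Fin.prod_univ_three, ← sum_eq_of_mem_support (hf i) hm]
  simp only [Pi.smul_apply, smul_eq_mul]
  ring

lemma isMor_id (C : Affine L) : IsMor k C id := by
  have h : ∀ Q : C.Point, evalTriple (MvPolynomial.X (R := k)) (coords Q) = coords Q := by
    intro Q
    funext i
    simp [evalTriple]
  exact fun P => ⟨MvPolynomial.X, by rw [h]; exact coords_ne_zero P,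
    ⟨1, fun i => MvPolynomial.isHomogeneous_X k i⟩, fun Q _ => by rw [h]; exact SamePoint.refl _⟩

lemma IsMor.comp {C : Affine L} {φ ψ : C.Point → C.Point} (hφ : IsMor k C φ) (hψ : IsMor k C ψ) :
    IsMor k C (φ ∘ ψ) := by
  intro P
  obtain ⟨g, hg, ⟨d, hd⟩, hgψ⟩ := hψ P
  obtain ⟨f, hf, ⟨e, he⟩, hfφ⟩ := hφ (ψ P)
  have hfg : ∀ Q : C.Point, evalTriple (fun i => MvPolynomial.aeval g (f i)) (coords Q) =
      evalTriple f (evalTriple g (coords Q)) := by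
    intro Q
    funext i
    exact MvPolynomial.aeval_bind₁ _ _ _
  have hscale := evalTriple_smul (L := L) he
  have key : ∀ Q : C.Point, evalTriple g (coords Q) ≠ 0 → ∃ u : Lˣ,
      evalTriple f (coords (ψ Q)) =
        (u : L) • evalTriple (fun i => MvPolynomial.aeval g (f i)) (coords Q) := by
    intro Q hQ
    obtain ⟨u, hu⟩ := hgψ Q hQ
    exact ⟨u ^ e, by rw [hu, hscale, hfg, Units.val_pow_eq_pow_val]⟩
  refine ⟨fun i => MvPolynomial.aeval g (f i), fun h0 => ?_, ⟨d * e, fun i => (he i).aeval g hd⟩,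
    fun Q hQ => ?_⟩
  · obtain ⟨u, hu⟩ := key P hg
    rw [h0, smul_zero] at hu
    exact hf hu
  · by_cases hQg : evalTriple g (coords Q) = 0
    · rw [hfg, hQg] at hQ
      -- At a common zero of `g` the composite can be nonzero only if `f` consists of constants, and
      -- then it does not depend on the point at which it is evaluated.
      by_cases he0 : e = 0
      · have hc : ∀ v w : Fin 3 → L, evalTriple f v = evalTriple f w := by
          intro v w
          rw [show evalTriple f v = evalTriple f 0 by simpa [he0] using (hscale 0 v).symm,
            show evalTriple f w = evalTriple f 0 by simpa [he0] using (hscale 0 w).symm]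
        have := hfφ (ψ Q) (by rwa [hc _ 0])
        rwa [hfg, hQg, hc 0 (coords (ψ Q))]
      · have := hscale 0 0
        rw [smul_zero, zero_pow he0, zero_smul] at this
        exact absurd this hQ
    · obtain ⟨u, hu⟩ := key Q hQg
      have := hfφ (ψ Q) (by rw [hu]; simpa using hQ)
      exact this.trans ⟨u, hu⟩

end Morphisms

/-! ### Points over the function field and the morphisms that they define -/

section PointMap

variable {k : Type*} [Field k] (E : Affine k) {L : Type*} [Field L] [Algebra k L]

lemma exists_equation [IsAlgClosed L] (C : Affine L) (x : L) : ∃ y, C.Equation x y := by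
  obtain ⟨y, hy⟩ := IsAlgClosed.exists_root
    (Polynomial.X ^ 2 + Polynomial.C (C.a₁ * x + C.a₃) * Polynomial.X -
      Polynomial.C (x ^ 3 + C.a₂ * x ^ 2 + C.a₄ * x + C.a₆) : L[X])
    (by rw [show (Polynomial.X ^ 2 + Polynomial.C (C.a₁ * x + C.a₃) * Polynomial.X -
          Polynomial.C (x ^ 3 + C.a₂ * x ^ 2 + C.a₄ * x + C.a₆) : L[X]).degree = 2 by
            compute_degree!]; norm_num)
  refine ⟨y, (Affine.equation_iff _ _).mpr ?_⟩
  simp only [IsRoot.def, eval_sub, eval_add, eval_mul, eval_pow, eval_X, eval_C] at hy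
  linear_combination hy

lemma exists_point [IsAlgClosed L] (C : Affine L) [C.IsElliptic] (x : L) :
    ∃ y, C.Nonsingular x y := by
  obtain ⟨y, hy⟩ := exists_equation C x
  exact ⟨y, Affine.equation_iff_nonsingular.mp hy⟩

/-- A regular function that vanishes at all affine geometric points is zero. -/
lemma eq_zero_of_evalAt [IsAlgClosed L] {a : E.CoordinateRing}
    (h : ∀ x y : L, ∀ h : (E⁄L).Equation x y, evalAt E h a = 0) : a = 0 := by
  -- The norm to `k[X]` is the product of the function with its conjugate, so as a polynomial in `x`
  -- it vanishes on all of `L`.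
  rw [← Algebra.norm_eq_zero_iff (R := k[X])]
  obtain ⟨p, q, rfl⟩ := exists_elt E a
  have hn := Affine.CoordinateRing.coe_norm_smul_basis (W' := E) p q
  rw [← Polynomial.map_eq_zero (algebraMap k L)]
  refine Polynomial.funext fun x => ?_
  obtain ⟨y, hy⟩ := exists_equation (E⁄L) x
  have h1 : evalAt E hy (algebraMap k[X] E.CoordinateRing (Algebra.norm k[X] (elt E p q))) = 0 := by
    rw [AdjoinRoot.algebraMap_eq, elt, hn, map_mul, ← elt_eq_mk, map_mul, h x y hy, zero_mul]
  rw [AdjoinRoot.algebraMap_eq, evalAt, AdjoinRoot.liftAlgHom_of] at h1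
  rw [Polynomial.eval_map_algebraMap, Polynomial.eval_zero]
  exact h1

lemma aeval_genericCoords_eq_zero [IsAlgClosed L] [E.IsElliptic] {F : MvPolynomial (Fin 3) k}
    (h : ∀ Q : (E⁄L).Point, MvPolynomial.aeval (coords Q) F = 0) :
    MvPolynomial.aeval (genericCoords E) F = 0 := by
  have : MvPolynomial.aeval (ringCoords E) F = 0 := eq_zero_of_evalAt (L := L) E
    fun x y hxy => (evalAt_aeval E (Affine.equation_iff_nonsingular.mp hxy) F).trans (h _)
  rw [← algebraMap_aeval, this, map_zero]

variable {E}

/-- The cross products are forms that vanish at every geometric point, because there one triple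
vanishes or both represent `φ Q`; hence they vanish at the generic point. -/
lemma evalTriple_cross [IsAlgClosed L] [E.IsElliptic] {φ : (E⁄L).Point → (E⁄L).Point}
    {f f' : Fin 3 → MvPolynomial (Fin 3) k} (hf : ComputesOver f φ) (hf' : ComputesOver f' φ)
    (i j : Fin 3) :
    evalTriple f (genericCoords E) i * evalTriple f' (genericCoords E) j =
      evalTriple f (genericCoords E) j * evalTriple f' (genericCoords E) i := by
  have := aeval_genericCoords_eq_zero E (L := L) (F := f i * f' j - f j * f' i) fun Q => by
    rw [map_sub, map_mul, map_mul, sub_eq_zero]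
    change evalTriple f (coords Q) i * evalTriple f' (coords Q) j =
      evalTriple f (coords Q) j * evalTriple f' (coords Q) i
    by_cases h : evalTriple f (coords Q) = 0
    · simp [h]
    by_cases h' : evalTriple f' (coords Q) = 0
    · simp [h']
    exact ((hf.2 Q h).symm.trans (hf'.2 Q h')).cross i j
  rwa [map_sub, map_mul, map_mul, sub_eq_zero] at this

lemma evalTriple_genericCoords_ne_zero {f : Fin 3 → MvPolynomial (Fin 3) k}
    (hf : ∃ d, ∀ i, (f i).IsHomogeneous d) {Q : (E⁄L).Point}
    (hQ : evalTriple f (coords Q) ≠ 0) : evalTriple f (genericCoords E) ≠ 0 := by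
  intro h0
  obtain ⟨d, hd⟩ := hf
  obtain ⟨μ, hμ, hv⟩ := exists_val_of_isHomogeneous hd Q
  refine hQ (funext fun i => ?_)
  have := hv i
  rw [h0, Pi.zero_apply, mul_zero] at this
  exact this.unique Place.val_zero

lemma equation_evalTriple [IsAlgClosed L] [E.IsElliptic] {φ : (E⁄L).Point → (E⁄L).Point}
    {f : Fin 3 → MvPolynomial (Fin 3) k} (hf : ComputesOver f φ) :
    Projective.Equation (E⁄E.FunctionField) (evalTriple f (genericCoords E)) := by
  have := aeval_genericCoords_eq_zero E (L := L)
    (F := f 1 ^ 2 * f 2 + MvPolynomial.C E.a₁ * f 0 * f 1 * f 2 + MvPolynomial.C E.a₃ * f 1 * f 2 ^ 2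
      - (f 0 ^ 3 + MvPolynomial.C E.a₂ * f 0 ^ 2 * f 2 + MvPolynomial.C E.a₄ * f 0 * f 2 ^ 2 +
        MvPolynomial.C E.a₆ * f 2 ^ 3)) fun Q => by
    by_cases h : evalTriple f (coords Q) = 0
    · have h' : ∀ i, MvPolynomial.aeval (coords Q) (f i) = 0 := fun i => congrFun h i
      simp [h']
    · have := (hf.2 Q h).nonsingular.1
      rw [Projective.equation_iff] at this
      simpa [evalTriple] using this
  rw [Projective.equation_iff]
  simpa [evalTriple] using this

lemma coords_baseChange [DecidableEq k] {F : Type*} [Field F] [DecidableEq F] [Algebra k F]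
    (c : (E⁄k).Point) (i : Fin 3) : coords (Affine.Point.baseChange k F c) i =
      algebraMap k F (coords c i) := by
  cases c with
  | zero =>
    change ![0, 1, 0] i = algebraMap k F (![0, 1, 0] i)
    fin_cases i <;> simp
  | some x y h =>
    change ![_, _, 1] i = algebraMap k F (![x, y, 1] i)
    fin_cases i <;> simp [Algebra.ofId_apply]

variable [DecidableEq E.FunctionField] [DecidableEq L] [E.IsElliptic]

variable (E) in
/-- The map on points over `L` that a point over the function field defines. -/
noncomputable def pointMap (g : (E⁄E.FunctionField).Point) (Q : (E⁄L).Point) : (E⁄L).Point :=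
  (placeAt E Q).sp E g

lemma computesOver_pointMap {g : (E⁄E.FunctionField).Point} {f : Fin 3 → MvPolynomial (Fin 3) k}
    (hf : ∃ d, ∀ i, (f i).IsHomogeneous d)
    (hg : SamePoint (coords g) (evalTriple f (genericCoords E))) :
    ComputesOver f (pointMap E (L := L) g) := by
  refine ⟨hf, fun Q hQ => ?_⟩
  obtain ⟨d, hd⟩ := hf
  obtain ⟨μ, hμ, hv⟩ := exists_val_of_isHomogeneous (E := E) hd Q
  have hg' : SamePoint (coords g) (μ • evalTriple f (genericCoords E)) :=
    hg.trans (samePoint_smul hμ _).symm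
  obtain ⟨R, hR⟩ := exists_samePoint hQ (Place.equation_of_val hv hg'.nonsingular.1)
  have : pointMap E g Q = R := Place.Specializes.sp_eq ⟨_, _, hv, hg', hR⟩
  rwa [this]

lemma exists_forms_pointMap (g : (E⁄E.FunctionField).Point) (P : (E⁄L).Point) :
    ∃ f : Fin 3 → MvPolynomial (Fin 3) k, (∃ d, ∀ i, (f i).IsHomogeneous d) ∧
      SamePoint (coords g) (evalTriple f (genericCoords E)) ∧ evalTriple f (coords P) ≠ 0 := by
  obtain ⟨v, w, hvw, hv, hw⟩ := Place.specializes_sp (A := placeAt E P) (E := E) g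
  obtain ⟨f, hf, ⟨μ, hμ, hf1⟩, ν, hν, hf2⟩ := exists_forms hvw
  refine ⟨f, hf, hf1 ▸ hv.trans (samePoint_smul hμ v).symm, ?_⟩
  rw [hf2]
  exact smul_ne_zero hν (hw.ne_zero (coords_ne_zero _))

lemma isMor_pointMap (g : (E⁄E.FunctionField).Point) : IsMor k (E⁄L) (pointMap E g) := by
  intro P
  obtain ⟨f, hf, hg, h0⟩ := exists_forms_pointMap g P
  exact ⟨f, h0, computesOver_pointMap hf hg⟩

/-- A triple that computes `φ` near the origin, evaluated at the generic point, is the required `g`.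
Another triple may be needed near another point, but by `evalTriple_cross` it defines the same `g`.
-/
lemma exists_pointMap_eq [IsAlgClosed L] {φ : (E⁄L).Point → (E⁄L).Point}
    (hφ : IsMor k (E⁄L) φ) : ∃ g, pointMap E g = φ := by
  obtain ⟨f, hf0, hf⟩ := hφ 0
  obtain ⟨g, hg⟩ := exists_samePoint (evalTriple_genericCoords_ne_zero hf.1 hf0)
    (equation_evalTriple hf)
  refine ⟨g, funext fun Q => ?_⟩
  obtain ⟨f', hf0', hf'⟩ := hφ Q
  have hg' : SamePoint (coords g) (evalTriple f' (genericCoords E)) :=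
    hg.trans (samePoint_of_cross (evalTriple_genericCoords_ne_zero hf.1 hf0)
      (evalTriple_genericCoords_ne_zero hf'.1 hf0') (evalTriple_cross hf hf'))
  exact eq_of_samePoint ((computesOver_pointMap hf'.1 hg').2 Q hf0') (hf'.2 Q hf0')

variable (E L) in
lemma pointMap_injective [IsAlgClosed L] : Function.Injective (pointMap E (L := L)) := by
  intro g g' h
  obtain ⟨f, hf, hg, -⟩ := exists_forms_pointMap (L := L) g 0
  obtain ⟨f', hf', hg', -⟩ := exists_forms_pointMap (L := L) g' 0
  have h1 := computesOver_pointMap (L := L) hf hg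
  have h2 := computesOver_pointMap (L := L) hf' hg'
  rw [← h] at h2
  exact eq_of_samePoint hg (hg'.trans (samePoint_of_cross (hg'.ne_zero (coords_ne_zero _))
    (hg.ne_zero (coords_ne_zero _)) (evalTriple_cross h2 h1)))

lemma pointMap_add (g g' : (E⁄E.FunctionField).Point) (Q : (E⁄L).Point) :
    pointMap E (g + g') Q = pointMap E g Q + pointMap E g' Q := map_add _ _ _

/-- Addition is transported from the group `E(K(E))`, which avoids covering `E × E` by addition
formulas without common zeros. -/
lemma IsMor.add [IsAlgClosed L] {φ ψ : (E⁄L).Point → (E⁄L).Point} (hφ : IsMor k (E⁄L) φ)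
    (hψ : IsMor k (E⁄L) ψ) : IsMor k (E⁄L) fun Q => φ Q + ψ Q := by
  obtain ⟨g, rfl⟩ := exists_pointMap_eq hφ
  obtain ⟨g', rfl⟩ := exists_pointMap_eq hψ
  have : pointMap E (L := L) (g + g') = fun Q => pointMap E g Q + pointMap E g' Q :=
    funext fun Q => map_add _ _ _
  exact this ▸ isMor_pointMap (L := L) (g + g')

lemma IsMor.neg [IsAlgClosed L] {φ : (E⁄L).Point → (E⁄L).Point} (hφ : IsMor k (E⁄L) φ) :
    IsMor k (E⁄L) fun Q => -φ Q := by
  obtain ⟨g, rfl⟩ := exists_pointMap_eq hφ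
  have : pointMap E (L := L) (-g) = fun Q => -pointMap E g Q := funext fun Q => map_neg _ _
  exact this ▸ isMor_pointMap (L := L) (-g)

lemma pointMap_baseChange [DecidableEq k] (c : (E⁄k).Point) (Q : (E⁄L).Point) :
    pointMap E (Affine.Point.baseChange k E.FunctionField c) Q =
      Affine.Point.baseChange k L c := by
  refine Place.Specializes.sp_eq ⟨_, _, fun i => ?_, SamePoint.refl _, SamePoint.refl _⟩
  rw [coords_baseChange, coords_baseChange]
  exact Place.val_algebraMap _

lemma isMor_const [DecidableEq k] (c : (E⁄k).Point) :
    IsMor k (E⁄L) fun _ => Affine.Point.baseChange k L c := by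
  have : pointMap E (L := L) (Affine.Point.baseChange k E.FunctionField c) =
    fun _ => Affine.Point.baseChange k L c := funext fun Q => pointMap_baseChange c Q
  exact this ▸ isMor_pointMap (L := L) _

/-- Forms over `k` take values in `k` at the rational point `[0 : 1 : 0]`. This is why the constant
to be subtracted from `g` is rational. -/
lemma pointMap_zero_eq_baseChange [DecidableEq k] (g : (E⁄E.FunctionField).Point) :
    pointMap E g (0 : (E⁄L).Point) =
      Affine.Point.baseChange k L (pointMap E g (0 : (E⁄k).Point)) := by
  obtain ⟨f, hf, hg, h0⟩ := exists_forms_pointMap g (0 : (E⁄L).Point)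
  have he : evalTriple f (coords (0 : (E⁄L).Point)) =
      fun i => algebraMap k L (evalTriple f (coords (0 : (E⁄k).Point)) i) := by
    funext i
    refine (aeval_coords_zero E (f i)).trans (congrArg _ ?_)
    exact (aeval_coords_zero E (L := k) (f i)).symm
  have h0' : evalTriple f (coords (0 : (E⁄k).Point)) ≠ 0 := by
    intro h
    rw [h] at he
    exact h0 (he.trans (funext fun i => map_zero _))
  obtain ⟨u, hu⟩ := (computesOver_pointMap hf hg).2 (0 : (E⁄k).Point) h0'
  refine eq_of_samePoint ((computesOver_pointMap hf hg).2 (0 : (E⁄L).Point) h0)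
    ⟨Units.map (algebraMap k L).toMonoidHom u, ?_⟩
  funext i
  rw [coords_baseChange, hu, he]
  simp

end PointMap

/-! ### Rational curves on an elliptic curve are constant -/

section Constancy

lemma exists_mul_primitive {R : Type*} [CommRing R] [IsDomain R] [IsPrincipalIdealRing R]
    {P : Fin 3 → R} (hP : P ≠ 0) : ∃ s, s ≠ 0 ∧ ∃ Q u : Fin 3 → R, (∀ i, P i = s * Q i) ∧
      u 0 * Q 0 + u 1 * Q 1 + u 2 * Q 2 = 1 := by
  obtain ⟨s, hs⟩ := (IsPrincipalIdealRing.principal (Ideal.span (Set.range P))).principal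
  have hmem : ∀ i, P i ∈ Ideal.span {s} := by
    intro i
    rw [Ideal.span, ← hs]
    exact Ideal.subset_span ⟨i, rfl⟩
  have hs0 : s ≠ 0 := by
    rintro rfl
    refine hP (funext fun i => ?_)
    simpa using hmem i
  choose Q hQ using fun i => Ideal.mem_span_singleton'.mp (hmem i)
  have h1 : s ∈ Ideal.span (Set.range P) := by
    rw [hs]
    exact Submodule.mem_span_singleton_self s
  obtain ⟨u, hu⟩ := Ideal.mem_span_range_iff_exists_fun.mp h1
  refine ⟨s, hs0, Q, u, fun i => by rw [← hQ i, mul_comm], mul_left_cancel₀ hs0 ?_⟩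
  rw [Fin.sum_univ_three] at hu
  rw [mul_one]
  conv_rhs => rw [← hu]
  rw [← hQ 0, ← hQ 1, ← hQ 2]
  ring

lemma C_two {R : Type*} [CommRing R] : (C 2 : R[X]) = 2 := map_ofNat C 2

lemma C_three {R : Type*} [CommRing R] : (C 3 : R[X]) = 3 := map_ofNat C 3

lemma cross_of_cyclic {R : Type*} [CommRing R] {D G : Fin 3 → R} (h01 : D 0 * G 1 = D 1 * G 0)
    (h12 : D 1 * G 2 = D 2 * G 1) (h20 : D 2 * G 0 = D 0 * G 2) (i j : Fin 3) :
    D i * G j = D j * G i := by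
  fin_cases i <;> fin_cases j
  exacts [rfl, h01, h20.symm, h01.symm, rfl, h12, h20, h12.symm, rfl]

variable {L : Type*} [Field L]

lemma exists_bezout [IsAlgClosed L] {P : Fin 3 → L[X]} (h : ∀ a, ∃ i, (P i).eval a ≠ 0) :
    ∃ u : Fin 3 → L[X], u 0 * P 0 + u 1 * P 1 + u 2 * P 2 = 1 := by
  have hP : P ≠ 0 := by
    rintro rfl
    obtain ⟨i, hi⟩ := h 0
    simp at hi
  obtain ⟨s, hs, Q, u, hQ, hu⟩ := exists_mul_primitive hP
  have hu' : IsUnit s := by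
    rw [Polynomial.isUnit_iff_degree_eq_zero]
    by_contra hd
    obtain ⟨a, ha⟩ := IsAlgClosed.exists_root s hd
    obtain ⟨i, hi⟩ := h a
    rw [hQ, eval_mul, ha.eq_zero, zero_mul] at hi
    exact hi rfl
  obtain ⟨v, hv⟩ := hu'.exists_left_inv
  refine ⟨fun i => v * u i, ?_⟩
  simp only [hQ]
  linear_combination hu + (u 0 * Q 0 + u 1 * Q 1 + u 2 * Q 2) * hv

variable {W : Affine L}

/-- The gradient of the Weierstrass equation. -/
def gradient {R : Type*} [CommRing R] (W : Projective R) (P : Fin 3 → R) : Fin 3 → R :=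
  ![W.a₁ * P 1 * P 2 - (3 * P 0 ^ 2 + 2 * W.a₂ * P 0 * P 2 + W.a₄ * P 2 ^ 2),
    2 * P 1 * P 2 + W.a₁ * P 0 * P 2 + W.a₃ * P 2 ^ 2,
    P 1 ^ 2 + W.a₁ * P 0 * P 1 + 2 * W.a₃ * P 1 * P 2 -
      (W.a₂ * P 0 ^ 2 + 2 * W.a₄ * P 0 * P 2 + 3 * W.a₆ * P 2 ^ 2)]

lemma exists_gradient_ne_zero [W.IsElliptic] {v : Fin 3 → L} (hv : v ≠ 0)
    (h : Projective.Equation W v) : ∃ j, gradient W v j ≠ 0 := by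
  rcases ((Projective.nonsingular_iff _).mp (nonsingular_of_equation hv h)).2 with h | h | h
  exacts [⟨0, h⟩, ⟨1, h⟩, ⟨2, h⟩]

lemma equation_iff_polynomial {P : Fin 3 → L[X]} : Projective.Equation (W⁄L[X]) P ↔
    P 1 ^ 2 * P 2 + C W.a₁ * P 0 * P 1 * P 2 + C W.a₃ * P 1 * P 2 ^ 2 -
      (P 0 ^ 3 + C W.a₂ * P 0 ^ 2 * P 2 + C W.a₄ * P 0 * P 2 ^ 2 + C W.a₆ * P 2 ^ 3) = 0 := by
  rw [Projective.equation_iff]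
  rfl

lemma equation_eval {P : Fin 3 → L[X]} (h : Projective.Equation (W⁄L[X]) P) (a : L) :
    Projective.Equation W (fun i => (P i).eval a) := by
  rw [equation_iff_polynomial] at h
  rw [Projective.equation_iff]
  simpa using congrArg (eval a) h

lemma gradient_eval (P : Fin 3 → L[X]) (a : L) (j : Fin 3) :
    (gradient (W⁄L[X]) P j).eval a = gradient W (fun i => (P i).eval a) j := by
  fin_cases j <;> simp [gradient]

lemma coeff_mul_three {P : Fin 3 → L[X]} {N : ℕ} (hN : ∀ i, (P i).natDegree ≤ N)
    (i j l : Fin 3) : (P i * P j * P l).coeff (N + N + N) =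
      (P i).coeff N * (P j).coeff N * (P l).coeff N := by
  rw [coeff_mul_add_eq_of_natDegree_le (natDegree_mul_le_of_le (hN i) (hN j)) (hN l),
    coeff_mul_add_eq_of_natDegree_le (hN i) (hN j)]

lemma equation_coeff {P : Fin 3 → L[X]} {N : ℕ} (hN : ∀ i, (P i).natDegree ≤ N)
    (h : Projective.Equation (W⁄L[X]) P) : Projective.Equation W (fun i => (P i).coeff N) := by
  rw [equation_iff_polynomial] at h
  rw [Projective.equation_iff]
  have h' : P 1 * P 1 * P 2 + C W.a₁ * (P 0 * P 1 * P 2) + C W.a₃ * (P 1 * P 2 * P 2) -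
      (P 0 * P 0 * P 0 + C W.a₂ * (P 0 * P 0 * P 2) + C W.a₄ * (P 0 * P 2 * P 2) +
        C W.a₆ * (P 2 * P 2 * P 2)) = 0 := by
    linear_combination h
  have h2 := congrArg (coeff · (N + N + N)) h'
  simp only [coeff_sub, coeff_add, coeff_C_mul, coeff_mul_three hN, coeff_zero] at h2
  linear_combination h2

lemma gradient_coeff {P : Fin 3 → L[X]} {N : ℕ} (hN : ∀ i, (P i).natDegree ≤ N) (j : Fin 3) :
    (gradient (W⁄L[X]) P j).coeff (N + N) = gradient W (fun i => (P i).coeff N) j := by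
  have h2 : ∀ i j, (P i * P j).coeff (N + N) = (P i).coeff N * (P j).coeff N := fun i j =>
    coeff_mul_add_eq_of_natDegree_le (hN i) (hN j)
  fin_cases j
  · have : gradient (W⁄L[X]) P 0 = C W.a₁ * (P 1 * P 2) -
        (C 3 * (P 0 * P 0) + C (2 * W.a₂) * (P 0 * P 2) + C W.a₄ * (P 2 * P 2)) := by
      simp [gradient, C_two, C_three]
      ring
    simp only [Fin.zero_eta, this, coeff_sub, coeff_add, coeff_C_mul, h2]
    simp [gradient]
    ring
  · have : gradient (W⁄L[X]) P 1 = C 2 * (P 1 * P 2) + C W.a₁ * (P 0 * P 2) +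
        C W.a₃ * (P 2 * P 2) := by
      simp [gradient, C_two]
      ring
    simp only [Fin.mk_one, this, coeff_add, coeff_C_mul, h2]
    simp [gradient]
    ring
  · have : gradient (W⁄L[X]) P 2 = P 1 * P 1 + C W.a₁ * (P 0 * P 1) +
        C (2 * W.a₃) * (P 1 * P 2) - (C W.a₂ * (P 0 * P 0) + C (2 * W.a₄) * (P 0 * P 2) +
          C (3 * W.a₆) * (P 2 * P 2)) := by
      simp [gradient, C_two, C_three]
      ring
    simp only [Fin.reduceFinMk, this, coeff_sub, coeff_add, coeff_C_mul, h2]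
    simp [gradient]
    ring

/-- A curve with primitive coordinates of degree at most `N`, one of them of degree `N`, has
vanishing derivative. -/
lemma derivative_eq_zero_of_equation [IsAlgClosed L] [W.IsElliptic] {P : Fin 3 → L[X]} {N : ℕ}
    (hN : ∀ i, (P i).natDegree ≤ N) (hi : ∃ i, (P i).coeff N ≠ 0)
    (h : Projective.Equation (W⁄L[X]) P) (hP : ∀ a, ∃ i, (P i).eval a ≠ 0) (i : Fin 3) :
    derivative (P i) = 0 := by
  -- By Euler's relation and by differentiating the equation, both `P` and its derivative are
  -- orthogonal to the gradient `G`, so `G` is parallel to their cross product `D`. Smoothness makes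
  -- `G` primitive, so the entries of `G` divide those of `D`. Smoothness at the parameter infinity
  -- gives `G` an entry of degree `2 * N`, while `D` has smaller degree. Hence `D = 0`, and the
  -- derivative is a multiple of the primitive triple `P`, so it vanishes for reasons of degree.
  set G := gradient (W⁄L[X]) P with hG
  have hE : P 0 * G 0 + P 1 * G 1 + P 2 * G 2 = 0 := by
    have := equation_iff_polynomial.mp h
    simp only [hG, gradient, Affine.baseChange_a₁, Affine.baseChange_a₂, Affine.baseChange_a₃,
      Affine.baseChange_a₄, Affine.baseChange_a₆, Matrix.cons_val, algebraMap_eq]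
    linear_combination 3 * this
  have hD : derivative (P 0) * G 0 + derivative (P 1) * G 1 + derivative (P 2) * G 2 = 0 := by
    have := congrArg derivative (equation_iff_polynomial.mp h)
    simp only [derivative_sub, derivative_add, derivative_mul, derivative_pow, derivative_C,
      derivative_zero] at this
    simp only [hG, gradient, Affine.baseChange_a₁, Affine.baseChange_a₂, Affine.baseChange_a₃,
      Affine.baseChange_a₄, Affine.baseChange_a₆, Matrix.cons_val, algebraMap_eq]
    norm_num [C_two, C_three] at this
    linear_combination this
  set D : Fin 3 → L[X] := ![P 1 * derivative (P 2) - P 2 * derivative (P 1),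
    P 2 * derivative (P 0) - P 0 * derivative (P 2),
    P 0 * derivative (P 1) - P 1 * derivative (P 0)] with hDdef
  have h01 : D 0 * G 1 = D 1 * G 0 := by
    simp only [hDdef, Matrix.cons_val]
    linear_combination derivative (P 2) * hE - P 2 * hD
  have h12 : D 1 * G 2 = D 2 * G 1 := by
    simp only [hDdef, Matrix.cons_val]
    linear_combination derivative (P 0) * hE - P 0 * hD
  have h20 : D 2 * G 0 = D 0 * G 2 := by
    simp only [hDdef, Matrix.cons_val]
    linear_combination derivative (P 1) * hE - P 1 * hD
  have hcross := cross_of_cyclic h01 h12 h20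
  obtain ⟨u, hu⟩ := exists_bezout (P := G) fun a => by
    have hv : (fun i => (P i).eval a) ≠ 0 := by
      obtain ⟨i, hi⟩ := hP a
      exact fun h0 => hi (congrFun h0 i)
    obtain ⟨j, hj⟩ := exists_gradient_ne_zero hv (equation_eval h a)
    exact ⟨j, by rwa [hG, gradient_eval]⟩
  obtain ⟨j, hj⟩ : ∃ j, (G j).coeff (N + N) ≠ 0 := by
    have hv : (fun i => (P i).coeff N) ≠ 0 := by
      obtain ⟨i, hi⟩ := hi
      exact fun h0 => hi (congrFun h0 i)
    obtain ⟨j, hj⟩ := exists_gradient_ne_zero hv (equation_coeff hN h)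
    exact ⟨j, by rwa [hG, gradient_coeff hN]⟩
  have hGj : G j ≠ 0 := by
    intro h0
    rw [h0, coeff_zero] at hj
    exact hj rfl
  have hlt : ∀ i l, (P i * derivative (P l)).degree < (N + N : ℕ) := by
    intro i l
    have h1 : (derivative (P l)).degree < N := by
      by_cases h0 : derivative (P l) = 0
      · rw [h0, degree_zero]
        exact WithBot.bot_lt_coe _
      · refine (degree_le_natDegree).trans_lt ?_
        have := natDegree_derivative_lt (p := P l) (fun h => h0 (derivative_of_natDegree_zero h))
        have := hN l
        exact_mod_cast (by omega)
    rw [degree_mul, Nat.cast_add]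
    by_cases h0 : P i = 0
    · rw [h0, degree_zero, WithBot.bot_add]
      exact WithBot.bot_lt_coe _
    · rw [degree_eq_natDegree h0]
      refine WithBot.add_lt_add_of_le_of_lt (WithBot.coe_ne_bot) ?_ h1
      exact_mod_cast hN i
  have hDlt : (D j).degree < (N + N : ℕ) := by
    fin_cases j <;> exact (degree_sub_le _ _).trans_lt (max_lt (hlt _ _) (hlt _ _))
  have hDj : D j = 0 := by
    refine eq_zero_of_dvd_of_degree_lt (p := G j) ?_ (hDlt.trans_le (le_degree_of_ne_zero hj))
    refine ⟨u 0 * D 0 + u 1 * D 1 + u 2 * D 2, ?_⟩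
    linear_combination (-D j) * hu - u 0 * hcross 0 j - u 1 * hcross 1 j - u 2 * hcross 2 j
  have hD0 : ∀ i, D i = 0 := by
    intro i
    have := hcross i j
    rw [hDj, zero_mul] at this
    exact (mul_eq_zero.mp this).resolve_right hGj
  have e0 : P 1 * derivative (P 2) - P 2 * derivative (P 1) = 0 := hD0 0
  have e1 : P 2 * derivative (P 0) - P 0 * derivative (P 2) = 0 := hD0 1
  have e2 : P 0 * derivative (P 1) - P 1 * derivative (P 0) = 0 := hD0 2
  have hPP := cross_of_cyclic (D := P) (G := fun i => derivative (P i)) (sub_eq_zero.mp e2)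
    (sub_eq_zero.mp e0) (sub_eq_zero.mp e1)
  obtain ⟨w, hw⟩ := exists_bezout hP
  by_cases hd : (P i).natDegree = 0
  · exact derivative_of_natDegree_zero hd
  refine eq_zero_of_dvd_of_natDegree_lt (p := P i) ⟨w 0 * derivative (P 0) +
    w 1 * derivative (P 1) + w 2 * derivative (P 2), ?_⟩ (natDegree_derivative_lt hd)
  linear_combination (-derivative (P i)) * hw + w 0 * hPP 0 i + w 1 * hPP 1 i + w 2 * hPP 2 i

/-- If no entry has degree `N`, lower the bound; otherwise the derivatives vanish. In characteristic
`p` the entries are then polynomials in `X ^ p`, and replacing `X ^ p` by `X` gives a point of the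
same curve with degrees at most `N / p`, hence at most `N / 2`. -/
lemma natDegree_eq_zero_of_equation [IsAlgClosed L] [W.IsElliptic] (N : ℕ) : ∀ {P : Fin 3 → L[X]},
    (∀ i, (P i).natDegree ≤ N) → Projective.Equation (W⁄L[X]) P →
      (∀ a, ∃ i, (P i).eval a ≠ 0) → ∀ i, (P i).natDegree = 0 := by
  induction N using Nat.strong_induction_on with
  | _ N ih =>
  intro P hN h hP
  by_cases hN0 : N = 0
  · exact fun i => Nat.eq_zero_of_le_zero (hN0 ▸ hN i)
  by_cases hi : ∃ i, (P i).coeff N ≠ 0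
  swap
  · push Not at hi
    refine ih (N - 1) (by omega) (fun i => ?_) h hP
    have h1 := hN i
    have h2 : (P i).natDegree ≠ N := by
      intro h3
      have := hi i
      rw [← h3, coeff_natDegree, leadingCoeff_eq_zero] at this
      rw [this, natDegree_zero] at h3
      exact hN0 h3.symm
    omega
  have hd := derivative_eq_zero_of_equation hN hi h hP
  obtain ⟨p, hp⟩ := CharP.exists L
  rcases CharP.char_is_prime_or_zero L p with hprime | rfl
  · have : Fact p.Prime := ⟨hprime⟩
    have he : ∀ i, expand L p (contract p (P i)) = P i := fun i =>
      expand_contract p (hd i) hprime.ne_zero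
    have hdeg : ∀ i, (P i).natDegree = (contract p (P i)).natDegree * p := fun i => by
      rw [← natDegree_expand, he]
    have hP2 := hprime.two_le
    have key := ih (N / 2) (by omega) (P := fun i => contract p (P i)) (fun i => ?_) ?_ ?_
    · intro i
      rw [hdeg, key, zero_mul]
    · have := hN i
      rw [hdeg] at this
      rw [Nat.le_div_iff_mul_le (by norm_num)]
      exact (Nat.mul_le_mul_left _ hP2).trans this
    · rw [equation_iff_polynomial] at h ⊢
      apply expand_injective hprime.pos
      simpa [he] using h
    · intro a
      obtain ⟨b, hb⟩ := IsAlgClosed.exists_pow_nat_eq a hprime.pos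
      obtain ⟨i, hi⟩ := hP b
      refine ⟨i, ?_⟩
      rwa [← he i, expand_eval, hb] at hi
  · have : CharZero L := CharP.charP_to_charZero L
    exact fun i => Polynomial.derivative_eq_zero.mp (hd i)

/-- A point of an elliptic curve over the polynomial ring is constant. -/
lemma exists_const_of_equation [IsAlgClosed L] [W.IsElliptic] {P : Fin 3 → L[X]} (hP : P ≠ 0)
    (h : Projective.Equation (W⁄L[X]) P) :
    ∃ s, s ≠ 0 ∧ ∃ c : Fin 3 → L, c ≠ 0 ∧ ∀ i, P i = s * C (c i) := by
  obtain ⟨s, hs, Q, u, hQ, hu⟩ := exists_mul_primitive hP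
  have hprim : ∀ a, ∃ i, (Q i).eval a ≠ 0 := by
    intro a
    by_contra! h0
    have := congrArg (eval a) hu
    simp [h0] at this
  have hQe : Projective.Equation (W⁄L[X]) Q := by
    rw [equation_iff_polynomial] at h ⊢
    refine (mul_eq_zero.mp ?_).resolve_left (pow_ne_zero 3 hs)
    rw [hQ 0, hQ 1, hQ 2] at h
    linear_combination h
  have h0 := natDegree_eq_zero_of_equation ((Q 0).natDegree + (Q 1).natDegree + (Q 2).natDegree)
    (P := Q) (fun i => by fin_cases i <;> simp <;> omega) hQe hprim
  refine ⟨s, hs, fun i => (Q i).coeff 0, fun hc => ?_, fun i => ?_⟩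
  · obtain ⟨i, hi⟩ := hprim 0
    exact hi (by rw [← coeff_zero_eq_eval_zero]; exact congrFun hc i)
  · rw [hQ, ← eq_C_of_natDegree_eq_zero (h0 i)]

end Constancy

/-! ### Formulas for `x`-coordinates -/

section Formulas

variable {L : Type*} [Field L] {W : Affine L}

lemma sq_two_mul_add {x y : L} (h : W.Equation x y) :
    (2 * y + W.a₁ * x + W.a₃) ^ 2 = 4 * x ^ 3 + W.b₂ * x ^ 2 + 2 * W.b₄ * x + W.b₆ := by
  rw [Affine.equation_iff] at h
  rw [b₂, b₄, b₆]
  linear_combination 4 * h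

/-- Numerator and denominator of the duplication formula have no common root. The triple fed to
`addSubMap_ne_zero` holds the product and the sum of the pair `x, x`. -/
lemma duplication_ne_zero (W : Affine L) [W.IsElliptic] (x : L)
    (h : 4 * x ^ 3 + W.b₂ * x ^ 2 + 2 * W.b₄ * x + W.b₆ = 0) :
    x ^ 4 - W.b₄ * x ^ 2 - 2 * W.b₆ * x - W.b₈ ≠ 0 := by
  intro h'
  have hx : (![x ^ 2, 2 * x, 1] : Fin 3 → L) ≠ 0 := fun h0 => by
    simpa using congrFun h0 2
  refine addSubMap_ne_zero W hx (funext fun i => ?_)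
  fin_cases i
  · simp [addSubMap]
    linear_combination h'
  · simp [addSubMap]
    linear_combination h
  · simp [addSubMap]
    ring

variable [DecidableEq L]

lemma add_self_eq_zero_of_x {x y : L} (h : W.Nonsingular x y)
    (hx : 4 * x ^ 3 + W.b₂ * x ^ 2 + 2 * W.b₄ * x + W.b₆ = 0) :
    Affine.Point.some x y h + .some x y h = 0 := by
  rw [← sq_two_mul_add h.1] at hx
  apply Affine.Point.add_self_of_Y_eq
  rw [Affine.negY]
  linear_combination pow_eq_zero_iff (two_ne_zero) |>.mp hx

lemma add_self_eq_some {x y : L} (h : W.Nonsingular x y)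
    (hx : 4 * x ^ 3 + W.b₂ * x ^ 2 + 2 * W.b₄ * x + W.b₆ ≠ 0) :
    ∃ x' y' h', Affine.Point.some x y h + .some x y h = .some x' y' h' ∧
      x' * (4 * x ^ 3 + W.b₂ * x ^ 2 + 2 * W.b₄ * x + W.b₆) =
        x ^ 4 - W.b₄ * x ^ 2 - 2 * W.b₆ * x - W.b₈ := by
  have hy : y ≠ W.negY x y := by
    intro hy
    rw [← sq_two_mul_add h.1] at hx
    apply hx
    rw [Affine.negY] at hy
    rw [show 2 * y + W.a₁ * x + W.a₃ = 0 by linear_combination hy]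
    ring
  refine ⟨_, _, _, Affine.Point.add_self_of_Y_ne hy, ?_⟩
  have hy' : 2 * y + W.a₁ * x + W.a₃ ≠ 0 := by
    intro h0
    apply hy
    rw [Affine.negY]
    linear_combination h0
  have he := (Affine.equation_iff _ _).mp h.1
  have hd := sq_two_mul_add h.1
  rw [Affine.addX, Affine.slope_of_Y_ne rfl hy, ← hd,
    show y - W.negY x y = 2 * y + W.a₁ * x + W.a₃ by rw [Affine.negY]; ring]
  obtain ⟨l, hl⟩ : ∃ l, l = (3 * x ^ 2 + 2 * W.a₂ * x + W.a₄ - W.a₁ * y) /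
    (2 * y + W.a₁ * x + W.a₃) := ⟨_, rfl⟩
  rw [← hl]
  rw [eq_div_iff hy'] at hl
  rw [b₂, b₄, b₆] at hd
  rw [b₄, b₆, b₈]
  linear_combination (l * (2 * y + W.a₁ * x + W.a₃) + (3 * x ^ 2 + 2 * W.a₂ * x + W.a₄ - W.a₁ * y)
    + W.a₁ * (2 * y + W.a₁ * x + W.a₃)) * hl - W.a₁ ^ 2 * he - (W.a₂ + 2 * x) * hd

/-- The sum and the product of the `x`-coordinates of `P + Q` and `P - Q`. -/
lemma add_sub_eq_some {x₁ y₁ x₂ y₂ : L} (h₁ : W.Nonsingular x₁ y₁) (h₂ : W.Nonsingular x₂ y₂)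
    (hx : x₁ ≠ x₂) : ∃ x y h x' y' h',
      Affine.Point.some x₁ y₁ h₁ + .some x₂ y₂ h₂ = .some x y h ∧
      Affine.Point.some x₁ y₁ h₁ - .some x₂ y₂ h₂ = .some x' y' h' ∧
      (x + x') * (x₁ - x₂) ^ 2 = 2 * (x₁ + x₂) * (x₁ * x₂) + W.b₂ * (x₁ * x₂) +
        W.b₄ * (x₁ + x₂) + W.b₆ ∧
      x * x' * (x₁ - x₂) ^ 2 = (x₁ * x₂) ^ 2 - W.b₄ * (x₁ * x₂) - W.b₆ * (x₁ + x₂) - W.b₈ := by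
  have hneg : Affine.Point.some x₁ y₁ h₁ - .some x₂ y₂ h₂ =
      .some x₁ y₁ h₁ + .some x₂ (W.negY x₂ y₂) ((Affine.nonsingular_neg ..).mpr h₂) := by
    rw [sub_eq_add_neg, Affine.Point.neg_some]
  refine ⟨_, _, _, _, _, _, Affine.Point.add_of_X_ne hx,
    hneg.trans (Affine.Point.add_of_X_ne hx), ?_, ?_⟩
  all_goals
    have hx' : x₁ - x₂ ≠ 0 := sub_ne_zero.mpr hx
    have e₁ := (Affine.equation_iff _ _).mp h₁.1
    have e₂ := (Affine.equation_iff _ _).mp h₂.1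
    rw [Affine.addX, Affine.addX, Affine.slope_of_X_ne hx, Affine.slope_of_X_ne hx]
    obtain ⟨l, hl⟩ : ∃ l, l = (y₁ - y₂) / (x₁ - x₂) := ⟨_, rfl⟩
    obtain ⟨m, hm⟩ : ∃ m, m = (y₁ - W.negY x₂ y₂) / (x₁ - x₂) := ⟨_, rfl⟩
    rw [← hl, ← hm]
    rw [eq_div_iff hx'] at hl hm
    rw [Affine.negY] at hm
    have hl' : (l ^ 2 + W.a₁ * l - W.a₂ - x₁ - x₂) * (x₁ - x₂) ^ 2 = (y₁ - y₂) ^ 2 +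
        W.a₁ * (y₁ - y₂) * (x₁ - x₂) - (W.a₂ + x₁ + x₂) * (x₁ - x₂) ^ 2 := by
      rw [← hl]
      ring
    have hm' : (m ^ 2 + W.a₁ * m - W.a₂ - x₁ - x₂) * (x₁ - x₂) ^ 2 =
        (y₁ + y₂ + W.a₁ * x₂ + W.a₃) ^ 2 + W.a₁ * (y₁ + y₂ + W.a₁ * x₂ + W.a₃) * (x₁ - x₂) -
          (W.a₂ + x₁ + x₂) * (x₁ - x₂) ^ 2 := by
      rw [show y₁ + y₂ + W.a₁ * x₂ + W.a₃ = m * (x₁ - x₂) by rw [hm]; ring]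
      ring
  · rw [b₂, b₄, b₆]
    linear_combination hl' + hm' + 2 * e₁ + 2 * e₂
  · apply mul_right_cancel₀ (pow_ne_zero 2 hx')
    rw [show (l ^ 2 + W.a₁ * l - W.a₂ - x₁ - x₂) * (m ^ 2 + W.a₁ * m - W.a₂ - x₁ - x₂) *
        (x₁ - x₂) ^ 2 * (x₁ - x₂) ^ 2 = ((l ^ 2 + W.a₁ * l - W.a₂ - x₁ - x₂) * (x₁ - x₂) ^ 2) *
          ((m ^ 2 + W.a₁ * m - W.a₂ - x₁ - x₂) * (x₁ - x₂) ^ 2) by ring, hl', hm', b₄, b₆, b₈]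
    linear_combination
      (y₁ ^ 2 + W.a₁ * x₁ * y₁ + W.a₃ * y₁ - (y₂ ^ 2 + W.a₁ * x₂ * y₂ + W.a₃ * y₂) +
        (x₁ ^ 3 + W.a₂ * x₁ ^ 2 + W.a₄ * x₁ + W.a₆) - (x₂ ^ 3 + W.a₂ * x₂ ^ 2 + W.a₄ * x₂ + W.a₆) +
        W.a₁ * (x₁ - x₂) * (W.a₁ * x₁ + W.a₃) - W.a₁ ^ 2 * (x₁ - x₂) ^ 2 -
        2 * (W.a₂ + x₁ + x₂) * (x₁ - x₂) ^ 2) * e₁ +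
      (-(y₁ ^ 2 + W.a₁ * x₁ * y₁ + W.a₃ * y₁ - (y₂ ^ 2 + W.a₁ * x₂ * y₂ + W.a₃ * y₂) +
        (x₁ ^ 3 + W.a₂ * x₁ ^ 2 + W.a₄ * x₁ + W.a₆) - (x₂ ^ 3 + W.a₂ * x₂ ^ 2 + W.a₄ * x₂ + W.a₆))
        - W.a₁ * (x₁ - x₂) * (W.a₁ * x₁ + W.a₃) -
        2 * (W.a₂ + x₁ + x₂) * (x₁ - x₂) ^ 2) * e₂

end Formulas

/-! ### Even functions and the additivity of morphisms -/

section Even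

variable {L : Type*} [Field L] (E : Affine L)

lemma exists_quartic_root {L : Type*} [Field L] [IsAlgClosed L] (a b c d e : L) :
    ∃ x, x ^ 4 + a * x ^ 3 + b * x ^ 2 + c * x + d = e := by
  have hdeg : (X ^ 4 + C a * X ^ 3 + C b * X ^ 2 + C c * X + C (d - e) : L[X]).degree = 4 := by
    compute_degree!
  obtain ⟨x, hx⟩ := IsAlgClosed.exists_root _ (by rw [hdeg]; norm_num)
  simp only [IsRoot.def, eval_add, eval_mul, eval_pow, eval_X, eval_C] at hx
  exact ⟨x, by linear_combination hx⟩

/-- Multiplication by two is surjective. -/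
lemma exists_add_self_eq {L : Type*} [Field L] [IsAlgClosed L] [DecidableEq L] {W : Affine L}
    [W.IsElliptic] (Q : W.Point) : ∃ P, P + P = Q := by
  cases Q with
  | zero => exact ⟨0, add_zero 0⟩
  | some x₀ y₀ h₀ =>
    -- This is the duplication formula for `x(2P) = x₀`, cleared of its denominator. It determines
    -- `P` up to sign, and the sign is fixed at the end.
    obtain ⟨x, hx⟩ := exists_quartic_root (-4 * x₀) (-W.b₄ - x₀ * W.b₂)
      (-2 * W.b₆ - 2 * x₀ * W.b₄) (-W.b₈) (x₀ * W.b₆)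
    obtain ⟨y, h⟩ := exists_point W x
    have hx0 : 4 * x ^ 3 + W.b₂ * x ^ 2 + 2 * W.b₄ * x + W.b₆ ≠ 0 := by
      intro h0
      refine duplication_ne_zero W x h0 ?_
      linear_combination hx + x₀ * h0
    obtain ⟨x', y', h', e, hx'⟩ := add_self_eq_some h hx0
    have hxx : x' = x₀ := by
      apply mul_right_cancel₀ hx0
      linear_combination hx' + hx
    subst hxx
    rcases Affine.Y_eq_of_X_eq h'.1 h₀.1 rfl with hy | hy
    · subst hy
      exact ⟨_, e⟩
    · refine ⟨-.some x y h, ?_⟩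
      rw [← neg_add, e, Affine.Point.neg_some, Affine.Point.some.injEq]
      refine ⟨rfl, ?_⟩
      rw [hy, Affine.negY_negY]

/-- The conjugate of a regular function, that is, its composition with the negation map. -/
lemma exists_conj (b : E.CoordinateRing) : ∃ c : E.CoordinateRing, (b ≠ 0 → c ≠ 0) ∧
    ∀ x y (h : (E⁄L).Equation x y) (h' : (E⁄L).Equation x ((E⁄L).negY x y)),
      evalAt E h c = evalAt E h' b ∧ evalAt E h' c = evalAt E h b := by
  obtain ⟨p, q, rfl⟩ := exists_elt E b
  refine ⟨elt E (p - q * (C E.a₁ * X + C E.a₃)) (-q), fun hb h0 => hb ?_, fun x y h h' => ?_⟩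
  · obtain ⟨h1, h2⟩ := elt_eq_zero h0
    rw [neg_eq_zero] at h2
    rw [h2, zero_mul, sub_zero] at h1
    rw [h1, h2]
    simp [elt]
  · simp only [evalAt_elt, Affine.negY, map_sub, map_neg, map_mul, map_add, aeval_X, aeval_C,
      Affine.baseChange_a₁, Affine.baseChange_a₃]
    constructor <;> ring

/-- Otherwise `y` would equal its conjugate `-y - a₁ x - a₃`, and the discriminant would be zero.
This is what excludes a nonzero `y`-part in even functions in characteristic two. -/
lemma two_ne_zero_or [E.IsElliptic] : (2 : L) ≠ 0 ∨ E.a₁ ≠ 0 ∨ E.a₃ ≠ 0 := by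
  by_contra! h
  obtain ⟨h2, h1, h3⟩ := h
  refine E.isUnit_Δ.ne_zero ?_
  have h4 : (4 : L) = 0 := by linear_combination 2 * h2
  have h8 : (8 : L) = 0 := by linear_combination 4 * h2
  have h27 : (27 : L) = 1 := by linear_combination 13 * h2
  rw [Δ, b₂, b₄, b₆, b₈, h1, h3]
  linear_combination (8 * E.a₂ * E.a₄ * E.a₂ * E.a₄ - 32 * E.a₂ ^ 3 * E.a₆ - 32 * E.a₄ ^ 3 -
    216 * E.a₆ ^ 2 + 144 * E.a₂ * E.a₄ * E.a₆) * h2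

variable {E}

/-- A regular function whose values at opposite points agree is a polynomial in `x`. -/
lemma exists_eq_algebraMap_of_even [IsAlgClosed L] [E.IsElliptic] {a : E.CoordinateRing}
    (h : ∀ x y (h : (E⁄L).Equation x y) (h' : (E⁄L).Equation x ((E⁄L).negY x y)),
      evalAt E h a = evalAt E h' a) : ∃ t : L[X], a = algebraMap L[X] E.CoordinateRing t := by
  obtain ⟨p, q, rfl⟩ := exists_elt E a
  have h0 : elt E (q * (C E.a₁ * X + C E.a₃)) (2 * q) = 0 := by
    refine eq_zero_of_evalAt (L := L) E fun x y hxy => ?_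
    have := h x y hxy ((Affine.equation_neg ..).mpr hxy)
    simp only [evalAt_elt, Affine.negY, Affine.baseChange_a₁, Affine.baseChange_a₃] at this
    simp only [evalAt_elt, map_mul, map_add, aeval_X, aeval_C, map_ofNat]
    linear_combination this
  obtain ⟨h1, h2⟩ := elt_eq_zero h0
  have hq : q = 0 := by
    rcases two_ne_zero_or E with h3 | h3
    · refine (mul_eq_zero.mp h2).resolve_left ?_
      rw [← C_two]
      exact C_ne_zero.mpr h3
    · refine (mul_eq_zero.mp h1).resolve_right fun h4 => ?_
      have e1 := congrArg (coeff · 1) h4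
      have e0 := congrArg (coeff · 0) h4
      simp at e0 e1
      tauto
  exact ⟨p, by rw [hq, elt, zero_smul, add_zero, Algebra.algebraMap_eq_smul_one]⟩

lemma neg_coords (Q : (E⁄L).Point) : coords (-Q) 0 = coords Q 0 ∧ coords (-Q) 2 = coords Q 2 := by
  cases Q <;> exact ⟨rfl, rfl⟩

/-- If the ratio of the coordinates `i` and `j` of an endomorphism is even, it is a rational
function of `x`. -/
lemma exists_mul_eq_algebraMap [IsAlgClosed L] [E.IsElliptic] {φ : (E⁄L).Point → (E⁄L).Point}
    {f : Fin 3 → MvPolynomial (Fin 3) L} (hf : ComputesOver f φ) {j : Fin 3}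
    (hj : evalTriple f (genericCoords E) j ≠ 0) : ∃ c : E.CoordinateRing, c ≠ 0 ∧ ∀ i,
      (∀ Q, coords (φ Q) i * coords (φ (-Q)) j = coords (φ Q) j * coords (φ (-Q)) i) →
        ∃ t : L[X], MvPolynomial.aeval (ringCoords E) (f i) * c =
          algebraMap L[X] E.CoordinateRing t := by
  -- Multiplying by the conjugate of coordinate `j` makes coordinate `i` even whenever the ratio of
  -- the two is.
  obtain ⟨c, hc0, hc⟩ := exists_conj E (MvPolynomial.aeval (ringCoords E) (f j))
  refine ⟨c, hc0 fun h0 => hj ?_, fun i hi => exists_eq_algebraMap_of_even fun x y h h' => ?_⟩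
  · rw [evalTriple, ← algebraMap_aeval, h0, map_zero]
  rw [map_mul, map_mul, (hc x y h h').1, (hc x y h h').2]
  have hn : (E⁄L).Nonsingular x y := Affine.equation_iff_nonsingular.mp h
  have hn' : (E⁄L).Nonsingular x ((E⁄L).negY x y) := Affine.equation_iff_nonsingular.mp h'
  rw [evalAt_aeval E hn, evalAt_aeval E hn', evalAt_aeval E hn, evalAt_aeval E hn']
  have key := hi (.some x y hn)
  rw [Affine.Point.neg_some] at key
  change evalTriple f _ i * evalTriple f _ j = evalTriple f _ i * evalTriple f _ j
  set Q : (E⁄L).Point := .some x y hn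
  set Q' : (E⁄L).Point := .some x ((E⁄L).negY x y) hn'
  by_cases h : evalTriple f (coords Q) = 0
  · simp [h]
  by_cases h' : evalTriple f (coords Q') = 0
  · simp [h']
  obtain ⟨u, hu⟩ := (hf.2 Q h).symm
  obtain ⟨u', hu'⟩ := (hf.2 Q' h').symm
  rw [hu, hu']
  simp only [Pi.smul_apply, smul_eq_mul]
  linear_combination (u * u' : L) * key

variable (E) in
lemma algebraMap_injective : Function.Injective (algebraMap L[X] E.CoordinateRing) := by
  rw [injective_iff_map_eq_zero]
  intro p hp
  refine (elt_eq_zero (E := E) (q := 0) ?_).1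
  rwa [elt, zero_smul, add_zero, ← Algebra.algebraMap_eq_smul_one]

lemma algebraMap_C (a : L) : algebraMap E.CoordinateRing E.FunctionField
    (algebraMap L[X] E.CoordinateRing (C a)) = algebraMap L E.FunctionField a := by
  rw [IsScalarTower.algebraMap_apply L E.CoordinateRing E.FunctionField,
    IsScalarTower.algebraMap_apply L L[X] E.CoordinateRing]
  rfl

lemma equation_of_algebraMap {t : Fin 3 → L[X]} (h : Projective.Equation (E⁄E.FunctionField)
    fun i => algebraMap E.CoordinateRing E.FunctionField (algebraMap L[X] E.CoordinateRing (t i))) :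
    Projective.Equation (E⁄L[X]) t := by
  rw [equation_iff_polynomial]
  rw [Projective.equation_iff] at h
  apply algebraMap_injective E
  apply IsFractionRing.injective E.CoordinateRing E.FunctionField
  simp only [Affine.baseChange_a₁, Affine.baseChange_a₂, Affine.baseChange_a₃,
    Affine.baseChange_a₄, Affine.baseChange_a₆, ← algebraMap_C] at h
  simpa using h

variable [DecidableEq L] [DecidableEq E.FunctionField] [IsAlgClosed L] [E.IsElliptic]

/-- An even morphism is constant. -/
lemma IsMor.eq_of_even {φ : (E⁄L).Point → (E⁄L).Point} (hφ : IsMor L (E⁄L) φ)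
    (h : ∀ Q, φ (-Q) = φ Q) (Q Q' : (E⁄L).Point) : φ Q = φ Q' := by
  suffices ∃ R, ∀ Q, φ Q = R by
    obtain ⟨R, hR⟩ := this
    rw [hR, hR]
  obtain ⟨g, rfl⟩ := exists_pointMap_eq hφ
  obtain ⟨f, hfh, hg, -⟩ := exists_forms_pointMap g (0 : (E⁄L).Point)
  obtain ⟨j, hj⟩ := Function.ne_iff.mp (hg.ne_zero (coords_ne_zero _))
  -- After scaling by `c` the coordinates of `g` are polynomials in `x`: the morphism factors
  -- through the projective line.
  obtain ⟨c, hc, hct⟩ := exists_mul_eq_algebraMap (computesOver_pointMap hfh hg) hj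
  choose t ht using fun i => hct i fun Q => by rw [h Q, mul_comm]
  have hinj := IsFractionRing.injective E.CoordinateRing E.FunctionField
  have hc0 : algebraMap E.CoordinateRing E.FunctionField c ≠ 0 := by
    rwa [Ne, map_eq_zero_iff _ hinj]
  have hgt : SamePoint (coords g) fun i => algebraMap E.CoordinateRing E.FunctionField
      (algebraMap L[X] E.CoordinateRing (t i)) := by
    have e : (fun i => algebraMap E.CoordinateRing E.FunctionField
        (algebraMap L[X] E.CoordinateRing (t i))) =
          algebraMap E.CoordinateRing E.FunctionField c • evalTriple f (genericCoords E) := by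
      funext i
      rw [← ht, map_mul, algebraMap_aeval, Pi.smul_apply, smul_eq_mul, mul_comm]
      rfl
    rw [e]
    exact hg.trans (samePoint_smul hc0 _).symm
  have ht0 : t ≠ 0 := by
    rintro rfl
    exact hgt.ne_zero (coords_ne_zero _) (funext fun i => by simp)
  obtain ⟨s, hs, c', hc', hsc⟩ := exists_const_of_equation ht0
    (equation_of_algebraMap hgt.nonsingular.1)
  have hs0 : algebraMap E.CoordinateRing E.FunctionField (algebraMap L[X] E.CoordinateRing s) ≠ 0 := by
    rwa [Ne, map_eq_zero_iff _ hinj, map_eq_zero_iff _ (algebraMap_injective E)]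
  have hgc : SamePoint (coords g) fun i => algebraMap L E.FunctionField (c' i) := by
    refine hgt.trans ?_
    have e : (fun i => algebraMap E.CoordinateRing E.FunctionField
        (algebraMap L[X] E.CoordinateRing (t i))) =
          algebraMap E.CoordinateRing E.FunctionField (algebraMap L[X] E.CoordinateRing s) •
            fun i => algebraMap L E.FunctionField (c' i) := by
      funext i
      rw [hsc, map_mul, map_mul, algebraMap_C]
      rfl
    rw [e]
    exact samePoint_smul hs0 _
  have hval : ∀ (Q : (E⁄L).Point) i, (placeAt E Q).Val (algebraMap L E.FunctionField (c' i))
      (c' i) := fun Q i => Place.val_algebraMap (c' i)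
  obtain ⟨R, hR⟩ := exists_samePoint hc' (Place.equation_of_val (hval 0) hgc.nonsingular.1)
  exact ⟨R, fun Q => Place.Specializes.sp_eq ⟨_, _, hval Q, hgc, hR⟩⟩

/-- A morphism that fixes the origin is additive. -/
lemma IsMor.map_add {φ : (E⁄L).Point → (E⁄L).Point} (hφ : IsMor L (E⁄L) φ) (h0 : φ 0 = 0)
    (P Q : (E⁄L).Point) : φ (P + Q) = φ P + φ Q := by
  have hid : IsMor L (E⁄L) fun Q => Q := isMor_id _
  -- As a function of `Q` the left side is an even morphism, hence constant, equal to its value at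
  -- `0`. Choosing `2T = P + Q`, the instances at `T` and at `P - T` express both `φ (P + Q)` and `φ
  -- P + φ Q` as `2 φ T`.
  have hadd : ∀ T Q : (E⁄L).Point, φ (T + Q) + φ (T - Q) = φ T + φ T := by
    intro T Q
    have hT : IsMor L (E⁄L) fun _ => T := by
      have := isMor_const (L := L) T
      rwa [show Affine.Point.baseChange L L T = T from by
        cases T <;> rfl] at this
    have h1 : IsMor L (E⁄L) fun Q => φ (T + Q) + φ (T - Q) := by
      simp only [sub_eq_add_neg]
      exact (hφ.comp (hT.add hid)).add (hφ.comp (hT.add hid.neg))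
    have := h1.eq_of_even (fun Q => by rw [sub_neg_eq_add, add_comm, sub_eq_add_neg]) Q 0
    simpa using this
  obtain ⟨T, hT⟩ := exists_add_self_eq (P + Q)
  have h1 := hadd T T
  have h2 := hadd T (P - T)
  rw [sub_self, h0, add_zero] at h1
  rw [add_sub_cancel, show T - (P - T) = Q by rw [sub_sub_eq_add_sub, hT, add_sub_cancel_left]] at h2
  rw [← hT, h1, h2]

end Even

/-! ### The degree of an endomorphism -/

section XRep

variable {L : Type*} [Field L]

/-- The fraction `p / q` in lowest terms describes the effect of `φ` on `x`-coordinates. -/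
structure XRep {C : Affine L} (φ : C.Point → C.Point) (p q : L[X]) : Prop where
  map_zero : φ 0 = 0
  isCoprime : IsCoprime p q
  degree_lt : q.degree < p.degree
  eq_zero : ∀ {x y} (h : C.Nonsingular x y), q.eval x = 0 → φ (.some x y h) = 0
  eq_some : ∀ {x y} (h : C.Nonsingular x y), q.eval x ≠ 0 → ∃ x' y' h',
    φ (.some x y h) = .some x' y' h' ∧ x' * q.eval x = p.eval x

lemma val_algebraMap_polynomial (E : Affine L) {x y : L} (h : (E⁄L).Nonsingular x y) (p : L[X]) :
    (placeAt E (.some x y h)).Val (algebraMap E.CoordinateRing E.FunctionField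
      (algebraMap L[X] E.CoordinateRing p)) (p.eval x) := by
  refine ⟨algebraMap L[X] E.CoordinateRing p, 1, ⟨by simp, ?_⟩, by rw [map_one, mul_one]⟩
  rw [show algebraMap L[X] E.CoordinateRing p = elt E p 0 by
    rw [elt, zero_smul, add_zero, Algebra.algebraMap_eq_smul_one], evalAt_elt]
  simp

lemma poleOrder_algebraMap (E : Affine L) {p : L[X]} (hp : p ≠ 0) :
    poleOrder (algebraMap L[X] E.CoordinateRing p) = (2 * p.natDegree : ℕ) := by
  rw [show algebraMap L[X] E.CoordinateRing p = elt E p 0 by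
    rw [elt, zero_smul, add_zero, Algebra.algebraMap_eq_smul_one], poleOrder_elt,
    degree_eq_natDegree hp]
  simp

lemma exists_eq_mul_coprime (t s : L[X]) (hs : s ≠ 0) :
    ∃ d p q, t = d * p ∧ s = d * q ∧ IsCoprime p q := by
  classical
  have hd : EuclideanDomain.gcd t s ≠ 0 := fun h0 => hs (EuclideanDomain.gcd_eq_zero_iff.mp h0).2
  obtain ⟨p, hp⟩ := EuclideanDomain.gcd_dvd_left t s
  obtain ⟨q, hq⟩ := EuclideanDomain.gcd_dvd_right t s
  refine ⟨_, p, q, hp, hq, EuclideanDomain.gcdA t s, EuclideanDomain.gcdB t s,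
    mul_left_cancel₀ hd ?_⟩
  linear_combination -EuclideanDomain.gcd_eq_gcd_ab t s - EuclideanDomain.gcdA t s * hp -
    EuclideanDomain.gcdB t s * hq

lemma exists_xRep_baseChange [IsAlgClosed L] (E : Affine L) [E.IsElliptic]
    {φ : (E⁄L).Point → (E⁄L).Point} (hφ : IsMor L (E⁄L) φ) (h0 : φ 0 = 0) :
    ∃ p q, XRep φ p q := by
  classical
  have hodd : ∀ Q, φ (-Q) = -φ Q := fun Q => by
    rw [eq_neg_iff_add_eq_zero, ← hφ.map_add h0, neg_add_cancel, h0]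
  obtain ⟨g, rfl⟩ := exists_pointMap_eq hφ
  obtain ⟨f, hfh, hg, -⟩ := exists_forms_pointMap g (0 : (E⁄L).Point)
  have hf := computesOver_pointMap (L := L) hfh hg
  cases g with
  | zero =>
    have h : ∀ Q : (E⁄L).Point, pointMap E .zero Q = 0 := fun Q => map_zero _
    -- The zero map is represented by the fraction `1 / 0`.
    exact ⟨1, 0, h0, isCoprime_one_left, by simp, fun h' _ => h _, fun h' hq => by simp at hq⟩
  | some X Y h =>
    obtain ⟨u, hu⟩ := hg
    have hf2 : (u : E.FunctionField) * evalTriple f (genericCoords E) 2 = 1 :=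
      (congrFun hu 2).symm
    have hf0 : (u : E.FunctionField) * evalTriple f (genericCoords E) 0 = X :=
      (congrFun hu 0).symm
    have hj : evalTriple f (genericCoords E) 2 ≠ 0 := by
      intro h0
      rw [h0, mul_zero] at hf2
      exact zero_ne_one hf2
    obtain ⟨c, hc, hct⟩ := exists_mul_eq_algebraMap hf hj
    obtain ⟨t, ht⟩ := hct 0 fun Q => by
      rw [hodd, (neg_coords _).1, (neg_coords _).2, mul_comm]
    obtain ⟨s, hs⟩ := hct 2 fun Q => by
      rw [hodd, (neg_coords _).2]
    have hinj := IsFractionRing.injective E.CoordinateRing E.FunctionField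
    have ht' := congrArg (algebraMap E.CoordinateRing E.FunctionField) ht
    have hs' := congrArg (algebraMap E.CoordinateRing E.FunctionField) hs
    rw [map_mul, algebraMap_aeval] at ht' hs'
    change evalTriple f (genericCoords E) 0 * _ = _ at ht'
    change evalTriple f (genericCoords E) 2 * _ = _ at hs'
    have hc0 : algebraMap E.CoordinateRing E.FunctionField c ≠ 0 := by
      rwa [Ne, map_eq_zero_iff _ hinj]
    have hs0 : s ≠ 0 := by
      rintro rfl
      rw [map_zero, map_zero] at hs'
      exact mul_ne_zero hj hc0 hs'
    have hX : X * algebraMap E.CoordinateRing E.FunctionField (algebraMap L[X] E.CoordinateRing s) =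
        algebraMap E.CoordinateRing E.FunctionField (algebraMap L[X] E.CoordinateRing t) := by
      rw [← hs', ← ht', ← hf0]
      linear_combination (evalTriple f (genericCoords E) 0 *
        algebraMap E.CoordinateRing E.FunctionField c) * hf2
    obtain ⟨d, p, q, rfl, rfl, hpq⟩ := exists_eq_mul_coprime t s hs0
    have hq0 : q ≠ 0 := right_ne_zero_of_mul hs0
    have hX' : X * algebraMap E.CoordinateRing E.FunctionField (algebraMap L[X] E.CoordinateRing q) =
        algebraMap E.CoordinateRing E.FunctionField (algebraMap L[X] E.CoordinateRing p) := by
      have hd0 : algebraMap E.CoordinateRing E.FunctionField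
          (algebraMap L[X] E.CoordinateRing d) ≠ 0 := by
        rw [Ne, map_eq_zero_iff _ hinj, map_eq_zero_iff _ (algebraMap_injective E)]
        exact left_ne_zero_of_mul hs0
      apply mul_left_cancel₀ hd0
      rw [map_mul, map_mul, map_mul, map_mul] at hX
      linear_combination hX
    refine ⟨p, q, h0, hpq, ?_, fun {x y} h' hqx => ?_, fun {x y} h' hqx => ?_⟩
    -- If `p` had no larger degree than `q`, the `x`-coordinate of `g` would be finite at the
    -- origin, and `g` could not specialize to `0` there.
    · by_contra! hlt
      obtain ⟨c', hc'⟩ : ∃ c' : L, algebraMap L[X] E.CoordinateRing p -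
          c' • algebraMap L[X] E.CoordinateRing q ∈ poleFiltration E (2 * q.natDegree) := by
        refine exists_sub_smul_mem ?_ (poleOrder_algebraMap E hq0)
        by_cases hp0 : p = 0
        · rw [hp0, map_zero]
          exact Submodule.zero_mem _
        · rw [mem_poleFiltration, poleOrder_algebraMap E hp0, Nat.cast_lt]
          have := natDegree_le_natDegree hlt
          omega
      exact Place.sp_ne_zero (A := placeAt E (0 : (E⁄L).Point)) (h := h) (c := c')
        ⟨_, _, ⟨c', rfl, _, poleOrder_algebraMap E hq0, hc'⟩, hX'⟩ h0
    · by_contra hne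
      obtain ⟨x', y', h'', e⟩ : ∃ x' y' h'', pointMap E (.some X Y h) (.some x y h') =
          .some x' y' h'' := by
        cases e : pointMap E (.some X Y h) (.some x y h') with
        | zero => exact absurd e hne
        | some x' y' h'' => exact ⟨_, _, _, rfl⟩
      have h1 := (Place.sp_eq_some e).1.mul (val_algebraMap_polynomial E h' q)
      rw [hX'] at h1
      have h2 := h1.unique (val_algebraMap_polynomial E h' p)
      rw [hqx, mul_zero] at h2
      obtain ⟨a, b, hab⟩ := hpq
      have := congrArg (eval x) hab
      simp [hqx, ← h2] at this
    · have hval : (placeAt E (.some x y h')).Val X (p.eval x / q.eval x) := by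
        have hq1 : algebraMap E.CoordinateRing E.FunctionField
            (algebraMap L[X] E.CoordinateRing q) ≠ 0 := by
          rwa [Ne, map_eq_zero_iff _ hinj, map_eq_zero_iff _ (algebraMap_injective E)]
        rw [eq_div_of_mul_eq hq1 hX']
        exact (val_algebraMap_polynomial E h' p).div (val_algebraMap_polynomial E h' q) hqx
      have hne := Place.sp_ne_zero (h := h) hval
      cases e : pointMap E (.some X Y h) (.some x y h') with
      | zero => exact absurd e hne
      | some x' y' h'' =>
        refine ⟨_, _, _, rfl, ?_⟩
        rw [(Place.sp_eq_some e).1.unique hval, div_mul_cancel₀ _ hqx]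

lemma exists_xRep [IsAlgClosed L] {C : Affine L} [C.IsElliptic] {φ : C.Point → C.Point}
    (hφ : IsMor L C φ) (h0 : φ 0 = 0) : ∃ p q, XRep φ p q := by
  have key : ∀ C' : Affine L, C⁄L = C' → ∀ φ : C'.Point → C'.Point, IsMor L C' φ → φ 0 = 0 →
      ∃ p q, XRep φ p q := by
    rintro _ rfl φ hφ h0
    exact exists_xRep_baseChange C hφ h0
  exact key C (WeierstrassCurve.map_id _) φ hφ h0

lemma IsMor.map_add' [IsAlgClosed L] [DecidableEq L] {C : Affine L} [C.IsElliptic]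
    {φ : C.Point → C.Point} (hφ : IsMor L C φ) (h0 : φ 0 = 0) (P Q : C.Point) :
    φ (P + Q) = φ P + φ Q := by
  classical
  have key : ∀ C' : Affine L, C⁄L = C' → ∀ φ : C'.Point → C'.Point, IsMor L C' φ → φ 0 = 0 →
      ∀ P Q, φ (P + Q) = φ P + φ Q := by
    rintro _ rfl φ hφ h0
    exact hφ.map_add h0
  exact key C (WeierstrassCurve.map_id _) φ hφ h0 P Q

namespace XRep

variable {C : Affine L} {φ ψ : C.Point → C.Point} {p q p' q' : L[X]}

lemma ne_zero (h : XRep φ p q) : p ≠ 0 := by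
  rintro rfl
  exact not_lt_bot h.degree_lt

lemma eval_ne_zero (h : XRep φ p q) {x : L} (hx : q.eval x = 0) : p.eval x ≠ 0 := by
  intro hp
  obtain ⟨a, b, hab⟩ := h.isCoprime
  have := congrArg (eval x) hab
  simp [hx, hp] at this

lemma zero : XRep (fun _ : C.Point => (0 : C.Point)) 1 0 :=
  ⟨rfl, isCoprime_one_left, by simp, fun _ _ => rfl, fun _ h => by simp at h⟩

lemma id : XRep (fun P : C.Point => P) X 1 :=
  ⟨rfl, isCoprime_one_right, by simp, fun _ h => by simp at h,
    fun h _ => ⟨_, _, h, rfl, by simp⟩⟩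

lemma neg (h : XRep φ p q) : XRep (fun P => -φ P) p q := by
  refine ⟨by rw [h.map_zero, Affine.Point.neg_zero], h.isCoprime, h.degree_lt, fun h' hx => ?_, fun h' hx => ?_⟩
  · rw [h.eq_zero h' hx, Affine.Point.neg_zero]
  · obtain ⟨x', y', h'', e, he⟩ := h.eq_some h' hx
    exact ⟨_, _, _, by rw [e, Affine.Point.neg_some], he⟩

lemma eq_zero_of_eq_zero (h : XRep φ p 0) (P : C.Point) : φ P = 0 := by
  cases P with
  | zero => exact h.map_zero
  | some x y h' => exact h.eq_zero h' (eval_zero)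

lemma mul_eq [IsAlgClosed L] [C.IsElliptic] (h : XRep φ p q) (h' : XRep φ p' q') :
    p * q' = p' * q := by
  refine Polynomial.funext fun x => ?_
  obtain ⟨y, hy⟩ := exists_point C x
  rw [eval_mul, eval_mul]
  by_cases hq : q.eval x = 0
  · by_cases hq' : q'.eval x = 0
    · rw [hq, hq', mul_zero, mul_zero]
    · obtain ⟨x₁, y₁, h₁, e, -⟩ := h'.eq_some hy hq'
      rw [h.eq_zero hy hq] at e
      cases e
  · obtain ⟨x₂, y₂, h₂, e, he⟩ := h.eq_some hy hq
    by_cases hq' : q'.eval x = 0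
    · rw [h'.eq_zero hy hq'] at e
      cases e
    · obtain ⟨x₁, y₁, h₁, e', he'⟩ := h'.eq_some hy hq'
      rw [e, Affine.Point.some.injEq] at e'
      obtain ⟨rfl, -⟩ := e'
      rw [← he, ← he']
      ring

/-- Two reduced fractions that agree differ by a scalar, so the degree of `p` and `ratio p q` depend
on `φ` alone. -/
lemma unique [IsAlgClosed L] [C.IsElliptic] (h : XRep φ p q) (h' : XRep φ p' q') :
    ∃ a : L, a ≠ 0 ∧ p' = Polynomial.C a * p ∧ q' = Polynomial.C a * q := by
  have e := h.mul_eq h'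
  have h1 : p ∣ p' := h.isCoprime.dvd_of_dvd_mul_right (Dvd.intro _ e)
  have h2 : p' ∣ p := h'.isCoprime.dvd_of_dvd_mul_right (Dvd.intro _ e.symm)
  obtain ⟨u, hu⟩ := associated_of_dvd_dvd h1 h2
  obtain ⟨a, ha, hau⟩ := Polynomial.isUnit_iff.mp u.isUnit
  rw [← hau] at hu
  refine ⟨a, ha.ne_zero, by rw [← hu, mul_comm], mul_left_cancel₀ h.ne_zero ?_⟩
  rw [e, ← hu]
  ring

end XRep

end XRep

/-! ### Composition: multiplicativity of the degree and of the leading coefficient at infinity -/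

section Composition

variable {L : Type*} [Field L]

/-- The homogenization of degree `n` of the polynomial `p`, evaluated at `(a, b)`. -/
noncomputable def homogEval (n : ℕ) (p a b : L[X]) : L[X] :=
  ∑ i ∈ Finset.range (n + 1), C (p.coeff i) * (a ^ i * b ^ (n - i))

lemma eval_homogEval_of_eq_zero {n : ℕ} {p a b : L[X]} {x : L} (hb : b.eval x = 0) :
    (homogEval n p a b).eval x = p.coeff n * a.eval x ^ n := by
  rw [homogEval, eval_finsetSum, Finset.sum_range_succ, Finset.sum_eq_zero, zero_add]
  · simp
  · intro i hi
    have := Finset.mem_range.mp hi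
    rw [eval_mul, eval_mul, eval_pow, eval_pow, hb, zero_pow (by omega), mul_zero, mul_zero]

lemma eval_homogEval {n : ℕ} {p a b : L[X]} (hp : p.natDegree ≤ n) {x z : L}
    (hz : z * b.eval x = a.eval x) :
    (homogEval n p a b).eval x = b.eval x ^ n * p.eval z := by
  rw [homogEval, eval_finsetSum, eval_eq_sum_range' (Nat.lt_succ_of_le hp), Finset.mul_sum]
  refine Finset.sum_congr rfl fun i hi => ?_
  have := Finset.mem_range.mp hi
  rw [eval_mul, eval_mul, eval_pow, eval_pow, eval_C, ← hz, mul_pow,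
    show n = i + (n - i) by omega, pow_add, show i + (n - i) - i = n - i by omega]
  ring

lemma natDegree_pow_mul_pow_le {a b : L[X]} {m n i : ℕ} (ha : a.natDegree ≤ m + 1)
    (hb : b.natDegree ≤ m) (hi : i ≤ n) : (a ^ i * b ^ (n - i)).natDegree ≤ n * m + i := by
  refine (natDegree_mul_le_of_le (natDegree_pow_le_of_le i ha)
    (natDegree_pow_le_of_le (n - i) hb)).trans (le_of_eq ?_)
  obtain ⟨j, rfl⟩ := Nat.exists_eq_add_of_le hi
  rw [Nat.add_sub_cancel_left]
  ring

lemma coeff_homogEval_of_lt {a b : L[X]} {m n N : ℕ} (p : L[X]) (ha : a.natDegree ≤ m + 1)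
    (hb : b.natDegree ≤ m) (hN : n * m + n < N) : (homogEval n p a b).coeff N = 0 := by
  rw [homogEval, finsetSum_coeff]
  refine Finset.sum_eq_zero fun i hi => ?_
  have := Finset.mem_range.mp hi
  rw [coeff_C_mul]
  refine mul_eq_zero_of_right _ (coeff_eq_zero_of_natDegree_lt ?_)
  exact (natDegree_pow_mul_pow_le ha hb (by omega)).trans_lt (by omega)

lemma coeff_homogEval {a b : L[X]} {m n : ℕ} (p : L[X]) (ha : a.natDegree ≤ m + 1)
    (hb : b.natDegree ≤ m) :
    (homogEval n p a b).coeff (n * m + n) = p.coeff n * a.coeff (m + 1) ^ n := by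
  rw [homogEval, finsetSum_coeff, Finset.sum_range_succ, Finset.sum_eq_zero, zero_add]
  · rw [coeff_C_mul, Nat.sub_self, pow_zero, mul_one, ← coeff_pow_of_natDegree_le ha,
      Nat.mul_succ]
  · intro i hi
    have := Finset.mem_range.mp hi
    rw [coeff_C_mul]
    refine mul_eq_zero_of_right _ (coeff_eq_zero_of_natDegree_lt ?_)
    exact (natDegree_pow_mul_pow_le ha hb (by omega)).trans_lt (by omega)

/-- Meant for a denominator, which has smaller degree than the numerator: homogenized to the degree
of the numerator, its leading term carries one factor `b`. The result is the coefficient that enters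
the `ratio` of a composite. -/
lemma coeff_homogEval_pred {a b : L[X]} {m n : ℕ} {p : L[X]} (hp : p.coeff (n + 1) = 0)
    (ha : a.natDegree ≤ m + 1) (hb : b.natDegree ≤ m) :
    (homogEval (n + 1) p a b).coeff ((n + 1) * m + n) =
      p.coeff n * (a.coeff (m + 1) ^ n * b.coeff m) := by
  rw [homogEval, finsetSum_coeff, Finset.sum_range_succ, hp, C_0, zero_mul, coeff_zero, add_zero,
    Finset.sum_range_succ, Finset.sum_eq_zero, zero_add]
  · rw [coeff_C_mul, Nat.add_sub_cancel_left, pow_one, ← coeff_pow_of_natDegree_le ha,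
      show (n + 1) * m + n = n * (m + 1) + m by ring, coeff_mul_add_eq_of_natDegree_le _ hb]
    exact natDegree_pow_le_of_le n ha
  · intro i hi
    have := Finset.mem_range.mp hi
    rw [coeff_C_mul]
    refine mul_eq_zero_of_right _ (coeff_eq_zero_of_natDegree_lt ?_)
    exact (natDegree_pow_mul_pow_le ha hb (by omega)).trans_lt (by omega)

/-- The leading coefficient of `x * q / p` at infinity. -/
noncomputable def ratio (p q : L[X]) : L := q.coeff (p.natDegree - 1) / p.leadingCoeff

lemma ratio_zero (p : L[X]) : ratio p 0 = 0 := by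
  rw [ratio, coeff_zero, zero_div]

namespace XRep

variable {C : Affine L} {φ ψ : C.Point → C.Point} {p q p' q' : L[X]}

lemma exists_natDegree (h : XRep φ p q) (hq : q ≠ 0) :
    ∃ m, p.natDegree = m + 1 ∧ q.natDegree ≤ m := by
  have := natDegree_lt_natDegree hq h.degree_lt
  exact ⟨p.natDegree - 1, by omega, by omega⟩

lemma natDegree_eq_zero (h : XRep φ p 0) : p.natDegree = 0 :=
  natDegree_eq_zero_of_isUnit (isCoprime_zero_right.mp h.isCoprime)

lemma coeff_natDegree_eq_zero (h : XRep φ p q) : q.coeff p.natDegree = 0 :=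
  coeff_eq_zero_of_degree_lt (h.degree_lt.trans_le degree_le_natDegree)

/-- Substitute `p' / q'` in `p / q`, with both homogenized to the degree of `p`. At a root of `q'`
only the leading term of `p` remains, and it is nonzero, so the new fraction is still reduced. -/
lemma comp_of_ne_zero [IsAlgClosed L] [C.IsElliptic] (h : XRep φ p q) (h' : XRep ψ p' q')
    (hq' : q' ≠ 0) :
    XRep (fun P => φ (ψ P)) (homogEval p.natDegree p p' q') (homogEval p.natDegree q p' q') ∧
      (homogEval p.natDegree p p' q').natDegree = p.natDegree * p'.natDegree ∧
      (homogEval p.natDegree p p' q').leadingCoeff =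
        p.leadingCoeff * p'.leadingCoeff ^ p.natDegree := by
  obtain ⟨m, hm, hm'⟩ := h'.exists_natDegree hq'
  have hqd : q.natDegree ≤ p.natDegree := natDegree_le_natDegree h.degree_lt.le
  have hlc : (homogEval p.natDegree p p' q').coeff (p.natDegree * m + p.natDegree) =
      p.leadingCoeff * p'.leadingCoeff ^ p.natDegree := by
    rw [coeff_homogEval p hm.le hm', ← hm, coeff_natDegree, coeff_natDegree]
  have hlc0 : p.leadingCoeff * p'.leadingCoeff ^ p.natDegree ≠ 0 :=
    mul_ne_zero (leadingCoeff_ne_zero.mpr h.ne_zero)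
      (pow_ne_zero _ (leadingCoeff_ne_zero.mpr h'.ne_zero))
  have hdeg : (homogEval p.natDegree p p' q').natDegree = p.natDegree * m + p.natDegree := by
    refine le_antisymm (natDegree_le_iff_coeff_eq_zero.mpr fun N hN => ?_)
      (le_natDegree_of_ne_zero (hlc ▸ hlc0))
    exact coeff_homogEval_of_lt p hm.le hm' hN
  have hev : ∀ x, (homogEval p.natDegree q p' q').eval x = 0 →
      (homogEval p.natDegree p p' q').eval x ≠ 0 := by
    intro x hx
    by_cases hqx : q'.eval x = 0
    · rw [eval_homogEval_of_eq_zero hqx, coeff_natDegree]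
      exact mul_ne_zero (leadingCoeff_ne_zero.mpr h.ne_zero)
        (pow_ne_zero _ (h'.eval_ne_zero hqx))
    · have hz := div_mul_cancel₀ (p'.eval x) hqx
      rw [eval_homogEval hqd hz] at hx
      rw [eval_homogEval le_rfl hz]
      exact mul_ne_zero (pow_ne_zero _ hqx)
        (h.eval_ne_zero ((mul_eq_zero.mp hx).resolve_left (pow_ne_zero _ hqx)))
  refine ⟨⟨?_, ?_, ?_, ?_, ?_⟩, ?_, ?_⟩
  · rw [h'.map_zero, h.map_zero]
  · rw [isCoprime_iff_aeval_ne_zero_of_isAlgClosed L L]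
    intro x
    by_cases hx : (homogEval p.natDegree q p' q').eval x = 0
    · exact .inl (by simpa using hev x hx)
    · exact .inr (by simpa using hx)
  · rw [degree_eq_natDegree (p := homogEval p.natDegree p p' q')
      (fun h0 => hlc0 (by rw [← hlc, h0, coeff_zero])), hdeg, degree_lt_iff_coeff_zero]
    intro N hN
    rcases hN.eq_or_lt with rfl | hN
    · rw [coeff_homogEval q hm.le hm', h.coeff_natDegree_eq_zero, zero_mul]
    · exact coeff_homogEval_of_lt q hm.le hm' hN
  · intro x y hxy hx
    by_cases hqx : q'.eval x = 0
    · rw [h'.eq_zero hxy hqx, h.map_zero]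
    · obtain ⟨x', y', h'', e, he⟩ := h'.eq_some hxy hqx
      rw [eval_homogEval hqd he] at hx
      rw [e, h.eq_zero h'' ((mul_eq_zero.mp hx).resolve_left (pow_ne_zero _ hqx))]
  · intro x y hxy hx
    by_cases hqx : q'.eval x = 0
    · rw [eval_homogEval_of_eq_zero hqx, h.coeff_natDegree_eq_zero, zero_mul] at hx
      exact absurd rfl hx
    · obtain ⟨x', y', h'', e, he⟩ := h'.eq_some hxy hqx
      rw [eval_homogEval hqd he] at hx
      obtain ⟨x₂, y₂, h₂, e₂, he₂⟩ := h.eq_some h'' (right_ne_zero_of_mul hx)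
      refine ⟨x₂, y₂, h₂, by rw [e, e₂], ?_⟩
      rw [eval_homogEval hqd he, eval_homogEval le_rfl he, ← he₂]
      ring
  · rw [hdeg, hm]
    ring
  · rw [leadingCoeff, hdeg, hlc]

/-- The degree is multiplicative, and so is the leading coefficient at infinity. -/
lemma comp [IsAlgClosed L] [C.IsElliptic] (h : XRep φ p q) (h' : XRep ψ p' q') :
    ∃ P Q, XRep (fun P => φ (ψ P)) P Q ∧ P.natDegree = p.natDegree * p'.natDegree ∧
      ratio P Q = ratio p q * ratio p' q' := by
  by_cases hq : q = 0
  · subst hq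
    refine ⟨1, 0, ?_, ?_, ?_⟩
    · simpa only [h.eq_zero_of_eq_zero] using zero
    · rw [h.natDegree_eq_zero, natDegree_one, zero_mul]
    · rw [ratio_zero, ratio_zero, zero_mul]
  by_cases hq' : q' = 0
  · subst hq'
    refine ⟨1, 0, ?_, ?_, ?_⟩
    · simpa only [h'.eq_zero_of_eq_zero, h.map_zero] using zero
    · rw [h'.natDegree_eq_zero, natDegree_one, mul_zero]
    · rw [ratio_zero, ratio_zero, mul_zero]
  obtain ⟨h1, h2, h3⟩ := h.comp_of_ne_zero h' hq'
  refine ⟨_, _, h1, h2, ?_⟩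
  obtain ⟨m, hm, hm'⟩ := h'.exists_natDegree hq'
  obtain ⟨n, hn, hn'⟩ := h.exists_natDegree hq
  have hlc := leadingCoeff_ne_zero.mpr h.ne_zero
  have hlc' := leadingCoeff_ne_zero.mpr h'.ne_zero
  have h4 := h.coeff_natDegree_eq_zero
  rw [ratio, ratio, ratio, h2, h3, hm, hn, Nat.add_sub_cancel, Nat.add_sub_cancel,
    show (n + 1) * (m + 1) - 1 = (n + 1) * m + n by
      rw [Nat.mul_succ, ← add_assoc, Nat.add_sub_cancel],
    coeff_homogEval_pred (hn ▸ h4) hm.le hm', ← hm, coeff_natDegree]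
  field_simp
  ring

end XRep

end Composition

/-! ### The parallelogram law for the degree -/

section Parallelogram

/-- Top coefficients of the polynomials in `XRep.exists_mul_eq`: the terms that contain some `bᵢ`
have too small a degree to contribute. -/
lemma coeffs_identities {L : Type*} [Field L] {p₁ q₁ p₂ q₂ : L[X]} (b₂ b₄ b₆ b₈ : L) {m₁ m₂ : ℕ} (hp₁ : p₁.natDegree ≤ m₁ + 1)
    (hp₂ : p₂.natDegree ≤ m₂ + 1) (hq₁ : q₁.natDegree ≤ m₁) (hq₂ : q₂.natDegree ≤ m₂) :
    ((p₁ * q₂ - p₂ * q₁) * (p₁ * q₂ - p₂ * q₁)).coeff (2 * (m₁ + m₂) + 2) =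
      (p₁.coeff (m₁ + 1) * q₂.coeff m₂ - p₂.coeff (m₂ + 1) * q₁.coeff m₁) ^ 2 ∧
    (C 2 * ((p₁ * q₂ + p₂ * q₁) * (p₁ * p₂)) + C b₂ * (p₁ * p₂ * (q₁ * q₂)) +
      C b₄ * ((p₁ * q₂ + p₂ * q₁) * (q₁ * q₂)) +
        C b₆ * (q₁ * q₂ * (q₁ * q₂))).coeff (2 * (m₁ + m₂) + 3) =
      2 * (p₁.coeff (m₁ + 1) * q₂.coeff m₂ + p₂.coeff (m₂ + 1) * q₁.coeff m₁) *
        (p₁.coeff (m₁ + 1) * p₂.coeff (m₂ + 1)) ∧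
    (p₁ * p₂ * (p₁ * p₂) - C b₄ * (p₁ * p₂ * (q₁ * q₂)) -
      C b₆ * ((p₁ * q₂ + p₂ * q₁) * (q₁ * q₂)) -
        C b₈ * (q₁ * q₂ * (q₁ * q₂))).coeff (2 * (m₁ + m₂) + 4) =
      (p₁.coeff (m₁ + 1) * p₂.coeff (m₂ + 1)) ^ 2 ∧
    (p₁ * p₂ * (p₁ * p₂) - C b₄ * (p₁ * p₂ * (q₁ * q₂)) -
      C b₆ * ((p₁ * q₂ + p₂ * q₁) * (q₁ * q₂)) -
        C b₈ * (q₁ * q₂ * (q₁ * q₂))).natDegree ≤ 2 * (m₁ + m₂) + 4 := by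
  have hT : (p₁ * p₂).natDegree ≤ m₁ + m₂ + 2 :=
    (natDegree_mul_le_of_le hp₁ hp₂).trans (by omega)
  have hU : (q₁ * q₂).natDegree ≤ m₁ + m₂ := natDegree_mul_le_of_le hq₁ hq₂
  have h12 : (p₁ * q₂).natDegree ≤ m₁ + m₂ + 1 :=
    (natDegree_mul_le_of_le hp₁ hq₂).trans (by omega)
  have h21 : (p₂ * q₁).natDegree ≤ m₁ + m₂ + 1 :=
    (natDegree_mul_le_of_le hp₂ hq₁).trans (by omega)
  have hS : (p₁ * q₂ + p₂ * q₁).natDegree ≤ m₁ + m₂ + 1 := natDegree_add_le_of_degree_le h12 h21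
  have hD : (p₁ * q₂ - p₂ * q₁).natDegree ≤ m₁ + m₂ + 1 := natDegree_sub_le_of_le h12 h21 |>.trans
    (by simp)
  have cT : (p₁ * p₂).coeff (m₁ + m₂ + 2) = p₁.coeff (m₁ + 1) * p₂.coeff (m₂ + 1) := by
    rw [← coeff_mul_add_eq_of_natDegree_le hp₁ hp₂]
    congr 1
    omega
  have c12 : (p₁ * q₂).coeff (m₁ + m₂ + 1) = p₁.coeff (m₁ + 1) * q₂.coeff m₂ := by
    rw [← coeff_mul_add_eq_of_natDegree_le hp₁ hq₂]
    congr 1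
    omega
  have c21 : (p₂ * q₁).coeff (m₁ + m₂ + 1) = p₂.coeff (m₂ + 1) * q₁.coeff m₁ := by
    rw [← coeff_mul_add_eq_of_natDegree_le hp₂ hq₁]
    congr 1
    omega
  have hTU := natDegree_mul_le_of_le hT hU
  have hSU := natDegree_mul_le_of_le hS hU
  have hUU := natDegree_mul_le_of_le hU hU
  have hTT := natDegree_mul_le_of_le hT hT
  refine ⟨?_, ?_, ?_, ?_⟩
  · rw [show 2 * (m₁ + m₂) + 2 = m₁ + m₂ + 1 + (m₁ + m₂ + 1) by omega,
      coeff_mul_add_eq_of_natDegree_le hD hD, coeff_sub, c12, c21]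
    ring
  · rw [show 2 * (m₁ + m₂) + 3 = m₁ + m₂ + 1 + (m₁ + m₂ + 2) by omega]
    rw [coeff_add, coeff_add, coeff_add, coeff_C_mul, coeff_C_mul, coeff_C_mul, coeff_C_mul,
      coeff_mul_add_eq_of_natDegree_le hS hT, coeff_add, c12, c21, cT,
      coeff_eq_zero_of_natDegree_lt (hTU.trans_lt (by omega)),
      coeff_eq_zero_of_natDegree_lt (hSU.trans_lt (by omega)),
      coeff_eq_zero_of_natDegree_lt (hUU.trans_lt (by omega))]
    ring
  · rw [show 2 * (m₁ + m₂) + 4 = m₁ + m₂ + 2 + (m₁ + m₂ + 2) by omega]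
    rw [coeff_sub, coeff_sub, coeff_sub, coeff_C_mul, coeff_C_mul, coeff_C_mul,
      coeff_mul_add_eq_of_natDegree_le hT hT, cT,
      coeff_eq_zero_of_natDegree_lt (hTU.trans_lt (by omega)),
      coeff_eq_zero_of_natDegree_lt (hSU.trans_lt (by omega)),
      coeff_eq_zero_of_natDegree_lt (hUU.trans_lt (by omega))]
    ring
  · rw [natDegree_le_iff_coeff_eq_zero]
    intro N hN
    rw [coeff_sub, coeff_sub, coeff_sub, coeff_C_mul, coeff_C_mul, coeff_C_mul,
      coeff_eq_zero_of_natDegree_lt (hTT.trans_lt (by omega)),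
      coeff_eq_zero_of_natDegree_lt (hTU.trans_lt (by omega)),
      coeff_eq_zero_of_natDegree_lt (hSU.trans_lt (by omega)),
      coeff_eq_zero_of_natDegree_lt (hUU.trans_lt (by omega))]
    ring

variable {L : Type*} [Field L] [IsAlgClosed L] [DecidableEq L] {W : Affine L} [W.IsElliptic]
  {φ ψ : W.Point → W.Point} {p₁ q₁ p₂ q₂ p₃ q₃ p₄ q₄ : L[X]}

namespace XRep

/-- Multiplication by two has degree four. -/
lemma add_self (W : Affine L) [W.IsElliptic] :
    ∃ p q, XRep (fun P : W.Point => P + P) p q ∧ p.natDegree = 4 ∧ ratio p q = 4 := by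
  have hp : (X ^ 4 - C W.b₄ * X ^ 2 - C (2 * W.b₆) * X - C W.b₈ : L[X]).natDegree = 4 := by
    compute_degree!
  have hp1 : (X ^ 4 - C W.b₄ * X ^ 2 - C (2 * W.b₆) * X - C W.b₈ : L[X]).coeff 4 = 1 := by
    compute_degree!
  have hp0 : (X ^ 4 - C W.b₄ * X ^ 2 - C (2 * W.b₆) * X - C W.b₈ : L[X]) ≠ 0 := by
    intro h0
    rw [h0, natDegree_zero] at hp
    omega
  have hq : (C 4 * X ^ 3 + C W.b₂ * X ^ 2 + C (2 * W.b₄) * X + C W.b₆ : L[X]).natDegree ≤ 3 := by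
    compute_degree
  have hq3 : (C 4 * X ^ 3 + C W.b₂ * X ^ 2 + C (2 * W.b₄) * X + C W.b₆ : L[X]).coeff 3 = 4 := by
    compute_degree!
  refine ⟨_, C 4 * X ^ 3 + C W.b₂ * X ^ 2 + C (2 * W.b₄) * X + C W.b₆,
    ⟨add_zero 0, ?_, ?_, fun h hx => ?_, fun h hx => ?_⟩, hp, ?_⟩
  · rw [isCoprime_iff_aeval_ne_zero_of_isAlgClosed L L]
    intro x
    by_cases hx : 4 * x ^ 3 + W.b₂ * x ^ 2 + 2 * W.b₄ * x + W.b₆ = 0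
    · refine .inl ?_
      simpa using duplication_ne_zero W x hx
    · exact .inr (by simpa using hx)
  · rw [degree_eq_natDegree hp0, hp]
    exact (degree_le_of_natDegree_le hq).trans_lt (by norm_num)
  · exact add_self_eq_zero_of_x h (by simpa using hx)
  · obtain ⟨x', y', h', e, he⟩ := add_self_eq_some h (by simpa using hx)
    exact ⟨x', y', h', e, by simpa using he⟩
  · rw [ratio, leadingCoeff, hp, hp1, hq3, div_one]

lemma eval_identities (h₁ : XRep φ p₁ q₁) (h₂ : XRep ψ p₂ q₂)
    (h₃ : XRep (fun P => φ P + ψ P) p₃ q₃) (h₄ : XRep (fun P => φ P - ψ P) p₄ q₄) {x : L}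
    (hq₁ : q₁.eval x ≠ 0) (hq₂ : q₂.eval x ≠ 0) (hq₃ : q₃.eval x ≠ 0) (hq₄ : q₄.eval x ≠ 0) :
    ∃ x₁ x₂ x₃ x₄, x₁ * q₁.eval x = p₁.eval x ∧ x₂ * q₂.eval x = p₂.eval x ∧
      x₃ * q₃.eval x = p₃.eval x ∧ x₄ * q₄.eval x = p₄.eval x ∧ x₁ ≠ x₂ ∧
      (x₃ + x₄) * (x₁ - x₂) ^ 2 = 2 * (x₁ + x₂) * (x₁ * x₂) + W.b₂ * (x₁ * x₂) +
        W.b₄ * (x₁ + x₂) + W.b₆ ∧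
      x₃ * x₄ * (x₁ - x₂) ^ 2 =
        (x₁ * x₂) ^ 2 - W.b₄ * (x₁ * x₂) - W.b₆ * (x₁ + x₂) - W.b₈ := by
  obtain ⟨y, hy⟩ := exists_point W x
  obtain ⟨x₁, y₁, h₁', e₁, hx₁⟩ := h₁.eq_some hy hq₁
  obtain ⟨x₂, y₂, h₂', e₂, hx₂⟩ := h₂.eq_some hy hq₂
  obtain ⟨x₃, y₃, h₃', e₃, hx₃⟩ := h₃.eq_some hy hq₃
  obtain ⟨x₄, y₄, h₄', e₄, hx₄⟩ := h₄.eq_some hy hq₄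
  -- Equal `x`-coordinates would make the sum or the difference zero, while `q₃` and `q₄` do not
  -- vanish at `x`.
  have hne : x₁ ≠ x₂ := by
    rintro rfl
    rcases Affine.Y_eq_of_X_eq h₁'.1 h₂'.1 rfl with rfl | rfl
    · rw [e₁, e₂, sub_self] at e₄
      cases e₄
    · rw [e₁, e₂, Affine.Point.add_of_Y_eq rfl rfl] at e₃
      cases e₃
  obtain ⟨z, w, h, z', w', h', e, e', hadd, hmul⟩ := add_sub_eq_some h₁' h₂' hne
  rw [e₁, e₂, e, Affine.Point.some.injEq] at e₃
  rw [e₁, e₂, e', Affine.Point.some.injEq] at e₄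
  obtain ⟨rfl, -⟩ := e₃
  obtain ⟨rfl, -⟩ := e₄
  exact ⟨_, _, _, _, hx₁, hx₂, hx₃, hx₄, hne, hadd, hmul⟩

/-- The right sides are the symmetric functions `1, x₃ + x₄, x₃ * x₄` of the `x`-coordinates of sum
and difference, cleared of denominators. They have no common root since both fractions are reduced,
so a Bézout combination of the left sides is the common factor `l`. -/
lemma exists_mul_eq (h₁ : XRep φ p₁ q₁) (h₂ : XRep ψ p₂ q₂)
    (h₃ : XRep (fun P => φ P + ψ P) p₃ q₃) (h₄ : XRep (fun P => φ P - ψ P) p₄ q₄)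
    (hq₁ : q₁ ≠ 0) (hq₂ : q₂ ≠ 0) (hq₃ : q₃ ≠ 0) (hq₄ : q₄ ≠ 0) : ∃ l : L[X],
      (p₁ * q₂ - p₂ * q₁) * (p₁ * q₂ - p₂ * q₁) = l * (q₃ * q₄) ∧
      C 2 * ((p₁ * q₂ + p₂ * q₁) * (p₁ * p₂)) + C W.b₂ * (p₁ * p₂ * (q₁ * q₂)) +
        C W.b₄ * ((p₁ * q₂ + p₂ * q₁) * (q₁ * q₂)) + C W.b₆ * (q₁ * q₂ * (q₁ * q₂)) =
          l * (p₃ * q₄ + p₄ * q₃) ∧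
      p₁ * p₂ * (p₁ * p₂) - C W.b₄ * (p₁ * p₂ * (q₁ * q₂)) -
        C W.b₆ * ((p₁ * q₂ + p₂ * q₁) * (q₁ * q₂)) - C W.b₈ * (q₁ * q₂ * (q₁ * q₂)) =
          l * (p₃ * p₄) := by
  have hq : q₁ * q₂ * q₃ * q₄ ≠ 0 := by simp [*]
  have key : ∀ f g : L[X], (∀ x, q₁.eval x ≠ 0 → q₂.eval x ≠ 0 → q₃.eval x ≠ 0 →
      q₄.eval x ≠ 0 → f.eval x = g.eval x) → f = g := by
    intro f g hfg
    apply mul_left_cancel₀ hq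
    refine Polynomial.funext fun x => ?_
    simp only [eval_mul]
    by_cases h1 : q₁.eval x = 0
    · simp [h1]
    by_cases h2 : q₂.eval x = 0
    · simp [h2]
    by_cases h3 : q₃.eval x = 0
    · simp [h3]
    by_cases h4 : q₄.eval x = 0
    · simp [h4]
    rw [hfg x h1 h2 h3 h4]
  obtain ⟨u, hu⟩ := exists_bezout (P := ![q₃ * q₄, p₃ * q₄ + p₄ * q₃, p₃ * p₄]) fun x => by
    by_contra! h0
    have e0 : q₃.eval x * q₄.eval x = 0 := by simpa using h0 0
    have e1 : p₃.eval x * q₄.eval x + p₄.eval x * q₃.eval x = 0 := by simpa using h0 1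
    have e2 : p₃.eval x * p₄.eval x = 0 := by simpa using h0 2
    rcases mul_eq_zero.mp e0 with h | h
    · have h3 := h₃.eval_ne_zero h
      rw [h, mul_zero, add_zero] at e1
      exact h₄.eval_ne_zero ((mul_eq_zero.mp e1).resolve_left h3)
        ((mul_eq_zero.mp e2).resolve_left h3)
    · have h4 := h₄.eval_ne_zero h
      rw [h, mul_zero, zero_add] at e1
      exact h₃.eval_ne_zero ((mul_eq_zero.mp e1).resolve_left h4)
        ((mul_eq_zero.mp e2).resolve_right h4)
  simp only [Matrix.cons_val] at hu
  have hA : (C 2 * ((p₁ * q₂ + p₂ * q₁) * (p₁ * p₂)) + C W.b₂ * (p₁ * p₂ * (q₁ * q₂)) +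
        C W.b₄ * ((p₁ * q₂ + p₂ * q₁) * (q₁ * q₂)) + C W.b₆ * (q₁ * q₂ * (q₁ * q₂))) * (q₃ * q₄) =
      (p₁ * q₂ - p₂ * q₁) * (p₁ * q₂ - p₂ * q₁) * (p₃ * q₄ + p₄ * q₃) := by
    refine key _ _ fun x h1 h2 h3 h4 => ?_
    obtain ⟨x₁, x₂, x₃, x₄, e1, e2, e3, e4, -, hadd, -⟩ := h₁.eval_identities h₂ h₃ h₄ h1 h2 h3 h4
    simp only [eval_mul, eval_add, eval_sub, eval_C, ← e1, ← e2, ← e3, ← e4]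
    linear_combination -(q₁.eval x * q₂.eval x) ^ 2 * q₃.eval x * q₄.eval x * hadd
  have hB : (p₁ * p₂ * (p₁ * p₂) - C W.b₄ * (p₁ * p₂ * (q₁ * q₂)) -
        C W.b₆ * ((p₁ * q₂ + p₂ * q₁) * (q₁ * q₂)) - C W.b₈ * (q₁ * q₂ * (q₁ * q₂))) * (q₃ * q₄) =
      (p₁ * q₂ - p₂ * q₁) * (p₁ * q₂ - p₂ * q₁) * (p₃ * p₄) := by
    refine key _ _ fun x h1 h2 h3 h4 => ?_
    obtain ⟨x₁, x₂, x₃, x₄, e1, e2, e3, e4, -, -, hmul⟩ := h₁.eval_identities h₂ h₃ h₄ h1 h2 h3 h4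
    simp only [eval_mul, eval_add, eval_sub, eval_C, ← e1, ← e2, ← e3, ← e4]
    linear_combination -(q₁.eval x * q₂.eval x) ^ 2 * q₃.eval x * q₄.eval x * hmul
  generalize (p₁ * q₂ - p₂ * q₁) * (p₁ * q₂ - p₂ * q₁) = D at *
  generalize C 2 * ((p₁ * q₂ + p₂ * q₁) * (p₁ * p₂)) + C W.b₂ * (p₁ * p₂ * (q₁ * q₂)) +
        C W.b₄ * ((p₁ * q₂ + p₂ * q₁) * (q₁ * q₂)) + C W.b₆ * (q₁ * q₂ * (q₁ * q₂)) = A at *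
  generalize p₁ * p₂ * (p₁ * p₂) - C W.b₄ * (p₁ * p₂ * (q₁ * q₂)) -
        C W.b₆ * ((p₁ * q₂ + p₂ * q₁) * (q₁ * q₂)) - C W.b₈ * (q₁ * q₂ * (q₁ * q₂)) = B at *
  have hD : D = (u 0 * D + u 1 * A + u 2 * B) * (q₃ * q₄) := by
    linear_combination (-D) * hu - u 1 * hA - u 2 * hB
  have h34 : q₃ * q₄ ≠ 0 := mul_ne_zero hq₃ hq₄
  refine ⟨_, hD, mul_right_cancel₀ h34 ?_, mul_right_cancel₀ h34 ?_⟩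
  · rw [hA]
    linear_combination (p₃ * q₄ + p₄ * q₃) * hD
  · rw [hB]
    linear_combination (p₃ * p₄) * hD

/-- The parallelogram inequality for the degree; equality gives two relations between leading
coefficients. -/
lemma parallelogram (h₁ : XRep φ p₁ q₁) (h₂ : XRep ψ p₂ q₂)
    (h₃ : XRep (fun P => φ P + ψ P) p₃ q₃) (h₄ : XRep (fun P => φ P - ψ P) p₄ q₄)
    (hq₁ : q₁ ≠ 0) (hq₂ : q₂ ≠ 0) (hq₃ : q₃ ≠ 0) (hq₄ : q₄ ≠ 0) :
    p₃.natDegree + p₄.natDegree ≤ 2 * p₁.natDegree + 2 * p₂.natDegree ∧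
    (p₃.natDegree + p₄.natDegree = 2 * p₁.natDegree + 2 * p₂.natDegree →
      ratio p₃ q₃ + ratio p₄ q₄ = 2 * ratio p₁ q₁ + 2 * ratio p₂ q₂ ∧
      ratio p₃ q₃ * ratio p₄ q₄ = (ratio p₁ q₁ - ratio p₂ q₂) ^ 2) := by
  obtain ⟨l, hD, hA, hB⟩ := h₁.exists_mul_eq h₂ h₃ h₄ hq₁ hq₂ hq₃ hq₄
  obtain ⟨m₁, hm₁, hm₁'⟩ := h₁.exists_natDegree hq₁
  obtain ⟨m₂, hm₂, hm₂'⟩ := h₂.exists_natDegree hq₂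
  obtain ⟨m₃, hm₃, hm₃'⟩ := h₃.exists_natDegree hq₃
  obtain ⟨m₄, hm₄, hm₄'⟩ := h₄.exists_natDegree hq₄
  obtain ⟨cD, cA, cB, dB⟩ := coeffs_identities W.b₂ W.b₄ W.b₆ W.b₈ hm₁.le hm₂.le hm₁' hm₂'
  rw [hD] at cD
  rw [hA] at cA
  rw [hB] at cB dB
  have hl₁ : p₁.coeff (m₁ + 1) ≠ 0 := by
    rw [← hm₁]
    exact leadingCoeff_ne_zero.mpr h₁.ne_zero
  have hl₂ : p₂.coeff (m₂ + 1) ≠ 0 := by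
    rw [← hm₂]
    exact leadingCoeff_ne_zero.mpr h₂.ne_zero
  have hl₃ : p₃.coeff (m₃ + 1) ≠ 0 := by
    rw [← hm₃]
    exact leadingCoeff_ne_zero.mpr h₃.ne_zero
  have hl₄ : p₄.coeff (m₄ + 1) ≠ 0 := by
    rw [← hm₄]
    exact leadingCoeff_ne_zero.mpr h₄.ne_zero
  have hl : l ≠ 0 := by
    rintro rfl
    rw [zero_mul, coeff_zero] at cB
    exact pow_ne_zero 2 (mul_ne_zero hl₁ hl₂) cB.symm
  -- The product `l * (p₃ * p₄)` has degree at most `2 * (m₁ + m₂) + 4`, which is twice the sum of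
  -- the degrees of `p₁` and `p₂`. Equality of degrees forces `l` to be constant, and comparing top
  -- coefficients then gives the relations between ratios.
  rw [natDegree_mul hl (mul_ne_zero h₃.ne_zero h₄.ne_zero),
    natDegree_mul h₃.ne_zero h₄.ne_zero] at dB
  refine ⟨by omega, fun heq => ?_⟩
  obtain ⟨c, hc⟩ : ∃ c, C c = l := Polynomial.natDegree_eq_zero.mp (by omega)
  subst hc
  have hm : m₃ + m₄ = 2 * (m₁ + m₂) + 2 := by omega
  have c3 := coeff_mul_add_eq_of_natDegree_le hm₃.le hm₄'
  have c4 := coeff_mul_add_eq_of_natDegree_le hm₄.le hm₃'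
  rw [coeff_C_mul, ← hm, coeff_mul_add_eq_of_natDegree_le hm₃' hm₄'] at cD
  rw [coeff_C_mul, coeff_add, show 2 * (m₁ + m₂) + 3 = m₃ + 1 + m₄ by omega, c3,
    show m₃ + 1 + m₄ = m₄ + 1 + m₃ by omega, c4] at cA
  rw [coeff_C_mul, show 2 * (m₁ + m₂) + 4 = m₃ + 1 + (m₄ + 1) by omega,
    coeff_mul_add_eq_of_natDegree_le hm₃.le hm₄.le] at cB
  have hc : c ≠ 0 := by
    rintro rfl
    rw [zero_mul] at cB
    exact pow_ne_zero 2 (mul_ne_zero hl₁ hl₂) cB.symm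
  simp only [ratio, leadingCoeff, hm₁, hm₂, hm₃, hm₄, Nat.add_sub_cancel]
  generalize p₁.coeff (m₁ + 1) = l₁ at *
  generalize p₂.coeff (m₂ + 1) = l₂ at *
  generalize p₃.coeff (m₃ + 1) = l₃ at *
  generalize p₄.coeff (m₄ + 1) = l₄ at *
  constructor
  · apply mul_right_cancel₀ (mul_ne_zero hc (mul_ne_zero hl₃ hl₄))
    have e1 : (q₃.coeff m₃ / l₃ + q₄.coeff m₄ / l₄) * (c * (l₃ * l₄)) =
        c * (l₃ * q₄.coeff m₄ + l₄ * q₃.coeff m₃) := by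
      field_simp
      ring
    rw [e1, cA, cB]
    field_simp
    ring
  · apply mul_right_cancel₀ (mul_ne_zero hc (mul_ne_zero hl₃ hl₄))
    have e1 : (q₃.coeff m₃ / l₃ * (q₄.coeff m₄ / l₄)) * (c * (l₃ * l₄)) =
        c * (q₃.coeff m₃ * q₄.coeff m₄) := by
      field_simp
    rw [e1, cD, cB]
    field_simp
    ring

end XRep

end Parallelogram

/-! ### The degree as a quadratic form on the endomorphism ring -/

section DegreeForm

variable {L : Type*} [Field L] [IsAlgClosed L] {W : Affine L} [W.IsElliptic]

lemma XRep.invariants_eq {φ : W.Point → W.Point} {p q p' q' : L[X]} (h : XRep φ p q)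
    (h' : XRep φ p' q') : p.natDegree = p'.natDegree ∧ ratio p q = ratio p' q' := by
  obtain ⟨a, ha, rfl, rfl⟩ := h.unique h'
  refine ⟨(natDegree_C_mul ha).symm, ?_⟩
  rw [ratio, ratio, natDegree_C_mul ha, coeff_C_mul, leadingCoeff_mul, leadingCoeff_C,
    mul_div_mul_left _ _ ha]

variable [DecidableEq L]

/-- The degree form on a ring of endomorphisms, together with the square of the action on
invariant differentials. -/
lemma exists_degree_form {R : Subring (AddMonoid.End W.Point)}
    (hR : ∀ r ∈ R, ∃ p q, XRep (⇑r) p q) : ∃ (N : R → ℕ) (κ : R → L),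
      N 1 = 1 ∧ (∀ r, N r = 0 → r = 0) ∧ (∀ r s, N (r * s) = N r * N s) ∧
      (∀ r s, N (r + s) + N (r - s) = 2 * N r + 2 * N s) ∧ κ 1 = 1 ∧
      (∀ r s, κ (r * s) = κ r * κ s) ∧
      (∀ r s, κ (r + s) + κ (r - s) = 2 * κ r + 2 * κ s) ∧
      (∀ r s, κ (r + s) * κ (r - s) = (κ r - κ s) ^ 2) := by
  choose p q h using fun r : R => hR r r.2
  have hq : ∀ r, q r = 0 → r = 0 := by
    intro r hr
    refine Subtype.ext (AddMonoidHom.ext fun P => ?_)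
    have := h r
    rw [hr] at this
    exact this.eq_zero_of_eq_zero P
  have hN0 : ∀ r, (p r).natDegree = 0 → r = 0 := by
    intro r hr
    by_contra h0
    obtain ⟨m, hm, -⟩ := (h r).exists_natDegree fun h1 => h0 (hq r h1)
    omega
  have hzero := (XRep.zero (C := W)).invariants_eq (h 0)
  have hone := (XRep.id (C := W)).invariants_eq (h 1)
  have hmul : ∀ r s, (p (r * s)).natDegree = (p r).natDegree * (p s).natDegree ∧
      ratio (p (r * s)) (q (r * s)) = ratio (p r) (q r) * ratio (p s) (q s) := by
    intro r s
    obtain ⟨P, Q, hPQ, h1, h2⟩ := (h r).comp (h s)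
    obtain ⟨h3, h4⟩ := hPQ.invariants_eq (h (r * s))
    exact ⟨h3.symm.trans h1, h4.symm.trans h2⟩
  have hneg : ∀ r, (p (-r)).natDegree = (p r).natDegree ∧
      ratio (p (-r)) (q (-r)) = ratio (p r) (q r) := by
    intro r
    obtain ⟨h3, h4⟩ := (h r).neg.invariants_eq (h (-r))
    exact ⟨h3.symm, h4.symm⟩
  have hdbl : ∀ r, (p (r + r)).natDegree = 4 * (p r).natDegree ∧
      ratio (p (r + r)) (q (r + r)) = 4 * ratio (p r) (q r) := by
    intro r
    obtain ⟨P, Q, hPQ, h1, h2⟩ := XRep.add_self W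
    obtain ⟨P', Q', hPQ', h1', h2'⟩ := hPQ.comp (h r)
    obtain ⟨h3, h4⟩ := hPQ'.invariants_eq (h (r + r))
    exact ⟨by rw [← h3, h1', h1], by rw [← h4, h2', h2]⟩
  rw [natDegree_one] at hzero
  rw [ratio_zero] at hzero
  -- These are the cases that `XRep.parallelogram` leaves out; they follow from the behaviour under
  -- negation and doubling.
  have hdeg : ∀ r s, r = 0 ∨ s = 0 ∨ r + s = 0 ∨ r - s = 0 →
      (p (r + s)).natDegree + (p (r - s)).natDegree =
        2 * (p r).natDegree + 2 * (p s).natDegree ∧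
      ratio (p (r + s)) (q (r + s)) + ratio (p (r - s)) (q (r - s)) =
        2 * ratio (p r) (q r) + 2 * ratio (p s) (q s) ∧
      ratio (p (r + s)) (q (r + s)) * ratio (p (r - s)) (q (r - s)) =
        (ratio (p r) (q r) - ratio (p s) (q s)) ^ 2 := by
    rintro r s (rfl | rfl | h0 | h0)
    · rw [zero_add, zero_sub, (hneg s).1, (hneg s).2, ← hzero.1, ← hzero.2]
      exact ⟨by ring, by ring, by ring⟩
    · rw [add_zero, sub_zero, ← hzero.1, ← hzero.2]
      exact ⟨by ring, by ring, by ring⟩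
    · obtain rfl := eq_neg_of_add_eq_zero_right h0
      rw [h0, sub_neg_eq_add, (hneg r).1, (hneg r).2, (hdbl r).1, (hdbl r).2, ← hzero.1,
        ← hzero.2]
      exact ⟨by ring, by ring, by ring⟩
    · obtain rfl := sub_eq_zero.mp h0
      rw [h0, (hdbl r).1, (hdbl r).2, ← hzero.1, ← hzero.2]
      exact ⟨by ring, by ring, by ring⟩
  have hpar : ∀ r s : R, ¬(r = 0 ∨ s = 0 ∨ r + s = 0 ∨ r - s = 0) → _ := fun r s hrs =>
    XRep.parallelogram (h r) (h s) (h (r + s)) (h (r - s)) (fun h0 => hrs (.inl (hq _ h0)))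
      (fun h0 => hrs (.inr (.inl (hq _ h0)))) (fun h0 => hrs (.inr (.inr (.inl (hq _ h0)))))
      (fun h0 => hrs (.inr (.inr (.inr (hq _ h0)))))
  have hle : ∀ r s, (p (r + s)).natDegree + (p (r - s)).natDegree ≤
      2 * (p r).natDegree + 2 * (p s).natDegree := by
    intro r s
    by_cases hrs : r = 0 ∨ s = 0 ∨ r + s = 0 ∨ r - s = 0
    · exact (hdeg r s hrs).1.le
    · exact (hpar r s hrs).1
  -- The inequality applied to `r + s` and `r - s` bounds the degrees of `2r` and `2s`. Since
  -- doubling multiplies the degree by four, this is the reverse inequality for `r` and `s`.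
  have heq : ∀ r s, (p (r + s)).natDegree + (p (r - s)).natDegree =
      2 * (p r).natDegree + 2 * (p s).natDegree := by
    intro r s
    have h1 := hle r s
    have h2 := hle (r + s) (r - s)
    rw [add_add_sub_cancel, add_sub_sub_cancel, (hdbl r).1, (hdbl s).1] at h2
    omega
  refine ⟨fun r => (p r).natDegree, fun r => ratio (p r) (q r), ?_, hN0, fun r s => (hmul r s).1,
    heq, ?_, fun r s => (hmul r s).2, fun r s => ?_, fun r s => ?_⟩
  · exact hone.1.symm.trans natDegree_X
  · dsimp only
    rw [← hone.2, ratio]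
    simp
  all_goals
    by_cases hrs : r = 0 ∨ s = 0 ∨ r + s = 0 ∨ r - s = 0
  · exact (hdeg r s hrs).2.1
  · exact ((hpar r s hrs).2 (heq r s)).1
  · exact (hdeg r s hrs).2.2
  · exact ((hpar r s hrs).2 (heq r s)).2

end DegreeForm

/-! ### Rings with a multiplicative quadratic form -/

section Polar

open QuadraticMap

variable {R A : Type*} [AddCommGroup R] [CommRing A] [IsDomain A] {n : R → A}

/-- The Jordan–von Neumann argument: four instances of the parallelogram law combine to twice the
claim. -/
lemma polar_add_left_of_parallelogram (h2 : (2 : A) ≠ 0)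
    (hn : ∀ r s, n (r + s) + n (r - s) = 2 * n r + 2 * n s) (x y z : R) :
    polar n (x + y) z = polar n x z + polar n y z := by
  have e1 := hn (x + z) y
  have e2 := hn (y + z) x
  have e3 := hn z (x - y)
  have e4 := hn x y
  rw [show x + z + y = x + y + z by abel] at e1
  rw [show y + z + x = x + y + z by abel] at e2
  rw [show z + (x - y) = x + z - y by abel, show z - (x - y) = y + z - x by abel] at e3
  rw [polar, polar, polar]
  apply mul_left_cancel₀ h2
  linear_combination e1 + e2 - e3 - 2 * e4

lemma map_zero_of_parallelogram (h2 : (2 : A) ≠ 0)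
    (hn : ∀ r s, n (r + s) + n (r - s) = 2 * n r + 2 * n s) : n 0 = 0 := by
  have := hn 0 0
  rw [add_zero, sub_zero] at this
  apply mul_left_cancel₀ h2
  linear_combination -this

lemma polar_self_of_parallelogram (h2 : (2 : A) ≠ 0)
    (hn : ∀ r s, n (r + s) + n (r - s) = 2 * n r + 2 * n s) (x : R) : polar n x x = 2 * n x := by
  have := hn x x
  rw [sub_self, map_zero_of_parallelogram h2 hn] at this
  rw [polar]
  linear_combination this

/-- The polar form as a homomorphism in its first variable. -/
def polarHom (h2 : (2 : A) ≠ 0) (hn : ∀ r s, n (r + s) + n (r - s) = 2 * n r + 2 * n s) (z : R) :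
    R →+ A :=
  AddMonoidHom.mk' (fun x => polar n x z) fun x y => polar_add_left_of_parallelogram h2 hn x y z

lemma polarHom_apply (h2 : (2 : A) ≠ 0)
    (hn : ∀ r s, n (r + s) + n (r - s) = 2 * n r + 2 * n s) (x z : R) :
    polarHom h2 hn z x = polar n x z := rfl

end Polar

section NormForm

open QuadraticMap

variable {R : Type*} [Ring R]

/-- A multiplicative anisotropic quadratic form with integral values. -/
structure NormForm (n : R → ℤ) : Prop where
  one : n 1 = 1
  eq_zero : ∀ r, n r = 0 → r = 0
  mul : ∀ r s, n (r * s) = n r * n s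
  parallelogram : ∀ r s, n (r + s) + n (r - s) = 2 * n r + 2 * n s

namespace NormForm

variable {n : R → ℤ} (h : NormForm n)

include h

lemma polar_add_left (x y z : R) : polar n (x + y) z = polar n x z + polar n y z :=
  polar_add_left_of_parallelogram two_ne_zero h.parallelogram x y z

lemma polar_sub_left (x y z : R) : polar n (x - y) z = polar n x z - polar n y z :=
  map_sub (polarHom two_ne_zero h.parallelogram z) x y

lemma polar_intCast_mul_left (k : ℤ) (x z : R) : polar n (k * x) z = k * polar n x z := by
  rw [← zsmul_eq_mul]
  exact map_zsmul (polarHom two_ne_zero h.parallelogram z) k x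

lemma polar_intCast_left (k : ℤ) (z : R) : polar n (k : R) z = k * polar n 1 z := by
  rw [← h.polar_intCast_mul_left, mul_one]

lemma polar_add_right (x y z : R) : polar n x (y + z) = polar n x y + polar n x z := by
  rw [polar_comm, h.polar_add_left, polar_comm n y, polar_comm n z]

lemma polar_self (x : R) : polar n x x = 2 * n x :=
  polar_self_of_parallelogram two_ne_zero h.parallelogram x

lemma map_intCast (k : ℤ) : n (k : R) = k ^ 2 := by
  have h1 := h.polar_self (k : R)
  rw [h.polar_intCast_left, polar_comm, h.polar_intCast_left, h.polar_self, h.one] at h1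
  linarith

lemma eq_zero_or_eq_zero {x y : R} (hxy : x * y = 0) : x = 0 ∨ y = 0 := by
  have h1 := h.mul x y
  rw [hxy, map_zero_of_parallelogram two_ne_zero h.parallelogram] at h1
  rcases mul_eq_zero.mp h1.symm with h2 | h2
  · exact .inl (h.eq_zero x h2)
  · exact .inr (h.eq_zero y h2)

lemma eq_zero_of_two_mul {x : R} (hx : 2 * x = 0) : x = 0 := by
  refine (h.eq_zero_or_eq_zero hx).resolve_left fun h2 => ?_
  have := h.map_intCast 2
  rw [Int.cast_ofNat, h2, map_zero_of_parallelogram two_ne_zero h.parallelogram] at this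
  norm_num at this

lemma polar_mul_mul_right (x y z : R) : polar n (x * z) (y * z) = polar n x y * n z := by
  rw [polar, polar, ← add_mul, h.mul, h.mul, h.mul]
  ring

lemma polar_mul_mul_left (x y z : R) : polar n (z * x) (z * y) = n z * polar n x y := by
  rw [polar, polar, ← mul_add, h.mul, h.mul, h.mul]
  ring

/-- This is the polarization in `z` of `polar n (x * z) z = polar n x 1 * n z`. -/
lemma polar_mul_left (x z w : R) :
    polar n (x * z) w + polar n (x * w) z = polar n x 1 * polar n z w := by
  have h1 := h.polar_mul_mul_right x 1 (z + w)
  have h2 := h.polar_mul_mul_right x 1 z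
  have h3 := h.polar_mul_mul_right x 1 w
  rw [one_mul, mul_add, h.polar_add_left, h.polar_add_right, h.polar_add_right] at h1
  rw [one_mul] at h2 h3
  rw [show polar n z w = n (z + w) - n z - n w from rfl]
  linear_combination h1 - h2 - h3

lemma polar_one_one : polar n 1 1 = 2 := by
  rw [h.polar_self, h.one, mul_one]

lemma trace_mul (x z : R) : polar n (x * z) 1 = polar n x 1 * polar n z 1 - polar n x z := by
  have := h.polar_mul_left x z 1
  rw [mul_one] at this
  linear_combination this

lemma trace_mul_comm (x z : R) : polar n (x * z) 1 = polar n (z * x) 1 := by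
  rw [h.trace_mul, h.trace_mul, polar_comm n x z, mul_comm]

/-- The difference of the two sides is orthogonal to every element, in particular to itself, so it
vanishes because `n` is anisotropic. -/
lemma mul_self (x : R) : x * x = (polar n x 1 : ℤ) * x - (n x : ℤ) := by
  have key : ∀ w, polar n (x * x - ((polar n x 1 : ℤ) * x - (n x : ℤ))) w = 0 := by
    intro w
    rw [h.polar_sub_left, h.polar_sub_left, h.polar_intCast_mul_left, h.polar_intCast_left]
    have h1 := h.polar_mul_left x x w
    have h2 := h.polar_mul_mul_left w 1 x
    rw [mul_one] at h2
    rw [polar_comm n 1 w]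
    linear_combination h1 - h2
  have h1 := key (x * x - ((polar n x 1 : ℤ) * x - (n x : ℤ)))
  rw [h.polar_self] at h1
  exact sub_eq_zero.mp (h.eq_zero _ (by linarith))

lemma mul_self_of_trace {x : R} (hx : polar n x 1 = 0) : x * x = -((n x : ℤ) : R) := by
  rw [h.mul_self, hx, Int.cast_zero, zero_mul, zero_sub]

/-- Elements of trace zero square to minus their norm, and `n (x + y) = n x + n y` by orthogonality;
expand the square of `x + y`. -/
lemma mul_eq_neg_mul {x y : R} (hx : polar n x 1 = 0) (hy : polar n y 1 = 0)
    (hxy : polar n x y = 0) : x * y = -(y * x) := by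
  have h1 := h.mul_self_of_trace (x := x + y) (by rw [h.polar_add_left, hx, hy, add_zero])
  have h2 : n (x + y) = n x + n y := by
    rw [polar] at hxy
    linarith
  rw [h2, Int.cast_add, mul_add, add_mul, add_mul, h.mul_self_of_trace hx,
    h.mul_self_of_trace hy] at h1
  rw [eq_neg_iff_add_eq_zero]
  have h3 : x * y + y * x = (-(n x : R) + y * x + (x * y + -(n y : R))) + (n x + n y) := by abel
  rw [h3, h1, neg_add_cancel]

/-- A complete orthogonal family determines the additive group. -/
lemma nonempty_addEquiv {a : ℕ} (v : Fin a → R) (hv : ∀ i, v i ≠ 0)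
    (horth : ∀ i j, i ≠ j → polar n (v i) (v j) = 0)
    (hcomplete : ∀ r, (∀ i, polar n r (v i) = 0) → r = 0) : Nonempty (R ≃+ (Fin a → ℤ)) := by
  -- The family need not span. Pairing with it embeds `R` in `ℤ ^ a`, so `R` is free of rank at most
  -- `a`, and the independence of the family gives rank at least `a`.
  let Φ : R →ₗ[ℤ] (Fin a → ℤ) :=
    LinearMap.pi fun i => (polarHom two_ne_zero h.parallelogram (v i)).toIntLinearMap
  have hΦ : Function.Injective Φ := by
    rw [injective_iff_map_eq_zero]
    exact fun r hr => hcomplete r fun i => congrFun hr i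
  have hfin : Module.Finite ℤ R := Module.Finite.of_injective Φ hΦ
  have hfree : Module.Free ℤ R := Module.Free.of_equiv (LinearEquiv.ofInjective Φ hΦ).symm
  have hli : LinearIndependent ℤ v := by
    rw [Fintype.linearIndependent_iff]
    intro g hg i
    have h1 := congrArg (polarHom two_ne_zero h.parallelogram (v i)) hg
    rw [map_sum, map_zero, Finset.sum_eq_single i] at h1
    · rw [map_zsmul, polarHom_apply, h.polar_self, smul_eq_mul] at h1
      rcases mul_eq_zero.mp h1 with h2 | h2
      · exact h2
      · exact absurd (h.eq_zero _ (by linarith)) (hv i)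
    · intro j _ hj
      rw [map_zsmul, polarHom_apply, horth j i hj, smul_zero]
    · simp
  have h1 := LinearMap.finrank_le_finrank_of_injective hΦ
  have h2 := hli.fintype_card_le_finrank
  rw [Module.finrank_fin_fun] at h1
  rw [Fintype.card_fin] at h2
  exact ⟨(Module.finBasisOfFinrankEq ℤ R (le_antisymm h1 h2)).equivFun.toAddEquiv⟩

lemma trace_two_mul_sub (r : R) : polar n (2 * r - (polar n r 1 : ℤ)) 1 = 0 := by
  have := h.polar_intCast_mul_left 2 r 1
  rw [Int.cast_ofNat] at this
  rw [h.polar_sub_left, h.polar_intCast_left, this, h.polar_one_one]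
  ring

/-- If `2 * r` were the integer `t`, then `4 * n r = t ^ 2` would make `t` even and `r` the integer
`t / 2`. -/
lemma two_mul_sub_ne_zero {r : R} (hr : ∀ k : ℤ, r ≠ k) : 2 * r - (polar n r 1 : ℤ) ≠ 0 := by
  intro h0
  have h1 := congrArg n (sub_eq_zero.mp h0)
  have h2 := h.map_intCast 2
  rw [Int.cast_ofNat] at h2
  rw [h.mul, h2, h.map_intCast] at h1
  obtain ⟨s, hs⟩ : (2 : ℤ) ∣ polar n r 1 := by
    apply Int.prime_two.dvd_of_dvd_pow (n := 2)
    rw [← h1]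
    exact ⟨2 * n r, by ring⟩
  refine hr s (sub_eq_zero.mp (h.eq_zero_of_two_mul ?_))
  rw [mul_sub, ← h0, hs]
  push_cast
  rfl

lemma nonempty_addEquiv_one (hr : ∀ r : R, ∃ k : ℤ, r = k) : Nonempty (R ≃+ (Fin 1 → ℤ)) := by
  refine h.nonempty_addEquiv (fun _ => 1) (fun _ h0 => ?_)
    (fun i j hij => absurd (Subsingleton.elim i j) hij) fun r h0 => ?_
  · have := h.one
    rw [h0, map_zero_of_parallelogram two_ne_zero h.parallelogram] at this
    exact zero_ne_one this
  · obtain ⟨k, rfl⟩ := hr r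
    have := h0 0
    rw [h.polar_intCast_left, h.polar_one_one] at this
    rw [show k = 0 by omega, Int.cast_zero]

lemma one_ne_zero : (1 : R) ≠ 0 := by
  intro h0
  have := h.one
  rw [h0, map_zero_of_parallelogram two_ne_zero h.parallelogram] at this
  exact zero_ne_one this

/-- The family is `1` and `i = 2 * r - tr r`. An element orthogonal to both anticommutes with `i`;
as it also commutes with `i`, it is zero. -/
lemma nonempty_addEquiv_two (hcomm : ∀ r s : R, r * s = s * r) {r : R} (hr : ∀ k : ℤ, r ≠ k) :
    Nonempty (R ≃+ (Fin 2 → ℤ)) := by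
  obtain ⟨i, hi, hi0⟩ : ∃ i : R, polar n i 1 = 0 ∧ i ≠ 0 :=
    ⟨_, h.trace_two_mul_sub r, h.two_mul_sub_ne_zero hr⟩
  refine h.nonempty_addEquiv ![1, i] ?_ ?_ fun s hs => ?_
  · intro l
    fin_cases l
    exacts [h.one_ne_zero, hi0]
  · intro l m hlm
    fin_cases l <;> fin_cases m
    exacts [absurd rfl hlm, (polar_comm n 1 i).trans hi, hi, absurd rfl hlm]
  · have h1 := h.mul_eq_neg_mul (hs 0) hi (hs 1)
    rw [hcomm i s, eq_neg_iff_add_eq_zero, ← two_mul] at h1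
    exact (h.eq_zero_or_eq_zero (h.eq_zero_of_two_mul h1)).resolve_right hi0

/-- The family is `1, i, j, i * j` with `i` and `j` orthogonal of trace zero. An element orthogonal
to all four anticommutes with `i`, `j` and `i * j`; the first two make it commute with `i * j`, so
it is zero. -/
lemma nonempty_addEquiv_four {r s : R} (hrs : r * s ≠ s * r) :
    Nonempty (R ≃+ (Fin 4 → ℤ)) := by
  obtain ⟨i, hi, his⟩ : ∃ i : R, polar n i 1 = 0 ∧ i * s ≠ s * i := by
    refine ⟨_, h.trace_two_mul_sub r, fun h0 => hrs ?_⟩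
    rw [sub_mul, mul_sub, Int.cast_comm, sub_left_inj, mul_assoc, ← mul_assoc s,
      (Commute.ofNat_right s 2).eq, mul_assoc] at h0
    exact sub_eq_zero.mp (h.eq_zero_of_two_mul (by rw [mul_sub, h0, sub_self]))
  -- The commutator of `i` and `s` has trace zero and is orthogonal to `i`, because the trace is
  -- invariant under exchanging factors.
  obtain ⟨j, hj, hj0, hij⟩ : ∃ j : R, polar n j 1 = 0 ∧ j ≠ 0 ∧ polar n i j = 0 := by
    have ht : polar n (i * s - s * i) 1 = 0 := by
      rw [h.polar_sub_left, h.trace_mul_comm, sub_self]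
    refine ⟨i * s - s * i, ht, sub_ne_zero.mpr his, ?_⟩
    have h1 := h.trace_mul i (i * s - s * i)
    rw [ht, mul_zero, mul_sub, h.polar_sub_left, ← mul_assoc i s i, h.trace_mul_comm (i * s) i,
      sub_self] at h1
    linarith
  have hi0 : i ≠ 0 := by
    rintro rfl
    simp at his
  have hanti := h.mul_eq_neg_mul hi hj hij
  have hk : polar n (i * j) 1 = 0 := by
    rw [h.trace_mul, hi, hij, zero_mul, sub_zero]
  have hki : polar n (i * j) i = 0 := by
    have h1 := h.trace_mul (i * j) i
    rw [hk, zero_mul, h.trace_mul_comm, ← mul_assoc, h.mul_self_of_trace hi, ← Int.cast_neg,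
      h.polar_intCast_mul_left, hj, mul_zero] at h1
    linarith
  have hkj : polar n (i * j) j = 0 := by
    have h1 := h.trace_mul (i * j) j
    rw [hk, zero_mul, mul_assoc, h.mul_self_of_trace hj, ← Int.cast_neg, ← Int.cast_comm,
      h.polar_intCast_mul_left, hi, mul_zero] at h1
    linarith
  have hk0 : i * j ≠ 0 := fun h0 => (h.eq_zero_or_eq_zero h0).elim hi0 hj0
  refine h.nonempty_addEquiv ![1, i, j, i * j] ?_ ?_ fun t ht => ?_
  · intro l
    fin_cases l
    exacts [h.one_ne_zero, hi0, hj0, hk0]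
  · intro l m hlm
    fin_cases l <;> fin_cases m
    exacts [absurd rfl hlm, (polar_comm n 1 i).trans hi, (polar_comm n 1 j).trans hj,
      (polar_comm n 1 _).trans hk, hi, absurd rfl hlm, hij, (polar_comm n i _).trans hki, hj,
      (polar_comm n j i).trans hij, absurd rfl hlm, (polar_comm n j _).trans hkj, hk, hki, hkj,
      absurd rfl hlm]
  · have h0 := ht 0
    have h1 := h.mul_eq_neg_mul h0 hi (ht 1)
    have h2 := h.mul_eq_neg_mul h0 hj (ht 2)
    have h3 := h.mul_eq_neg_mul h0 hk (ht 3)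
    rw [← mul_assoc, h1, neg_mul, mul_assoc, h2, mul_neg, neg_neg, ← mul_assoc,
      eq_neg_iff_add_eq_zero, ← two_mul] at h3
    exact (h.eq_zero_or_eq_zero (h.eq_zero_of_two_mul h3)).resolve_left hk0

/-- A second multiplicative form that is the square of a linear form forces commutativity. -/
lemma mul_comm_of_rank_one {L : Type*} [Field L] [CharZero L] {κ : R → L} (h1 : κ 1 = 1)
    (hmul : ∀ r s, κ (r * s) = κ r * κ s)
    (hpar : ∀ r s, κ (r + s) + κ (r - s) = 2 * κ r + 2 * κ s)
    (hprod : ∀ r s, κ (r + s) * κ (r - s) = (κ r - κ s) ^ 2) (r s : R) : r * s = s * r := by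
  have h2 : (2 : L) ≠ 0 := two_ne_zero
  -- The homomorphism `c` is twice the linear form whose square is `κ`.
  let c : R →+ L := polarHom h2 hpar 1
  have hc : ∀ x, c x = κ (x + 1) - κ x - 1 := fun x => by
    change polar κ x 1 = _
    rw [polar, h1]
  have hc1 : c 1 = 2 := by
    change polar κ 1 1 = _
    rw [polar_self_of_parallelogram h2 hpar, h1, mul_one]
  have hsq : ∀ x, c x ^ 2 = 4 * κ x := by
    intro x
    have e1 := hpar x 1
    have e2 := hprod x 1
    rw [h1] at e1 e2
    rw [hc]
    linear_combination κ (x + 1) * e1 - e2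
  -- From `c ^ 2 = 4 * κ`, multiplicativity of `c / 2` is clear up to sign; comparing the values at
  -- `x * y` and at `(1 + x) * y` settles the sign.
  have hcmul : ∀ x y, 2 * c (x * y) = c x * c y := by
    intro x y
    have e1 := hsq (x * y)
    have e2 := hsq ((1 + x) * y)
    have e3 := hsq (1 + x)
    rw [hmul] at e1 e2
    rw [add_mul, one_mul, map_add] at e2
    rw [map_add, hc1] at e3
    have ex := hsq x
    have ey := hsq y
    by_cases hy : c y = 0
    · rw [hy] at ey
      have hκ : κ y = 0 := by
        have : (4 : L) * κ y = 0 := by linear_combination -ey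
        exact (mul_eq_zero.mp this).resolve_left (by norm_num)
      rw [hκ, mul_zero, mul_zero] at e1
      rw [hy, pow_eq_zero_iff two_ne_zero |>.mp e1, mul_zero, mul_zero]
    · apply mul_left_cancel₀ hy
      linear_combination e2 - e1 - κ y * e3 + κ y * ex - (1 + c x) * ey
  -- The integer `n x` is a multiple of `x`, so `c` kills it together with `x`; in characteristic
  -- zero this forces `n x = 0`.
  have hinj : ∀ x, c x = 0 → x = 0 := by
    intro x hx
    have e := h.mul_self x
    have e1 : ((n x : ℤ) : R) = ((polar n x 1 : ℤ) - x) * x := by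
      rw [sub_mul, e]
      abel
    have e2 := hcmul ((polar n x 1 : ℤ) - x) x
    rw [hx, mul_zero, ← e1, ← zsmul_one, map_zsmul, hc1] at e2
    have e3 : ((n x : ℤ) : L) = 0 := by
      rw [zsmul_eq_mul] at e2
      have : (4 : L) * (n x : L) = 0 := by linear_combination e2
      exact (mul_eq_zero.mp this).resolve_left (by norm_num)
    exact h.eq_zero x (by exact_mod_cast e3)
  refine sub_eq_zero.mp (hinj _ (mul_left_cancel₀ h2 ?_))
  rw [map_sub, mul_sub, hcmul, hcmul]
  ring

end NormForm

end NormForm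

/-! ### The endomorphism ring and the exact sequence -/

section EndRing

variable {k : Type*} [Field k] {L : Type*} [Field L] [Algebra k L]

lemma IsMor.extendScalars {C : Affine L} {φ : C.Point → C.Point} (hφ : IsMor k C φ) :
    IsMor L C φ := by
  have he : ∀ (f : Fin 3 → MvPolynomial (Fin 3) k) (Q : C.Point),
      evalTriple (fun i => MvPolynomial.map (algebraMap k L) (f i)) (coords Q) =
        evalTriple f (coords Q) := fun f Q =>
    funext fun i => MvPolynomial.aeval_map_algebraMap L (coords Q) (f i)
  intro P
  obtain ⟨f, h0, ⟨d, hd⟩, hf⟩ := hφ P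
  refine ⟨fun i => MvPolynomial.map (algebraMap k L) (f i), by rwa [he],
    ⟨d, fun i => (hd i).map _⟩, fun Q hQ => ?_⟩
  rw [he] at hQ ⊢
  exact hf Q hQ

end EndRing

section EndOf

variable {k : Type*} [Field k] (E : Affine k) [E.IsElliptic]

/-- The morphisms over `k` among the group endomorphisms of `E(L)`. -/
def endRing (L : Type*) [Field L] [Algebra k L] [IsAlgClosed L] [DecidableEq L] :
    Subring (AddMonoid.End (E⁄L).Point) where
  carrier := {r | IsMor k (E⁄L) r}
  mul_mem' hr hs := hr.comp hs
  one_mem' := isMor_id _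
  add_mem' hr hs := by classical exact hr.add hs
  zero_mem' := by classical exact isMor_const 0
  neg_mem' hr := by classical exact hr.neg

variable {E} {L : Type*} [Field L] [Algebra k L] [IsAlgClosed L] [DecidableEq L]

lemma exists_mem_endRing {φ : (E⁄L).Point → (E⁄L).Point} (hφ : IsMor k (E⁄L) φ) (h0 : φ 0 = 0) :
    ∃ r ∈ endRing E L, ⇑r = φ :=
  ⟨AddMonoidHom.mk' φ (hφ.extendScalars.map_add' h0), hφ, rfl⟩

variable (E L) in
lemma exists_normForm : ∃ (n : endRing E L → ℤ) (κ : endRing E L → L), NormForm n ∧ κ 1 = 1 ∧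
    (∀ r s, κ (r * s) = κ r * κ s) ∧ (∀ r s, κ (r + s) + κ (r - s) = 2 * κ r + 2 * κ s) ∧
    (∀ r s, κ (r + s) * κ (r - s) = (κ r - κ s) ^ 2) := by
  obtain ⟨N, κ, h1, h2, h3, h4, h5, h6, h7, h8⟩ := exists_degree_form (R := endRing E L)
    fun r hr => exists_xRep hr.extendScalars (map_zero r)
  refine ⟨fun r => N r, κ, ⟨?_, fun r hr => h2 r ?_, fun r s => ?_, fun r s => ?_⟩, h5, h6, h7, h8⟩
  · exact_mod_cast h1
  · exact_mod_cast hr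
  · exact_mod_cast h3 r s
  · exact_mod_cast h4 r s

variable [DecidableEq k] [DecidableEq E.FunctionField]

lemma isMor_pointMap_sub (g : (E⁄E.FunctionField).Point) :
    IsMor k (E⁄L) fun P => pointMap E g P - pointMap E g 0 := by
  have h := (isMor_pointMap (L := L) g).add (isMor_const (-pointMap E g (0 : (E⁄k).Point)))
  rw [map_neg, ← pointMap_zero_eq_baseChange] at h
  simpa only [← sub_eq_add_neg] using h

variable (E L) in
/-- The endomorphism from which a rational map from `E` to `E` differs by a constant. -/
noncomputable def endOf : (E⁄E.FunctionField).Point →+ endRing E L :=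
  AddMonoidHom.mk' (fun g => ⟨AddMonoidHom.mk' (fun P => pointMap E g P - pointMap E g 0)
    ((isMor_pointMap_sub g).extendScalars.map_add' (sub_self _)), isMor_pointMap_sub g⟩)
    fun g g' => by
    refine Subtype.ext (AddMonoidHom.ext fun P => ?_)
    change pointMap E (g + g') P - pointMap E (g + g') 0 =
      pointMap E g P - pointMap E g 0 + (pointMap E g' P - pointMap E g' 0)
    rw [pointMap_add, pointMap_add]
    abel

lemma endOf_apply (g : (E⁄E.FunctionField).Point) (P : (E⁄L).Point) :
    (endOf E L g : AddMonoid.End (E⁄L).Point) P = pointMap E g P - pointMap E g 0 := rfl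

lemma endOf_add_baseChange (g : (E⁄E.FunctionField).Point) (P : (E⁄L).Point) :
    (endOf E L g : AddMonoid.End (E⁄L).Point) P +
      Affine.Point.baseChange k L (pointMap E g (0 : (E⁄k).Point)) = pointMap E g P := by
  rw [endOf_apply, ← pointMap_zero_eq_baseChange, sub_add_cancel]

/-- When `endOf` kills `g`, the map `pointMap E g` is constant, equal to its rational value at the
origin, and `pointMap_injective` identifies `g` with that constant. -/
lemma endOf_exact :
    Function.Exact (Affine.Point.baseChange (W' := E) k E.FunctionField) (endOf E L) := by
  intro g
  constructor
  · intro h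
    refine ⟨pointMap E g (0 : (E⁄k).Point), pointMap_injective E L (funext fun P => ?_)⟩
    rw [pointMap_baseChange, ← endOf_add_baseChange g P, h]
    exact (zero_add _).symm
  · rintro ⟨c, rfl⟩
    refine Subtype.ext (AddMonoidHom.ext fun P => ?_)
    refine (endOf_apply _ P).trans ?_
    rw [pointMap_baseChange, pointMap_baseChange]
    exact sub_self _

lemma endOf_surjective : Function.Surjective (endOf E L) := by
  rintro ⟨r, hr⟩
  obtain ⟨g, hg⟩ := exists_pointMap_eq hr
  refine ⟨g, Subtype.ext (AddMonoidHom.ext fun P => ?_)⟩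
  refine (endOf_apply g P).trans ?_
  rw [hg]
  exact (congrArg (r P - ·) (map_zero r)).trans (sub_zero _)

end EndOf

/-- An extension of a finite free abelian group splits. -/
lemma nonempty_addEquiv_prod {A B C : Type*} [AddCommGroup A] [AddCommGroup B] [AddCommGroup C]
    {f : A →+ B} {g : B →+ C} (hf : Function.Injective f) (hfg : Function.Exact f g)
    (hg : Function.Surjective g) {a : ℕ} (e : C ≃+ (Fin a → ℤ)) :
    Nonempty (B ≃+ A × (Fin a → ℤ)) := by
  have : Module.Free ℤ C := Module.Free.of_equiv e.symm.toIntLinearEquiv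
  obtain ⟨s, hs⟩ := Module.projective_lifting_property g.toIntLinearMap LinearMap.id hg
  have hs' : ∀ c, g (s c) = c := fun c => LinearMap.congr_fun hs c
  have hgf : ∀ x, g (f x) = 0 := fun x => (hfg _).mpr ⟨x, rfl⟩
  let F : A × C →+ B := f.coprod s.toAddMonoidHom
  have hF : ∀ x, F x = f x.1 + s x.2 := fun x => rfl
  have hbij : Function.Bijective F := by
    refine ⟨(injective_iff_map_eq_zero _).mpr fun x hx => ?_, fun b => ?_⟩
    · rw [hF] at hx
      have h2 : x.2 = 0 := by
        have := congrArg g hx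
        rwa [map_add, hgf, zero_add, hs', map_zero] at this
      rw [h2, map_zero, add_zero] at hx
      exact Prod.ext ((injective_iff_map_eq_zero f).mp hf _ hx) h2
    · obtain ⟨x, hx⟩ := (hfg (b - s (g b))).mp (by rw [map_sub, hs', sub_self])
      exact ⟨(x, g b), by rw [hF, hx, sub_add_cancel]⟩
  exact ⟨(AddEquiv.ofBijective F hbij).symm.trans ((AddEquiv.refl A).prodCongr e)⟩

end EllipticEnd

theorem mainTheorem2 {K : Type*} [Field K] (E : WeierstrassCurve.Affine K) [E.IsElliptic]
    [DecidableEq K] [DecidableEq (AlgebraicClosure K)] [DecidableEq E.FunctionField] :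
    -- the endomorphisms of `E` over `K` form a ring `R`, namely `End_K(E)`
    ∃ R : Subring (AddMonoid.End (E⁄(AlgebraicClosure K)).Point),
      EllipticEnd.IsEndRing E R ∧
      -- the exact sequence `0 → E(K) → E(K(E)) → End_K(E) → 0`: its first map is the inclusion
      -- of the constant maps, and its second map sends a rational map from `E` to `E` to the
      -- endomorphism from which it differs by a constant in `E(K)`
      (∃ ρ : (E⁄E.FunctionField).Point →+ R,
        (∀ g : (E⁄E.FunctionField).Point, ∃ c : (E⁄K).Point,
          EllipticEnd.Represents E g fun P =>
            (ρ g : AddMonoid.End (E⁄(AlgebraicClosure K)).Point) P +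
              WeierstrassCurve.Affine.Point.baseChange K (AlgebraicClosure K) c) ∧
        Function.Injective
          (WeierstrassCurve.Affine.Point.baseChange (W' := E) K E.FunctionField) ∧
        Function.Exact
          (WeierstrassCurve.Affine.Point.baseChange (W' := E) K E.FunctionField) ρ ∧
        Function.Surjective ρ) ∧
      -- the rank of `End_K(E)`; the noncommutative case cannot occur in characteristic zero
      (CharZero K → ∀ r s : R, r * s = s * r) ∧
      ∃ a : ℕ,
        (¬ EllipticEnd.HasCM R → a = 1) ∧
        (EllipticEnd.HasCM R → (∀ r s : R, r * s = s * r) → a = 2) ∧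
        ((¬ ∀ r s : R, r * s = s * r) → a = 4) ∧
        Nonempty (R ≃+ (Fin a → ℤ)) ∧
        Nonempty ((E⁄E.FunctionField).Point ≃+ (E⁄K).Point × (Fin a → ℤ)) := by
  open EllipticEnd WeierstrassCurve in
  obtain ⟨n, κ, hn, h1, hmul, hpar, hprod⟩ := exists_normForm E (AlgebraicClosure K)
  have hinj := Affine.Point.map_injective (W' := E) (Algebra.ofId K E.FunctionField)
  have hrank : ∀ {a : ℕ}, Nonempty (endRing E (AlgebraicClosure K) ≃+ (Fin a → ℤ)) →
      Nonempty (endRing E (AlgebraicClosure K) ≃+ (Fin a → ℤ)) ∧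
        Nonempty ((E⁄E.FunctionField).Point ≃+ (E⁄K).Point × (Fin a → ℤ)) :=
    fun h => ⟨h, h.elim (nonempty_addEquiv_prod hinj endOf_exact endOf_surjective)⟩
  refine ⟨endRing E (AlgebraicClosure K), fun φ => ⟨fun h => exists_mem_endRing h.1 h.2, ?_⟩,
    ⟨endOf E (AlgebraicClosure K), fun g => ⟨pointMap E g (0 : (E⁄K).Point), ?_⟩, hinj,
      endOf_exact, endOf_surjective⟩, fun hK => ?_, ?_⟩
  · rintro ⟨r, hr, rfl⟩
    exact ⟨hr, map_zero r⟩
  · obtain ⟨f, hf, hg, -⟩ := exists_forms_pointMap g (0 : (E⁄(AlgebraicClosure K)).Point)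
    rw [funext (endOf_add_baseChange g)]
    exact ⟨f, hg, computesOver_pointMap hf hg⟩
  · have : CharZero (AlgebraicClosure K) :=
      charZero_of_injective_algebraMap (algebraMap K (AlgebraicClosure K)).injective
    exact hn.mul_comm_of_rank_one h1 hmul hpar hprod
  · by_cases hcomm : ∀ r s : endRing E (AlgebraicClosure K), r * s = s * r
    · by_cases hCM : HasCM (endRing E (AlgebraicClosure K))
      · exact ⟨2, (absurd hCM ·), fun _ _ => rfl, (absurd hcomm ·),
          hrank (hCM.elim fun r hr => hn.nonempty_addEquiv_two hcomm hr)⟩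
      · refine ⟨1, fun _ => rfl, fun h => absurd h hCM, (absurd hcomm ·),
          hrank (hn.nonempty_addEquiv_one fun r => ?_)⟩
        by_contra! hr
        exact hCM ⟨r, hr⟩
    · refine ⟨4, fun hCM => absurd (fun r s => ?_) hcomm, fun _ h => absurd h hcomm, fun _ => rfl,
        hrank ?_⟩
      -- Integers are central, so an element that fails to commute with another one already provides
      -- complex multiplication.
      · by_contra hrs
        refine hCM ⟨r, fun m hm => hrs ?_⟩
        rw [hm, Int.cast_comm]
      · push Not at hcomm
        obtain ⟨r, s, hrs⟩ := hcomm
        exact hn.nonempty_addEquiv_four hrs
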